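/- Let $M$ be a connected smooth 4-dimensional manifold with a smooth metric $g$ of signature $(-,+,+,+)$, Levi-Civita connection $\nabla$ and Riemann tensor $R$. Let $\{e_a\}_{a=0}^3$ be a Riemann-frame ($R$-frame), that is, a smooth orthonormal frame on $M$ that is locally determined by the metric, the Riemann tensor and finitely many of its covariant derivatives, in the following sense: every point of $M$ has a neighbourhood $U$ for which there are an integer $m\ge 0$ and a neighbourhood $N$ of the identity matrix such that, whenever $q,q'\in U$ and $L:T_qM\to T_{q'}M$ is a linear isometry which maps $(\nabla^kR)_q$ to $(\nabla^kR)_{q'}$ for all $0\le k\le m$ and whose matrix $\Lambda$, given by $L e_a(q)=\sum_b\Lambda_{ba}e_b(q')$, lies in $N$, one has $L e_a(q)=e_a(q')$ for all $a$. Let $\{\theta^a\}$ be the dual basis, let $\gamma^c_{ab}$ be the connection coefficients of the frame, $\nabla e_a=\gamma^c_{ab}\,\theta^b\otimes e_c$, let $H=\gamma^c_{ab}\,\theta^b\otimes\theta^a\otimes e_c$ be its connection tensor, and let $$C^{[1]}(H)_{\alpha\mu\nu\sigma}=\nabla_\alpha H_{\mu\nu\sigma}+{H_{\alpha\mu}}^{\rho}H_{\rho\nu\sigma}+{H_{\alpha\nu}}^{\rho}H_{\mu\rho\sigma}+{H_{\alpha\sigma}}^{\rho}H_{\mu\nu\rho}$$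 be the first differential concomitant of $H$. Then the following are equivalent: 1. $g$ admits a 4-dimensional local isometry group $G_4$: every point has an open neighbourhood $U$ such that, for each connected open neighbourhood $V\subseteq U$ of that point, the Lie algebra of the smooth Killing fields on $V$ has dimension exactly $4$; 2. $C^{[1]}(H)=0$ on $M$; 3. $g$ is locally homogeneous: at every point the Killing fields defined on some neighbourhood of it span the tangent space; 4. all the connection coefficients $\gamma^c_{ab}$ are constant on $M$. -/

import Mathlib

open scoped Manifold ContDiff Topology
open Bundle

noncomputable section

namespace Spacetime

universe u

section Basic

variable (M : Type u) [TopologicalSpace M] [ChartedSpace (EuclideanSpace ℝ (Fin 4)) M]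

/-- (Rough) vector fields on the `4`-manifold `M`. -/
abbrev VField : Type u := (x : M) → TangentSpace (𝓡 4) x

variable {M} [IsManifold (𝓡 4) ∞ M]

/-- The vector field `X` is of class `C^∞` on the set `s`. -/
def SmoothOn (X : VField M) (s : Set M) : Prop :=
  ContMDiffOn (𝓡 4) (𝓡 4).tangent ∞ (fun x => (⟨x, X x⟩ : TangentBundle (𝓡 4) M)) s

/-- The vector field `X` is of class `C^∞` on `M`. -/
def Smooth (X : VField M) : Prop :=
  ContMDiff (𝓡 4) (𝓡 4).tangent ∞ (fun x => (⟨x, X x⟩ : TangentBundle (𝓡 4) M))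

/-- The vector field `X` is differentiable at the point `x`. -/
def DiffAt (X : VField M) (x : M) : Prop :=
  MDifferentiableAt (𝓡 4) (𝓡 4).tangent (fun y => (⟨y, X y⟩ : TangentBundle (𝓡 4) M)) x

/-- The derivative `X(f)` of the function `f` along the vector field `X`. -/
def dirDeriv (X : VField M) (f : M → ℝ) : M → ℝ :=
  fun x => mvfderiv (𝓡 4) f x (X x)

/-- The Lie bracket `[X, Y]`. -/
def bracket (X Y : VField M) : VField M :=
  VectorField.mlieBracket (𝓡 4) X Y

end Basic

/-- The signature symbol `diag(-1, 1, 1, 1)`, as a list of signs. -/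
def sgn (a : Fin 4) : ℝ := if a = 0 then -1 else 1

/-- The signature symbol `diag(-1, 1, 1, 1)`, as a matrix. -/
def etaMat : Matrix (Fin 4) (Fin 4) ℝ := Matrix.diagonal sgn

/-- A smooth metric of signature `(-,+,+,+)` on the `4`-manifold `M`. -/
structure LorentzMetric (M : Type u) [TopologicalSpace M]
    [ChartedSpace (EuclideanSpace ℝ (Fin 4)) M] [IsManifold (𝓡 4) ∞ M] where
  /-- The scalar product on each tangent space. -/
  val (x : M) : TangentSpace (𝓡 4) x →L[ℝ] TangentSpace (𝓡 4) x →L[ℝ] ℝ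
  symm (x : M) (v w : TangentSpace (𝓡 4) x) : val x v w = val x w v
  signature (x : M) : ∃ b : Module.Basis (Fin 4) ℝ (TangentSpace (𝓡 4) x),
    ∀ i j, val x (b i) (b j) = etaMat i j
  contMDiff : ContMDiff (𝓡 4)
    ((𝓡 4).prod 𝓘(ℝ, EuclideanSpace ℝ (Fin 4) →L[ℝ] EuclideanSpace ℝ (Fin 4) →L[ℝ] ℝ)) ∞
    (fun x => TotalSpace.mk'
      (EuclideanSpace ℝ (Fin 4) →L[ℝ] EuclideanSpace ℝ (Fin 4) →L[ℝ] ℝ) x (val x))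

variable {M : Type u} [TopologicalSpace M] [ChartedSpace (EuclideanSpace ℝ (Fin 4)) M]
  [IsManifold (𝓡 4) ∞ M]

namespace LorentzMetric

variable (g : LorentzMetric M)

/-- The function `g(X, Y)`. -/
def inn (X Y : VField M) : M → ℝ := fun x => g.val x (X x) (Y x)

/-! ### The Levi-Civita connection and the curvature -/

/-- The right-hand side of the Koszul formula for `2 g(∇_X Y, Z)`. -/
def koszul (X Y Z : VField M) : M → ℝ := fun x =>
  dirDeriv X (g.inn Y Z) x + dirDeriv Y (g.inn Z X) x - dirDeriv Z (g.inn X Y) x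
    + g.inn (bracket X Y) Z x - g.inn (bracket X Z) Y x - g.inn (bracket Y Z) X x

/-- The Levi-Civita connection `∇_X Y`: at each point `x` it is the vector `w` with
`2 g(w, Z) = koszul X Y Z` for all vector fields `Z` differentiable at `x`. -/
def nabla (X Y : VField M) : VField M := fun x =>
  Classical.epsilon fun w : TangentSpace (𝓡 4) x =>
    ∀ Z : VField M, DiffAt Z x → 2 * g.val x w (Z x) = g.koszul X Y Z x

theorem mdifferentiableAt_inn {X Y : VField M} {x : M} (hX : DiffAt X x) (hY : DiffAt Y x) :
    MDifferentiableAt (𝓡 4) 𝓘(ℝ, ℝ) (g.inn X Y) x := by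
  have h0 := (g.contMDiff x).mdifferentiableAt (by simp)
  have h1 := MDifferentiableAt.clm_bundle_apply₂ (F₁ := EuclideanSpace ℝ (Fin 4))
    (F₂ := EuclideanSpace ℝ (Fin 4)) (F₃ := ℝ) (E₃ := fun _ : M => ℝ) h0 hX hY
  exact (mdifferentiableAt_totalSpace _ _).1 h1 |>.2

theorem koszul_tensorialAt {X Y : VField M} {x : M} (hX : DiffAt X x) (hY : DiffAt Y x) :
    TensorialAt (𝓡 4) (EuclideanSpace ℝ (Fin 4)) (fun Z : VField M => g.koszul X Y Z x) x where
  smul {f Z} hf hZ := by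
    have a1 : g.inn Y (f • Z) = fun y => f y * g.inn Y Z y := by ext y; simp [inn]
    have a2 : g.inn (f • Z) X = fun y => f y * g.inn Z X y := by ext y; simp [inn]
    simp only [koszul, a1, a2, dirDeriv, mvfderiv_fun_mul hf (g.mdifferentiableAt_inn hY hZ), mvfderiv_fun_mul hf (g.mdifferentiableAt_inn hZ hX)]
    simp only [inn, bracket, VectorField.mlieBracket_smul_right hf hZ]
    simp only [Pi.smul_apply', map_smul, map_add, smul_eq_mul, add_apply, smul_apply,
      g.symm x (Z x) (Y x), g.symm x (Z x) (X x)]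
    ring
  add {Z W} hZ hW := by
    have a1 : g.inn Y (Z + W) = fun y => g.inn Y Z y + g.inn Y W y := by ext y; simp [inn]
    have a2 : g.inn (Z + W) X = fun y => g.inn Z X y + g.inn W X y := by ext y; simp [inn]
    simp only [koszul, a1, a2, dirDeriv, mvfderiv_fun_add (g.mdifferentiableAt_inn hY hZ) (g.mdifferentiableAt_inn hY hW), mvfderiv_fun_add (g.mdifferentiableAt_inn hZ hX) (g.mdifferentiableAt_inn hW hX)]
    simp only [inn, bracket, VectorField.mlieBracket_add_right hZ hW]
    simp
    ring

theorem exists_val_eq (x : M) (φ : TangentSpace (𝓡 4) x → ℝ) (hφ : IsLinearMap ℝ φ) :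
    ∃ w, ∀ v, g.val x w v = φ v := by
  obtain ⟨b, hb⟩ := g.signature x
  refine ⟨∑ i, (sgn i * φ (b i)) • b i, fun v => ?_⟩
  let A : TangentSpace (𝓡 4) x →ₗ[ℝ] ℝ := (g.val x (∑ i, (sgn i * φ (b i)) • b i)).toLinearMap
  have : A = hφ.mk' φ := by
    apply b.ext
    intro j
    simp [A, hb, etaMat, Matrix.diagonal_apply]
    by_cases h : j = 0 <;> simp [sgn, h]
  exact LinearMap.congr_fun this v

/-- The defining property of the Levi-Civita connection: the vector sought for exists. -/
theorem nabla_spec {X Y Z : VField M} {x : M} (hX : DiffAt X x) (hY : DiffAt Y x)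
    (hZ : DiffAt Z x) : 2 * g.inn (g.nabla X Y) Z x = g.koszul X Y Z x := by
  have := Classical.epsilon_spec (p := fun w : TangentSpace (𝓡 4) x =>
    ∀ Z : VField M, DiffAt Z x → 2 * g.val x w (Z x) = g.koszul X Y Z x) (by
    let L := TensorialAt.mkHom _ x (g.koszul_tensorialAt hX hY)
    obtain ⟨w, hw⟩ := g.exists_val_eq x (fun v => L v / 2) ⟨fun a b => by simp; ring, fun a b => by simp; ring⟩
    refine ⟨w, fun Z hZ => ?_⟩
    rw [hw, mul_div_cancel₀ _ two_ne_zero]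
    exact TensorialAt.mkHom_apply (g.koszul_tensorialAt hX hY) hZ)
  exact this Z hZ

/-- The covariant derivative of a `k`-times covariant tensor field `T`, a tensor field being
regarded as a multilinear map on vector fields. The first argument of `∇T` is the direction of
differentiation. -/
def nablaT {k : ℕ} (T : (Fin k → VField M) → M → ℝ) : (Fin (k + 1) → VField M) → M → ℝ :=
  fun X x => dirDeriv (X 0) (T (Fin.tail X)) x
    - ∑ i : Fin k, T (Function.update (Fin.tail X) i (g.nabla (X 0) (X i.succ))) x

/-- The Riemann curvature operator `R(X, Y) Z`. -/
def curv (X Y Z : VField M) : VField M :=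
  g.nabla X (g.nabla Y Z) - g.nabla Y (g.nabla X Z) - g.nabla (bracket X Y) Z

/-- The Riemann tensor and its successive covariant derivatives: `nablaRiem g k` is the
`(k + 4)`-times covariant tensor field `∇^k R`. -/
def nablaRiem : (k : ℕ) → (Fin (k + 4) → VField M) → M → ℝ
  | 0 => fun X => g.inn (g.curv (X 0) (X 1) (X 2)) (X 3)
  | k + 1 => g.nablaT (nablaRiem k)

/-! ### Frames, the connection tensor and its first differential concomitant -/

/-- The frame `e` is (smooth and) orthonormal: `g(e_a, e_b) = diag(-1, 1, 1, 1)`. -/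
structure IsOrthonormalFrame (e : Fin 4 → VField M) : Prop where
  smooth : ∀ a, Smooth (e a)
  orthonormal : ∀ a b x, g.inn (e a) (e b) x = etaMat a b

/-- The frame `e` rotated by the constant matrix `Λ`: the `a`-th vector is `∑_b Λ_ba e_b`. -/
def rotate (Λ : Matrix (Fin 4) (Fin 4) ℝ) (e : Fin 4 → VField M) : Fin 4 → VField M :=
  fun a x => ∑ b, Λ b a • e b x

/-- A Riemann-frame: an orthonormal frame that is locally determined by the metric, the Riemann
tensor and finitely many of its covariant derivatives. Let `q`, `q'` be close to a given point.
A linear isometry `T_q M → T_q' M` sends `e_a(q)` to `(rotate Λ e)_a(q')`, with `Λ` a Lorentz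
matrix; if it maps `∇^k R` at `q` to `∇^k R` at `q'` for all `k ≤ m`, and if `Λ` is close to `1`
(so that discrete choices, such as the sign of an eigenvector or the order of the eigenvectors,
do not matter), then it must send `e_a(q)` to `e_a(q')`. -/
structure IsRiemannFrame (e : Fin 4 → VField M) : Prop extends g.IsOrthonormalFrame e where
  determined : ∀ p : M, ∃ m : ℕ, ∃ U ∈ 𝓝 p, ∃ N ∈ 𝓝 (1 : Matrix (Fin 4) (Fin 4) ℝ),
    ∀ q ∈ U, ∀ q' ∈ U, ∀ Λ ∈ N, Λ.transpose * etaMat * Λ = etaMat →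
      (∀ k ≤ m, ∀ a : Fin (k + 4) → Fin 4,
        g.nablaRiem k (fun i => rotate Λ e (a i)) q' = g.nablaRiem k (fun i => e (a i)) q) →
      Λ = 1

/-- The algebraic dual basis `θ^a` of an orthonormal frame: `θ^a(X) = ± g(e_a, X)`. -/
def coframe (e : Fin 4 → VField M) (a : Fin 4) (X : VField M) : M → ℝ :=
  fun x => sgn a * g.inn (e a) X x

/-- The connection coefficients `γ^c_{ab} = θ^c(∇_{e_b} e_a)`, i.e.
`∇ e_a = γ^c_{ab} θ^b ⊗ e_c`. -/
def connCoeff (e : Fin 4 → VField M) (c a b : Fin 4) : M → ℝ :=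
  g.coframe e c (g.nabla (e b) (e a))

/-- The connection tensor `H = γ^c_{ab} θ^b ⊗ θ^a ⊗ e_c` with its last index up, as a
vector-valued map of its first two arguments. -/
def connVec (e : Fin 4 → VField M) (X Y : VField M) : VField M := fun x =>
  ∑ a, ∑ b, ∑ c, (g.connCoeff e c a b x * g.coframe e b X x * g.coframe e a Y x) • e c x

/-- The connection tensor `H` with all its indices down. -/
def connTensor (e : Fin 4 → VField M) (X : Fin 3 → VField M) : M → ℝ :=
  g.inn (g.connVec e (X 0) (X 1)) (X 2)

/-- The first-order differential concomitant `C^{[1]}(H)`: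
`C_{αμνσ} = ∇_α H_{μνσ} + H_{αμ}^ρ H_{ρνσ} + H_{αν}^ρ H_{μρσ} + H_{ασ}^ρ H_{μνρ}`. -/
def concomitant (e : Fin 4 → VField M) (X : Fin 4 → VField M) : M → ℝ := fun x =>
  g.nablaT (g.connTensor e) X x
    + g.connTensor e ![g.connVec e (X 0) (X 1), X 2, X 3] x
    + g.connTensor e ![X 1, g.connVec e (X 0) (X 2), X 3] x
    + g.connTensor e ![X 1, X 2, g.connVec e (X 0) (X 3)] x

/-! ### Isometries -/

/-- `(L_ξ g)_x = 0`: for all vector fields `X`, `Y` differentiable at `x`,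
`ξ(g(X, Y)) = g([ξ, X], Y) + g(X, [ξ, Y])` at `x`. -/
def KillingAt (ξ : VField M) (x : M) : Prop :=
  ∀ X Y : VField M, DiffAt X x → DiffAt Y x →
    dirDeriv ξ (g.inn X Y) x = g.inn (bracket ξ X) Y x + g.inn X (bracket ξ Y) x

theorem diffAt_of_smoothOn {X : VField M} {s : Set M} {x : M} (h : SmoothOn X s)
    (hs : IsOpen s) (hx : x ∈ s) : DiffAt X x :=
  (h.contMDiffAt (hs.mem_nhds hx)).mdifferentiableAt (by simp)

theorem bracket_add (Y : VField M) {X X' : VField M} {x : M} (h : DiffAt X x) (h' : DiffAt X' x) :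
    bracket (X + X') Y x = bracket X Y x + bracket X' Y x :=
  VectorField.mlieBracket_add_left h h'

theorem bracket_smul (c : ℝ) (Y : VField M) {X : VField M} {x : M} (h : DiffAt X x) :
    bracket (c • X) Y x = c • bracket X Y x :=
  VectorField.mlieBracket_const_smul_left h

/-- The vector space of the Killing fields defined on the open set `U` (extended by zero outside
`U`, so that each of them is counted once). -/
def killingFields (U : TopologicalSpace.Opens M) : Submodule ℝ (VField M) where
  carrier := {ξ | SmoothOn ξ U ∧ (∀ x ∈ U, g.KillingAt ξ x) ∧ ∀ x ∉ U, ξ x = 0}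
  zero_mem' := by
    refine ⟨(contMDiff_zeroSection ℝ (TangentSpace (𝓡 4) : M → Type _)).contMDiffOn,
      fun x _ X Y _ _ => ?_, fun _ _ => rfl⟩
    simp [dirDeriv, bracket, inn]
  add_mem' := by
    rintro ξ ζ ⟨h1, h2, h3⟩ ⟨k1, k2, k3⟩
    refine ⟨h1.add_section k1, fun x hx X Y hX hY => ?_, fun x hx => ?_⟩
    · have e1 := fun Z => bracket_add Z (diffAt_of_smoothOn h1 U.isOpen hx)
        (diffAt_of_smoothOn k1 U.isOpen hx)
      have a1 := h2 x hx X Y hX hY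
      have a2 := k2 x hx X Y hX hY
      simp only [dirDeriv, inn, e1, Pi.add_apply, map_add,
        add_apply] at a1 a2 ⊢
      rw [a1, a2]; ring
    · simp [h3 x hx, k3 x hx]
  smul_mem' := by
    rintro c ξ ⟨h1, h2, h3⟩
    refine ⟨h1.const_smul_section, fun x hx X Y hX hY => ?_, fun x hx => ?_⟩
    · have e1 := fun Z => bracket_smul c Z (diffAt_of_smoothOn h1 U.isOpen hx)
      have a1 := h2 x hx X Y hX hY
      simp only [dirDeriv, inn, e1, Pi.smul_apply, map_smul, smul_eq_mul,
        smul_apply] at a1 ⊢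
      rw [a1]; ring
    · simp [h3 x hx]

/-- The metric admits an `r`-dimensional (local) isometry group `G_r`: near each point, the Lie
algebra of the local Killing fields has dimension `r`. -/
def HasIsometryGroupOfDim (r : ℕ) : Prop :=
  ∀ p : M, ∃ U : TopologicalSpace.Opens M, p ∈ U ∧
    ∀ V : TopologicalSpace.Opens M, V ≤ U → p ∈ V → IsConnected (V : Set M) →
      Module.finrank ℝ (g.killingFields V) = r

/-- The metric is locally homogeneous: at each point the local Killing fields span the tangent
space. -/
def LocallyHomogeneous : Prop :=
  ∀ p : M, ∃ U : TopologicalSpace.Opens M, p ∈ U ∧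
    ∀ v : TangentSpace (𝓡 4) p, ∃ ξ ∈ g.killingFields U, ξ p = v

end LorentzMetric

end Spacetime

end

open scoped Manifold ContDiff Topology
open Bundle

noncomputable section

set_option linter.unusedSectionVars false

namespace Spacetime

universe u

variable {M : Type u} [TopologicalSpace M] [ChartedSpace (EuclideanSpace ℝ (Fin 4)) M]
  [IsManifold (𝓡 4) ∞ M]

/-! Let `∇' = ∇ - H` be the connection for which the frame is parallel. It is metric, and the three
quadratic terms of `C^{[1]}(H)` are exactly what turns `∇H` into `∇'H`. Hence the frame components
of `C^{[1]}(H)` are, up to sign, the derivatives `e_d(γ^c_{ab})` (`concomitant_eq`). On a connected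
manifold they all vanish if and only if the coefficients are constant, which is 2 ⟺ 4.

The Riemann-frame condition enters through one fact: every local Killing field `ξ` commutes with the
frame (`IsRiemannFrame.bracket_eq_zero`). The flow of `ξ` carries `e_a(p)` to `∑_b Λ_ba e_b` at the
point reached at time `t`. The metric and all `∇^k R` are invariant under the flow, so `Λ` is a
Lorentz matrix that matches these tensors. Moreover `Λ` is close to `1` for small `t`, so the frame
condition forces `Λ = 1`, and differentiation at `t = 0` gives `[ξ, e_a] = 0`. No flow on `M` is
constructed: one integral curve suffices, together with the solution along it of `Λ' = -BΛ`, where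
`B_bd = θ^b([ξ, e_d])`.

3 ⟹ 4: a Killing field commutes with the frame and respects `∇`, so it annihilates every `γ^c_{ab}`;
if the Killing fields span each tangent space, the coefficients are locally constant.

4 ⟹ 3: the structure functions `C_{ab}^d` of the frame are then constant. A field `u^c e_c` commutes
with the frame when `e_a(u^c) = -C_{ab}^c u^b`. This linear system is integrable because of the
Jacobi identity, so it has local solutions with any initial value (`exists_solution_of_const`, which
rests on `exists_hasFDerivAt_of_flat`). A field that commutes with an orthonormal frame is Killing.

1 ⟺ 3: the components of a Killing field solve the same kind of homogeneous system, so on a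
connected open set a Killing field that vanishes at one point is zero. Evaluation at a point is
therefore injective into a 4-dimensional space, and the dimension is 4 exactly when it is onto. -/

/-- The function `f` is of class `C^∞` on the set `s`. -/
def SmoothFnOn (f : M → ℝ) (s : Set M) : Prop := ContMDiffOn (𝓡 4) 𝓘(ℝ, ℝ) ∞ f s

/-! ### Calculus of smooth functions, vector fields and Lie brackets -/

section Calculus

variable {U : Set M} {X Y Z : VField M} {f h : M → ℝ} {x : M}

theorem SmoothFnOn.mdifferentiableAt (hf : SmoothFnOn f U) (hU : IsOpen U) (hx : x ∈ U) :
    MDifferentiableAt (𝓡 4) 𝓘(ℝ, ℝ) f x :=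
  (hf.contMDiffAt (hU.mem_nhds hx)).mdifferentiableAt (by simp)

theorem SmoothFnOn.const (c : ℝ) : SmoothFnOn (fun _ : M => c) U := contMDiffOn_const

theorem SmoothFnOn.add (hf : SmoothFnOn f U) (hh : SmoothFnOn h U) :
    SmoothFnOn (fun x => f x + h x) U := ContMDiffOn.add hf hh

theorem SmoothFnOn.mul (hf : SmoothFnOn f U) (hh : SmoothFnOn h U) :
    SmoothFnOn (fun x => f x * h x) U := ContMDiffOn.mul hf hh

theorem SmoothFnOn.neg (hf : SmoothFnOn f U) : SmoothFnOn (fun x => - f x) U := by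
  simpa using (SmoothFnOn.const (-1)).mul hf

theorem SmoothFnOn.sub (hf : SmoothFnOn f U) (hh : SmoothFnOn h U) :
    SmoothFnOn (fun x => f x - h x) U := by
  simpa [sub_eq_add_neg] using hf.add hh.neg

theorem SmoothFnOn.sum {ι : Type*} {s : Finset ι} {F : ι → M → ℝ}
    (hF : ∀ i ∈ s, SmoothFnOn (F i) U) : SmoothFnOn (fun x => ∑ i ∈ s, F i x) U :=
  contMDiffOn_finsetSum hF

theorem SmoothFnOn.congr (hf : SmoothFnOn f U) (hfh : ∀ x ∈ U, h x = f x) : SmoothFnOn h U :=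
  ContMDiffOn.congr hf hfh

theorem SmoothFnOn.mono {V : Set M} (hf : SmoothFnOn f U) (hV : V ⊆ U) : SmoothFnOn f V :=
  ContMDiffOn.mono hf hV

theorem SmoothOn.mono {V : Set M} (hX : SmoothOn X U) (hV : V ⊆ U) : SmoothOn X V :=
  ContMDiffOn.mono hX hV

theorem Smooth.smoothOn (hX : Smooth X) : SmoothOn X U := ContMDiff.contMDiffOn hX

theorem SmoothOn.diffAt (hX : SmoothOn X U) (hU : IsOpen U) (hx : x ∈ U) : DiffAt X x :=
  LorentzMetric.diffAt_of_smoothOn hX hU hx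

theorem Smooth.diffAt (hX : Smooth X) : DiffAt X x := by
  exact (hX.smoothOn (U := Set.univ)).diffAt isOpen_univ (Set.mem_univ x)

theorem SmoothOn.add (hX : SmoothOn X U) (hY : SmoothOn Y U) : SmoothOn (X + Y) U :=
  ContMDiffOn.add_section hX hY

theorem SmoothOn.smul (hf : SmoothFnOn f U) (hX : SmoothOn X U) : SmoothOn (f • X) U :=
  ContMDiffOn.smul_section hf hX

theorem SmoothOn.const_smul (c : ℝ) (hX : SmoothOn X U) : SmoothOn (c • X) U :=
  ContMDiffOn.const_smul_section hX

theorem SmoothOn.sub (hX : SmoothOn X U) (hY : SmoothOn Y U) : SmoothOn (X - Y) U := by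
  have := hX.add (hY.const_smul (-1))
  rwa [neg_one_smul, ← sub_eq_add_neg] at this

theorem SmoothOn.sum {ι : Type*} {s : Finset ι} {F : ι → VField M}
    (hF : ∀ i ∈ s, SmoothOn (F i) U) : SmoothOn (∑ i ∈ s, F i) U := by
  have := ContMDiffOn.sum_section (I := 𝓡 4) (n := ∞) (F := EuclideanSpace ℝ (Fin 4))
    (V := TangentSpace (𝓡 4)) (u := U) (t := F) hF
  unfold SmoothOn
  convert this using 3
  simp

theorem SmoothOn.congr (hX : SmoothOn X U) (h : ∀ x ∈ U, Y x = X x) : SmoothOn Y U :=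
  ContMDiffOn.congr hX (fun x hx => by simp [h x hx])

theorem SmoothOn.bracket (hX : SmoothOn X U) (hY : SmoothOn Y U) (hU : IsOpen U) :
    SmoothOn (bracket X Y) U := by
  intro x hx
  have : IsManifold (𝓡 4) (minSmoothness ℝ 2) M := by
    simp only [minSmoothness_of_isRCLikeNormedField]
    exact IsManifold.of_le (n := ∞) (WithTop.coe_le_coe.2 le_top)
  have : IsManifold (𝓡 4) (((⊤ : ℕ∞) : WithTop ℕ∞) + 1) M := by
    simpa using (inferInstance : IsManifold (𝓡 4) ∞ M)
  refine (ContMDiffAt.mlieBracket_vectorField (m := ⊤) (n := ⊤)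
    (hX.contMDiffAt (hU.mem_nhds hx)) (hY.contMDiffAt (hU.mem_nhds hx)) ?_).contMDiffWithinAt
  simp

theorem dirDeriv_const (c : ℝ) : dirDeriv X (fun _ => c) x = 0 := by
  have := mvfderiv_const (I := 𝓡 4) c (x := x)
  simp only [dirDeriv]
  rw [this]
  rfl

theorem dirDeriv_fun_add (hf : MDifferentiableAt (𝓡 4) 𝓘(ℝ, ℝ) f x)
    (hh : MDifferentiableAt (𝓡 4) 𝓘(ℝ, ℝ) h x) :
    dirDeriv X (fun y => f y + h y) x = dirDeriv X f x + dirDeriv X h x := by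
  simp [dirDeriv, mvfderiv_fun_add hf hh]

theorem dirDeriv_fun_mul (hf : MDifferentiableAt (𝓡 4) 𝓘(ℝ, ℝ) f x)
    (hh : MDifferentiableAt (𝓡 4) 𝓘(ℝ, ℝ) h x) :
    dirDeriv X (fun y => f y * h y) x = f x * dirDeriv X h x + h x * dirDeriv X f x := by
  simp [dirDeriv, mvfderiv_fun_mul hf hh]

theorem dirDeriv_const_mul (c : ℝ) (hf : MDifferentiableAt (𝓡 4) 𝓘(ℝ, ℝ) f x) :
    dirDeriv X (fun y => c * f y) x = c * dirDeriv X f x := by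
  rw [dirDeriv_fun_mul mdifferentiableAt_const hf, dirDeriv_const]; ring

theorem dirDeriv_fun_sub (hf : MDifferentiableAt (𝓡 4) 𝓘(ℝ, ℝ) f x)
    (hh : MDifferentiableAt (𝓡 4) 𝓘(ℝ, ℝ) h x) :
    dirDeriv X (fun y => f y - h y) x = dirDeriv X f x - dirDeriv X h x := by
  have : (fun y => f y - h y) = f - h := rfl
  simp [dirDeriv, this, mvfderiv_sub hf hh]

theorem mdifferentiableAt_fun_sum {ι : Type*} {s : Finset ι} {F : ι → M → ℝ}
    (hF : ∀ i ∈ s, MDifferentiableAt (𝓡 4) 𝓘(ℝ, ℝ) (F i) x) :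
    MDifferentiableAt (𝓡 4) 𝓘(ℝ, ℝ) (fun y => ∑ i ∈ s, F i y) x := by
  classical
  induction s using Finset.induction_on with
  | empty => simpa using mdifferentiableAt_const
  | insert a s ha ih =>
    simp only [Finset.sum_insert ha]
    exact (hF a (by simp)).add (ih fun i hi => hF i (by simp [hi]))

theorem dirDeriv_fun_sum {ι : Type*} {s : Finset ι} {F : ι → M → ℝ}
    (hF : ∀ i ∈ s, MDifferentiableAt (𝓡 4) 𝓘(ℝ, ℝ) (F i) x) :
    dirDeriv X (fun y => ∑ i ∈ s, F i y) x = ∑ i ∈ s, dirDeriv X (F i) x := by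
  classical
  induction s using Finset.induction_on with
  | empty => simp [dirDeriv_const]
  | insert a s ha ih =>
    simp only [Finset.sum_insert ha]
    rw [dirDeriv_fun_add (hF a (by simp))
      (mdifferentiableAt_fun_sum fun i hi => hF i (by simp [hi])),
      ih fun i hi => hF i (by simp [hi])]

theorem dirDeriv_congr (hU : IsOpen U) (hx : x ∈ U) (hfh : ∀ y ∈ U, f y = h y) :
    dirDeriv X f x = dirDeriv X h x := by
  have : f =ᶠ[𝓝 x] h := Filter.eventually_of_mem (hU.mem_nhds hx) hfh
  unfold dirDeriv mvfderiv
  rw [this.mfderiv_eq, this.self_of_nhds]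

theorem bracket_add_left (hX : DiffAt X x) (hY : DiffAt Y x) :
    bracket (X + Y) Z x = bracket X Z x + bracket Y Z x :=
  VectorField.mlieBracket_add_left hX hY

theorem bracket_add_right (hX : DiffAt X x) (hY : DiffAt Y x) :
    bracket Z (X + Y) x = bracket Z X x + bracket Z Y x :=
  VectorField.mlieBracket_add_right hX hY

theorem bracket_smul_right (hf : MDifferentiableAt (𝓡 4) 𝓘(ℝ, ℝ) f x) (hY : DiffAt Y x) :
    bracket X (f • Y) x = dirDeriv X f x • Y x + f x • bracket X Y x :=
  VectorField.mlieBracket_smul_right hf hY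

theorem bracket_smul_left (hf : MDifferentiableAt (𝓡 4) 𝓘(ℝ, ℝ) f x) (hX : DiffAt X x) :
    bracket (f • X) Y x = -(dirDeriv Y f x) • X x + f x • bracket X Y x :=
  VectorField.mlieBracket_smul_left hf hX

theorem bracket_swap : bracket X Y x = - bracket Y X x :=
  VectorField.mlieBracket_swap_apply

theorem bracket_congr {X' Y' : VField M} (hU : IsOpen U) (hx : x ∈ U)
    (hX : ∀ y ∈ U, X y = X' y) (hY : ∀ y ∈ U, Y y = Y' y) :
    bracket X Y x = bracket X' Y' x :=
  Filter.EventuallyEq.mlieBracket_vectorField_eq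
    (Filter.eventually_of_mem (hU.mem_nhds hx) hX) (Filter.eventually_of_mem (hU.mem_nhds hx) hY)

theorem diffAt_sum {ι : Type*} {s : Finset ι} {F : ι → VField M}
    (hF : ∀ i ∈ s, DiffAt (F i) x) : DiffAt (∑ i ∈ s, F i) x := by
  classical
  induction s using Finset.induction_on with
  | empty =>
    exact (Smooth.diffAt (X := (0 : VField M))
      (contMDiff_zeroSection ℝ (TangentSpace (𝓡 4) : M → Type _)))
  | insert a s ha ih =>
    rw [Finset.sum_insert ha]
    exact mdifferentiableAt_add_section (hF a (by simp)) (ih fun i hi => hF i (by simp [hi]))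

theorem bracket_sum_right {ι : Type*} {s : Finset ι} {F : ι → VField M}
    (hF : ∀ i ∈ s, DiffAt (F i) x) :
    bracket Z (∑ i ∈ s, F i) x = ∑ i ∈ s, bracket Z (F i) x := by
  classical
  induction s using Finset.induction_on with
  | empty => simp [bracket]
  | insert a s ha ih =>
    simp only [Finset.sum_insert ha]
    rw [bracket_add_right (hF a (by simp))
      (diffAt_sum fun i hi => hF i (by simp [hi])), ih fun i hi => hF i (by simp [hi])]

theorem bracket_bracket (hX : SmoothOn X U) (hY : SmoothOn Y U) (hZ : SmoothOn Z U)
    (hU : IsOpen U) (hx : x ∈ U) :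
    bracket X (bracket Y Z) x = bracket (bracket X Y) Z x + bracket Y (bracket X Z) x := by
  have : IsManifold (𝓡 4) (minSmoothness ℝ 3) M := by
    simp only [minSmoothness_of_isRCLikeNormedField]
    exact IsManifold.of_le (n := ∞) (WithTop.coe_le_coe.2 le_top)
  have key {W : VField M} (hW : SmoothOn W U) :
      ContMDiffAt (𝓡 4) (𝓡 4).tangent (minSmoothness ℝ 2)
        (fun x => (⟨x, W x⟩ : TangentBundle (𝓡 4) M)) x := by
    simp only [minSmoothness_of_isRCLikeNormedField]
    exact (hW.contMDiffAt (hU.mem_nhds hx)).of_le (WithTop.coe_le_coe.2 le_top)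
  exact VectorField.leibniz_identity_mlieBracket_apply (key hX) (key hY) (key hZ)

end Calculus

/-! ### The metric and the components in an orthonormal frame -/

namespace LorentzMetric

variable {g : LorentzMetric M} {U : Set M} {X Y Z : VField M} {f : M → ℝ} {x : M}

theorem inn_comm : g.inn X Y x = g.inn Y X x := g.symm x _ _

theorem inn_add_left : g.inn (X + Y) Z x = g.inn X Z x + g.inn Y Z x := by simp [inn]

theorem inn_add_right : g.inn X (Y + Z) x = g.inn X Y x + g.inn X Z x := by simp [inn]

theorem inn_sub_left : g.inn (X - Y) Z x = g.inn X Z x - g.inn Y Z x := by simp [inn]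

theorem inn_smul_left : g.inn (f • X) Y x = f x * g.inn X Y x := by simp [inn]

theorem inn_smul_right : g.inn X (f • Y) x = f x * g.inn X Y x := by simp [inn]

theorem inn_congr {X' Y' : VField M} (hX : X x = X' x) (hY : Y x = Y' x) :
    g.inn X Y x = g.inn X' Y' x := by simp [inn, hX, hY]

theorem SmoothFnOn.inn (hX : SmoothOn X U) (hY : SmoothOn Y U) : SmoothFnOn (g.inn X Y) U := by
  intro x hx
  have h0 : ContMDiffWithinAt (𝓡 4)
    ((𝓡 4).prod 𝓘(ℝ, EuclideanSpace ℝ (Fin 4) →L[ℝ] EuclideanSpace ℝ (Fin 4) →L[ℝ] ℝ)) ∞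
    (fun x => TotalSpace.mk'
      (EuclideanSpace ℝ (Fin 4) →L[ℝ] EuclideanSpace ℝ (Fin 4) →L[ℝ] ℝ) x (g.val x)) U x :=
    (g.contMDiff x).contMDiffWithinAt
  have h1 := ContMDiffWithinAt.clm_bundle_apply₂ (F₁ := EuclideanSpace ℝ (Fin 4))
    (F₂ := EuclideanSpace ℝ (Fin 4)) (F₃ := ℝ) (E₃ := fun _ : M => ℝ) h0 (hX x hx) (hY x hx)
  exact (Bundle.contMDiffWithinAt_totalSpace.1 h1).2

variable {e : Fin 4 → VField M}

theorem coframe_def (a : Fin 4) : g.coframe e a X x = sgn a * g.inn (e a) X x := rfl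

theorem coframe_add (a : Fin 4) :
    g.coframe e a (X + Y) x = g.coframe e a X x + g.coframe e a Y x := by
  simp [coframe, inn, mul_add]

theorem coframe_sub (a : Fin 4) :
    g.coframe e a (X - Y) x = g.coframe e a X x - g.coframe e a Y x := by
  simp [coframe, inn, mul_sub]

theorem coframe_smul (a : Fin 4) : g.coframe e a (f • X) x = f x * g.coframe e a X x := by
  simp [coframe, inn]; ring

theorem coframe_congr (a : Fin 4) (h : X x = Y x) : g.coframe e a X x = g.coframe e a Y x := by
  simp [coframe, inn, h]

theorem sgn_mul_self (a : Fin 4) : sgn a * sgn a = 1 := by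
  unfold sgn; split_ifs <;> norm_num

theorem sgn_ne_zero (a : Fin 4) : sgn a ≠ 0 := by
  unfold sgn; split_ifs <;> norm_num

namespace IsOrthonormalFrame

theorem inn_frame (he : g.IsOrthonormalFrame e) (a b : Fin 4) :
    g.inn (e a) (e b) x = if a = b then sgn a else 0 := by
  rw [he.orthonormal, etaMat, Matrix.diagonal_apply]

theorem coframe_frame (he : g.IsOrthonormalFrame e) (a b : Fin 4) :
    g.coframe e a (e b) x = if a = b then 1 else 0 := by
  rw [coframe_def, he.inn_frame]
  split_ifs <;> simp [sgn_mul_self]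

theorem smoothOn (he : g.IsOrthonormalFrame e) (a : Fin 4) : SmoothOn (e a) U :=
  (he.smooth a).smoothOn

theorem diffAt (he : g.IsOrthonormalFrame e) (a : Fin 4) : DiffAt (e a) x := (he.smooth a).diffAt

theorem linearIndependent (he : g.IsOrthonormalFrame e) (x : M) :
    LinearIndependent ℝ (fun a => e a x) := by
  rw [Fintype.linearIndependent_iff]
  intro c hc b
  have h := congrArg (g.val x (e b x)) hc
  have h2 (a : Fin 4) : g.val x (e b x) (e a x) = if b = a then sgn b else 0 :=
    he.inn_frame b a
  simpa [h2, sgn_ne_zero] using h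

theorem sum_coframe_smul (he : g.IsOrthonormalFrame e) (X : VField M) (x : M) :
    ∑ a, g.coframe e a X x • e a x = X x := by
  have hcard : Fintype.card (Fin 4) = Module.finrank ℝ (TangentSpace (𝓡 4) x) := by
    change _ = Module.finrank ℝ (EuclideanSpace ℝ (Fin 4))
    simp
  let b := basisOfLinearIndependentOfCardEqFinrank (he.linearIndependent x) hcard
  have hb (a : Fin 4) : b a = e a x := by simp [b]
  have h1 := b.sum_repr (X x)
  have h2 (a : Fin 4) : g.coframe e a X x = b.repr (X x) a := by
    have h3 (c : Fin 4) : g.val x (e a x) (e c x) = if a = c then sgn a else 0 :=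
      he.inn_frame a c
    rw [coframe_def, inn]
    conv_lhs => rw [← h1]
    simp [hb, h3]
    rw [mul_comm, mul_assoc, sgn_mul_self, mul_one]
  simp only [h2, ← hb]
  exact h1

theorem eq_sum (he : g.IsOrthonormalFrame e) (X : VField M) :
    X = ∑ a, g.coframe e a X • e a := by
  funext x
  simpa using (he.sum_coframe_smul X x).symm

theorem ext_coframe (he : g.IsOrthonormalFrame e)
    (h : ∀ a, g.coframe e a X x = g.coframe e a Y x) : X x = Y x := by
  rw [← he.sum_coframe_smul X, ← he.sum_coframe_smul Y]
  simp [h]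

theorem ext_inn (he : g.IsOrthonormalFrame e)
    (h : ∀ a, g.inn X (e a) x = g.inn Y (e a) x) : X x = Y x :=
  he.ext_coframe fun a => by rw [coframe_def, coframe_def, inn_comm, h, inn_comm]

theorem inn_eq_sum (he : g.IsOrthonormalFrame e) (X Y : VField M) (x : M) :
    g.inn X Y x = ∑ a, sgn a * (g.coframe e a X x * g.coframe e a Y x) := by
  have h : g.inn X Y x = g.val x (X x) (∑ a, g.coframe e a Y x • e a x) := by
    rw [he.sum_coframe_smul]; rfl
  rw [h, map_sum]
  refine Finset.sum_congr rfl fun a _ => ?_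
  have h2 : g.val x (X x) (e a x) = g.inn (e a) X x := inn_comm
  rw [map_smul, smul_eq_mul, h2, coframe_def (X := X), ← mul_assoc, ← mul_assoc, sgn_mul_self]
  ring

theorem smoothFnOn_coframe (he : g.IsOrthonormalFrame e) (a : Fin 4) (hX : SmoothOn X U) :
    SmoothFnOn (g.coframe e a X) U :=
  (SmoothFnOn.const (sgn a)).mul (SmoothFnOn.inn (he.smoothOn a) hX)

theorem mdifferentiableAt_coframe (he : g.IsOrthonormalFrame e) (a : Fin 4) (hX : DiffAt X x) :
    MDifferentiableAt (𝓡 4) 𝓘(ℝ, ℝ) (g.coframe e a X) x :=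
  MDifferentiableAt.mul mdifferentiableAt_const (g.mdifferentiableAt_inn (he.diffAt a) hX)

theorem smoothOn_of_coframe (he : g.IsOrthonormalFrame e)
    (hX : ∀ a, SmoothFnOn (g.coframe e a X) U) : SmoothOn X U := by
  rw [he.eq_sum X]
  exact SmoothOn.sum fun a _ => SmoothOn.smul (hX a) (he.smoothOn a)

theorem dirDeriv_eq_sum (he : g.IsOrthonormalFrame e) (X : VField M) (f : M → ℝ) (x : M) :
    dirDeriv X f x = ∑ a, g.coframe e a X x * dirDeriv (e a) f x := by
  simp only [dirDeriv]
  conv_lhs => rw [← he.sum_coframe_smul X x]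
  simp

/-- The derivative `X(f)` is the `e_0`-component of `[X, f e_0] - f [X, e_0]`, so its smoothness is
inherited from that of the Lie bracket. -/
theorem smoothFnOn_dirDeriv (he : g.IsOrthonormalFrame e) (hU : IsOpen U) (hX : SmoothOn X U)
    (hf : SmoothFnOn f U) : SmoothFnOn (dirDeriv X f) U := by
  have h0 := he.smoothOn (U := U) 0
  refine ((he.smoothFnOn_coframe 0 (hX.bracket (SmoothOn.smul hf h0) hU)).sub
    (hf.mul (he.smoothFnOn_coframe 0 (hX.bracket h0 hU)))).congr fun x hx => ?_
  have h1 : bracket X (f • e 0) x = (dirDeriv X f • e 0 + f • bracket X (e 0)) x :=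
    bracket_smul_right (hf.mdifferentiableAt hU hx) (he.diffAt 0)
  rw [coframe_congr 0 h1, coframe_add, coframe_smul, coframe_smul, he.coframe_frame]
  simp

/-- Apply the Jacobi identity to `X`, `Y`, `f e_0`, expand by the Leibniz rule and compare the
coefficients of `e_0`. -/
theorem dirDeriv_bracket (he : g.IsOrthonormalFrame e) (hU : IsOpen U) (hx : x ∈ U)
    (hX : SmoothOn X U) (hY : SmoothOn Y U) (hf : SmoothFnOn f U) :
    dirDeriv (bracket X Y) f x = dirDeriv X (dirDeriv Y f) x - dirDeriv Y (dirDeriv X f) x := by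
  have h0 := he.smoothOn (U := U) 0
  have key {X Y : VField M} (hX : SmoothOn X U) (hY : SmoothOn Y U) :
      bracket X (bracket Y (f • e 0)) x = dirDeriv X (dirDeriv Y f) x • e 0 x
        + dirDeriv Y f x • bracket X (e 0) x + dirDeriv X f x • bracket Y (e 0) x
        + f x • bracket X (bracket Y (e 0)) x := by
    have h1 : ∀ y ∈ U, bracket Y (f • e 0) y = (dirDeriv Y f • e 0 + f • bracket Y (e 0)) y :=
      fun y hy => bracket_smul_right (hf.mdifferentiableAt hU hy) (he.diffAt 0)
    have hd := he.smoothFnOn_dirDeriv hU hY hf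
    have hb := hY.bracket h0 hU
    rw [bracket_congr (X' := X) hU hx (fun _ _ => rfl) h1, bracket_add_right
      ((SmoothOn.smul hd h0).diffAt hU hx) ((SmoothOn.smul hf hb).diffAt hU hx),
      bracket_smul_right (hd.mdifferentiableAt hU hx) (he.diffAt 0),
      bracket_smul_right (hf.mdifferentiableAt hU hx) (hb.diffAt hU hx)]
    abel
  have h1 := bracket_bracket hX hY (SmoothOn.smul hf h0) hU hx
  rw [key hX hY, key hY hX, bracket_smul_right (hf.mdifferentiableAt hU hx) (he.diffAt 0),
    bracket_bracket hX hY h0 hU hx, smul_add] at h1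
  have h2 : ((dirDeriv X (dirDeriv Y f) • e 0 : VField M) : VField M) x
      = ((dirDeriv (bracket X Y) f + dirDeriv Y (dirDeriv X f)) • e 0 : VField M) x := by
    simp only [Pi.smul_apply', Pi.add_apply]
    rw [add_smul]
    rw [← sub_eq_zero] at h1 ⊢
    rw [← h1]
    abel
  have h3 := coframe_congr (g := g) (e := e) 0 h2
  rw [coframe_smul, coframe_smul, he.coframe_frame] at h3
  simp at h3
  linarith

end IsOrthonormalFrame

theorem smoothFnOn_koszul (he : g.IsOrthonormalFrame e) (hU : IsOpen U) (hX : SmoothOn X U)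
    (hY : SmoothOn Y U) (hZ : SmoothOn Z U) : SmoothFnOn (g.koszul X Y Z) U := by
  have d {X Y Z : VField M} (hX : SmoothOn X U) (hY : SmoothOn Y U) (hZ : SmoothOn Z U) :=
    he.smoothFnOn_dirDeriv hU hX (SmoothFnOn.inn (g := g) hY hZ)
  have b {X Y Z : VField M} (hX : SmoothOn X U) (hY : SmoothOn Y U) (hZ : SmoothOn Z U) :=
    SmoothFnOn.inn (g := g) (hX.bracket hY hU) hZ
  exact (((((d hX hY hZ).add (d hY hZ hX)).sub (d hZ hX hY)).add (b hX hY hZ)).sub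
    (b hX hZ hY)).sub (b hY hZ hX)

/-! ### Rules of the Levi-Civita connection, from the Koszul formula -/

namespace IsOrthonormalFrame

theorem coframe_nabla (he : g.IsOrthonormalFrame e) (c : Fin 4) (hX : DiffAt X x)
    (hY : DiffAt Y x) :
    g.coframe e c (g.nabla X Y) x = sgn c / 2 * g.koszul X Y (e c) x := by
  rw [← g.nabla_spec hX hY (he.diffAt c), coframe_def, inn_comm]
  ring

theorem smoothOn_nabla (he : g.IsOrthonormalFrame e) (hU : IsOpen U) (hX : SmoothOn X U)
    (hY : SmoothOn Y U) : SmoothOn (g.nabla X Y) U := by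
  refine he.smoothOn_of_coframe fun a => ?_
  refine ((SmoothFnOn.const (sgn a / 2)).mul
    (smoothFnOn_koszul he hU hX hY (he.smoothOn a))).congr fun x hx => ?_
  exact he.coframe_nabla a (hX.diffAt hU hx) (hY.diffAt hU hx)

/-- The value of `nabla` is accessible only through the Koszul formula `nabla_spec`; each rule below
is therefore tested against the frame vectors, with the factor 2 of that formula kept. -/
theorem ext_two_inn (he : g.IsOrthonormalFrame e)
    (h : ∀ a, 2 * g.inn X (e a) x = 2 * g.inn Y (e a) x) : X x = Y x :=
  he.ext_inn fun a => mul_left_cancel₀ two_ne_zero (h a)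

theorem nabla_smul_right (he : g.IsOrthonormalFrame e)
    (hf : MDifferentiableAt (𝓡 4) 𝓘(ℝ, ℝ) f x) (hX : DiffAt X x) (hY : DiffAt Y x) :
    g.nabla X (f • Y) x = dirDeriv X f x • Y x + f x • g.nabla X Y x := by
  change _ = (dirDeriv X f • Y + f • g.nabla X Y) x
  refine he.ext_two_inn fun c => ?_
  have hc : DiffAt (e c) x := he.diffAt c
  have hfY : DiffAt (f • Y) x := MDifferentiableAt.smul_section hf hY
  rw [g.nabla_spec hX hfY hc, inn_add_left, inn_smul_left, inn_smul_left, mul_add,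
    mul_left_comm 2 (f x), g.nabla_spec hX hY hc]
  have a1 : g.inn (f • Y) (e c) = fun y => f y * g.inn Y (e c) y := funext fun y => inn_smul_left
  have a2 : g.inn X (f • Y) = fun y => f y * g.inn X Y y := funext fun y => inn_smul_right
  have b1 : bracket X (f • Y) x = (dirDeriv X f • Y + f • bracket X Y) x :=
    bracket_smul_right hf hY
  have b2 : bracket (f • Y) (e c) x = (-(dirDeriv (e c) f) • Y + f • bracket Y (e c)) x :=
    bracket_smul_left hf hY
  have d1 (h : M → ℝ) : dirDeriv (f • Y) h x = f x * dirDeriv Y h x := by simp [dirDeriv]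
  simp only [koszul, a1, a2, d1, dirDeriv_fun_mul hf (g.mdifferentiableAt_inn hY hc),
    dirDeriv_fun_mul hf (g.mdifferentiableAt_inn hX hY),
    inn_congr (g := g) (Y := e c) b1 rfl, inn_congr (g := g) (Y := X) b2 rfl,
    inn_add_left, inn_smul_left, inn_smul_right, Pi.neg_apply,
    inn_comm (X := Y) (Y := X) (x := x)]
  ring

theorem nabla_smul_left (he : g.IsOrthonormalFrame e)
    (hf : MDifferentiableAt (𝓡 4) 𝓘(ℝ, ℝ) f x) (hX : DiffAt X x) (hY : DiffAt Y x) :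
    g.nabla (f • X) Y x = f x • g.nabla X Y x := by
  change _ = (f • g.nabla X Y) x
  refine he.ext_two_inn fun c => ?_
  have hc : DiffAt (e c) x := he.diffAt c
  have hfX : DiffAt (f • X) x := MDifferentiableAt.smul_section hf hX
  rw [g.nabla_spec hfX hY hc, inn_smul_left, mul_left_comm 2 (f x), g.nabla_spec hX hY hc]
  have a1 : g.inn (f • X) Y = fun y => f y * g.inn X Y y := funext fun y => inn_smul_left
  have a2 : g.inn (e c) (f • X) = fun y => f y * g.inn (e c) X y :=
    funext fun y => inn_smul_right
  have b1 : bracket (f • X) Y x = (-(dirDeriv Y f) • X + f • bracket X Y) x :=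
    bracket_smul_left hf hX
  have b2 : bracket (f • X) (e c) x = (-(dirDeriv (e c) f) • X + f • bracket X (e c)) x :=
    bracket_smul_left hf hX
  have d1 (h : M → ℝ) : dirDeriv (f • X) h x = f x * dirDeriv X h x := by simp [dirDeriv]
  simp only [koszul, a1, a2, d1, dirDeriv_fun_mul hf (g.mdifferentiableAt_inn hc hX),
    dirDeriv_fun_mul hf (g.mdifferentiableAt_inn hX hY),
    inn_congr (g := g) (Y := e c) b1 rfl, inn_congr (g := g) (Y := Y) b2 rfl,
    inn_add_left, inn_smul_left, inn_smul_right, Pi.neg_apply,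
    inn_comm (X := e c) (Y := X) (x := x)]
  ring

theorem nabla_add_right (he : g.IsOrthonormalFrame e) (hX : DiffAt X x) (hY : DiffAt Y x)
    (hZ : DiffAt Z x) : g.nabla X (Y + Z) x = g.nabla X Y x + g.nabla X Z x := by
  change _ = (g.nabla X Y + g.nabla X Z) x
  refine he.ext_two_inn fun c => ?_
  have hc : DiffAt (e c) x := he.diffAt c
  have hYZ : DiffAt (Y + Z) x := mdifferentiableAt_add_section hY hZ
  rw [g.nabla_spec hX hYZ hc, inn_add_left, mul_add, g.nabla_spec hX hY hc, g.nabla_spec hX hZ hc]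
  have a1 : g.inn (Y + Z) (e c) = fun y => g.inn Y (e c) y + g.inn Z (e c) y :=
    funext fun y => inn_add_left
  have a2 : g.inn X (Y + Z) = fun y => g.inn X Y y + g.inn X Z y := funext fun y => inn_add_right
  have b1 : bracket X (Y + Z) x = (bracket X Y + bracket X Z) x := bracket_add_right hY hZ
  have b2 : bracket (Y + Z) (e c) x = (bracket Y (e c) + bracket Z (e c)) x :=
    bracket_add_left hY hZ
  have d1 (h : M → ℝ) : dirDeriv (Y + Z) h x = dirDeriv Y h x + dirDeriv Z h x := by
    simp [dirDeriv]
  simp only [koszul, a1, a2, d1, inn_congr (g := g) (Y := e c) b1 rfl,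
    inn_congr (g := g) (Y := X) b2 rfl, inn_add_left, inn_add_right,
    dirDeriv_fun_add (g.mdifferentiableAt_inn hY hc) (g.mdifferentiableAt_inn hZ hc),
    dirDeriv_fun_add (g.mdifferentiableAt_inn hX hY) (g.mdifferentiableAt_inn hX hZ)]
  ring

theorem nabla_add_left (he : g.IsOrthonormalFrame e) (hX : DiffAt X x) (hY : DiffAt Y x)
    (hZ : DiffAt Z x) : g.nabla (X + Y) Z x = g.nabla X Z x + g.nabla Y Z x := by
  change _ = (g.nabla X Z + g.nabla Y Z) x
  refine he.ext_two_inn fun c => ?_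
  have hc : DiffAt (e c) x := he.diffAt c
  have hXY : DiffAt (X + Y) x := mdifferentiableAt_add_section hX hY
  rw [g.nabla_spec hXY hZ hc, inn_add_left, mul_add, g.nabla_spec hX hZ hc, g.nabla_spec hY hZ hc]
  have a1 : g.inn (X + Y) Z = fun y => g.inn X Z y + g.inn Y Z y := funext fun y => inn_add_left
  have a2 : g.inn (e c) (X + Y) = fun y => g.inn (e c) X y + g.inn (e c) Y y :=
    funext fun y => inn_add_right
  have b1 : bracket (X + Y) Z x = (bracket X Z + bracket Y Z) x := bracket_add_left hX hY
  have b2 : bracket (X + Y) (e c) x = (bracket X (e c) + bracket Y (e c)) x :=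
    bracket_add_left hX hY
  have d1 (h : M → ℝ) : dirDeriv (X + Y) h x = dirDeriv X h x + dirDeriv Y h x := by
    simp [dirDeriv]
  simp only [koszul, a1, a2, d1, inn_congr (g := g) (Y := e c) b1 rfl,
    inn_congr (g := g) (Y := Z) b2 rfl, inn_add_left, inn_add_right,
    dirDeriv_fun_add (g.mdifferentiableAt_inn hX hZ) (g.mdifferentiableAt_inn hY hZ),
    dirDeriv_fun_add (g.mdifferentiableAt_inn hc hX) (g.mdifferentiableAt_inn hc hY)]
  ring

theorem nabla_sub_nabla (he : g.IsOrthonormalFrame e) (hX : DiffAt X x) (hY : DiffAt Y x) :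
    bracket X Y x = g.nabla X Y x - g.nabla Y X x := by
  change _ = (g.nabla X Y - g.nabla Y X) x
  refine he.ext_two_inn fun c => ?_
  have hc : DiffAt (e c) x := he.diffAt c
  rw [inn_sub_left, mul_sub, g.nabla_spec hX hY hc, g.nabla_spec hY hX hc]
  have a1 : g.inn X Y = g.inn Y X := funext fun y => inn_comm
  have a2 : g.inn X (e c) = g.inn (e c) X := funext fun y => inn_comm
  have a3 : g.inn Y (e c) = g.inn (e c) Y := funext fun y => inn_comm
  have b1 : bracket Y X x = (-bracket X Y) x := bracket_swap
  have n1 : g.inn (-bracket X Y) (e c) x = - g.inn (bracket X Y) (e c) x := by simp [inn]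
  simp only [koszul, a1, a2, a3, inn_congr (g := g) (Y := e c) b1 rfl, n1]
  ring

/-- The Koszul expression depends only on germs. This allows the rules for an inner derivative,
which hold only on `U`, to be substituted inside an iterated one. -/
theorem nabla_congr (he : g.IsOrthonormalFrame e) {X' Y' : VField M} (hU : IsOpen U)
    (hx : x ∈ U) (hX : SmoothOn X U) (hY : SmoothOn Y U) (hXX' : ∀ y ∈ U, X y = X' y)
    (hYY' : ∀ y ∈ U, Y y = Y' y) : g.nabla X Y x = g.nabla X' Y' x := by
  have hX' : SmoothOn X' U := hX.congr fun y hy => (hXX' y hy).symm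
  have hY' : SmoothOn Y' U := hY.congr fun y hy => (hYY' y hy).symm
  refine he.ext_two_inn fun c => ?_
  rw [g.nabla_spec (hX.diffAt hU hx) (hY.diffAt hU hx) (he.diffAt c),
    g.nabla_spec (hX'.diffAt hU hx) (hY'.diffAt hU hx) (he.diffAt c)]
  have i1 {A A' B B' : VField M} (hA : ∀ y ∈ U, A y = A' y) (hB : ∀ y ∈ U, B y = B' y)
      (C : VField M) : dirDeriv C (g.inn A B) x = dirDeriv C (g.inn A' B') x :=
    dirDeriv_congr hU hx fun y hy => inn_congr (hA y hy) (hB y hy)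
  have d1 {A A' : VField M} (hA : ∀ y ∈ U, A y = A' y) (h : M → ℝ) :
      dirDeriv A h x = dirDeriv A' h x := by simp [dirDeriv, hA x hx]
  have r : ∀ y ∈ U, e c y = e c y := fun _ _ => rfl
  simp only [koszul, d1 hXX', d1 hYY', i1 hYY' r, i1 r hXX', i1 hXX' hYY',
    inn_congr (g := g) (bracket_congr hU hx hXX' hYY') (r x hx),
    inn_congr (g := g) (bracket_congr hU hx hXX' r) (hYY' x hx),
    inn_congr (g := g) (bracket_congr hU hx hYY' r) (hXX' x hx)]

end IsOrthonormalFrame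

end LorentzMetric

/-! ### The linear total differential equation `du = A u` in a normed space -/

section TotalDifferentialEquation

open Set Metric

set_option synthInstance.maxHeartbeats 200000

variable {E F : Type*} [NormedAddCommGroup E] [NormedSpace ℝ E] [NormedAddCommGroup F]
  [NormedSpace ℝ F]

/-- A solution of the total differential equation `du = A u` which vanishes at a point vanishes
near it. -/
theorem eventually_eq_zero_of_hasFDerivAt {u : E → F} {A : E → E →L[ℝ] F →L[ℝ] F} {Ω : Set E}
    (hΩ : IsOpen Ω) {z₀ : E} (hz₀ : z₀ ∈ Ω) (hA : ContinuousOn A Ω)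
    (hu : ∀ z ∈ Ω, HasFDerivAt u ((A z).flip (u z)) z) (h0 : u z₀ = 0) :
    ∀ᶠ z in 𝓝 z₀, u z = 0 := by
  have hA0 : ContinuousAt A z₀ := hA.continuousAt (hΩ.mem_nhds hz₀)
  have hA1 : Filter.Tendsto (fun z => ‖A z‖) (𝓝 z₀) (𝓝 ‖A z₀‖) :=
    ContinuousAt.norm (E := E →L[ℝ] F →L[ℝ] F) hA0
  have h1 : ∀ᶠ z in 𝓝 z₀, z ∈ Ω ∧ ‖A z‖ < ‖A z₀‖ + 1 :=
    Filter.Eventually.and (hΩ.mem_nhds hz₀) (hA1.eventually (gt_mem_nhds (lt_add_one _)))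
  obtain ⟨r, hr, hball⟩ := Metric.eventually_nhds_iff_ball.1 h1
  refine Metric.eventually_nhds_iff_ball.2 ⟨r, hr, fun z hz => ?_⟩
  set γ : ℝ → E := fun t => z₀ + t • (z - z₀) with hγ
  have hγd (t : ℝ) : HasDerivAt γ (z - z₀) t := by
    simpa [hγ] using ((hasDerivAt_id t).smul_const (z - z₀)).const_add z₀
  have hγm (t : ℝ) (ht : t ∈ Icc (0 : ℝ) 1) : γ t ∈ ball z₀ r := by
    have hz' : ‖z - z₀‖ < r := by simpa [dist_eq_norm] using hz
    simp only [hγ, mem_ball, dist_eq_norm, add_sub_cancel_left, norm_smul, Real.norm_eq_abs,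
      abs_of_nonneg ht.1]
    nlinarith [ht.2, norm_nonneg (z - z₀)]
  have hd (t : ℝ) (ht : t ∈ Icc (0 : ℝ) 1) :
      HasDerivAt (fun t => u (γ t)) ((A (γ t)).flip (u (γ t)) (z - z₀)) t :=
    (hu _ (hball _ (hγm t ht)).1).comp_hasDerivAt t (hγd t)
  -- Along the segment from `z₀` to `z`, the speed of `u` is at most a constant times `‖u‖`, so the
  -- zero initial value propagates by Grönwall.
  have := eq_zero_of_abs_deriv_le_mul_abs_self_of_eq_zero_right (a := 0) (b := 1)
    (f := fun t => u (γ t)) (K := (‖A z₀‖ + 1) * ‖z - z₀‖)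
    (fun t ht => (hd t ht).continuousAt.continuousWithinAt)
    (fun t ht => (hd t ⟨ht.1, ht.2.le⟩).hasDerivWithinAt) (by simpa [hγ] using h0)
    (fun t ht => by
      have hb := (hball _ (hγm t ⟨ht.1, ht.2.le⟩)).2.le
      calc ‖(A (γ t)).flip (u (γ t)) (z - z₀)‖ = ‖A (γ t) (z - z₀) (u (γ t))‖ := rfl
        _ ≤ ‖A (γ t)‖ * ‖z - z₀‖ * ‖u (γ t)‖ := (A (γ t)).le_opNorm₂ _ _
        _ ≤ _ := by gcongr) 1 (by simp)
  simpa [hγ] using this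

/-- Grönwall with rate `1/2` on the unit interval: `e^{1/2} ≤ 2` gives the bound `2δ + 2ε`, weakened
for convenience. The rate is the one provided by `K * r ≤ 1/2` in `exists_ball_bounds`. -/
theorem norm_le_of_norm_deriv_le {f f' : ℝ → F} {ε : ℝ}
    (hf : ∀ t ∈ Icc (0 : ℝ) 1, HasDerivWithinAt f (f' t) (Icc 0 1) t) {δ : ℝ} (h0 : ‖f 0‖ ≤ δ)
    (hε : 0 ≤ ε) (bound : ∀ t ∈ Icc (0 : ℝ) 1, ‖f' t‖ ≤ 1 / 2 * ‖f t‖ + ε) :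
    ∀ t ∈ Icc (0 : ℝ) 1, ‖f t‖ ≤ 4 * (δ + ε) := by
  intro t ht
  have h1 := norm_le_gronwallBound_of_norm_deriv_right_le (f := f) (f' := f') (δ := δ)
    (K := 1 / 2) (ε := ε) (a := 0) (b := 1) (fun t ht => (hf t ht).continuousWithinAt)
    (fun t ht => (hf t ⟨ht.1, ht.2.le⟩).mono_of_mem_nhdsWithin (Icc_mem_nhdsGE_of_mem ht))
    h0 (fun t ht => bound t ⟨ht.1, ht.2.le⟩) t ht
  have hδ : 0 ≤ δ := (norm_nonneg _).trans h0
  rw [gronwallBound_of_K_ne_0 (by norm_num)] at h1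
  have h2 : Real.exp (1 / 2 * (t - 0)) ≤ 2 := by
    have h3 : Real.exp (1 / 2 * (t - 0)) ≤ Real.exp (1 / 2) := by
      gcongr; linarith [ht.2]
    have h4 : Real.exp (1 / 2) ≤ 1 / (1 - 1 / 2) := by
      have h5 := Real.add_one_le_exp (-(1 / 2) : ℝ)
      rw [Real.exp_neg] at h5
      have h6 := Real.exp_pos (1 / 2)
      have h7 : (1 / 2 : ℝ) * Real.exp (1 / 2) ≤ 1 := by
        calc (1 / 2 : ℝ) * Real.exp (1 / 2) ≤ (Real.exp (1 / 2))⁻¹ * Real.exp (1 / 2) := by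
              gcongr; linarith
          _ = 1 := inv_mul_cancel₀ h6.ne'
      linarith
    linarith
  have h3 : (0 : ℝ) < Real.exp (1 / 2 * (t - 0)) := Real.exp_pos _
  have h4 : ε / (1 / 2) * (Real.exp (1 / 2 * (t - 0)) - 1) ≤ 2 * ε := by
    have : ε / (1 / 2) = 2 * ε := by ring
    rw [this]; nlinarith
  nlinarith

/-- In the ball of radius `‖y₀‖` about `y₀` one has `‖y‖ ≤ 2‖y₀‖`, hence speed at most `‖y₀‖`. A
solution cannot leave the ball in unit time, so a single Picard–Lindelöf step covers all of `[0,
1]`. -/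
theorem exists_linear_ode_solution [CompleteSpace F] {B : ℝ → F →L[ℝ] F} (hB : ContinuousOn B (Icc 0 1))
    (hb : ∀ t ∈ Icc (0 : ℝ) 1, ‖B t‖ ≤ 1 / 2) (y₀ : F) :
    ∃ y : ℝ → F, y 0 = y₀ ∧
      ∀ t ∈ Icc (0 : ℝ) 1, HasDerivWithinAt y (B t (y t)) (Icc 0 1) t := by
  have hP : IsPicardLindelof (fun t y => B t y) (tmin := 0) (tmax := 1) ⟨0, by simp⟩ y₀
      ‖y₀‖₊ 0 ‖y₀‖₊ (1 / 2) := by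
    refine ⟨fun t ht => ?_, fun y _ => ?_, fun t ht y hy => ?_, by simp⟩
    · refine ((B t).lipschitz.weaken ?_).lipschitzOnWith
      exact_mod_cast hb t ht
    · exact hB.clm_apply continuousOn_const
    · have h1 : ‖y‖ ≤ 2 * ‖y₀‖ := by
        have h2 : ‖y - y₀‖ ≤ ‖y₀‖ := by simpa [dist_eq_norm] using hy
        linarith [norm_le_norm_sub_add y y₀]
      calc ‖B t y‖ ≤ ‖B t‖ * ‖y‖ := (B t).le_opNorm y
        _ ≤ 1 / 2 * (2 * ‖y₀‖) := by gcongr; exact hb t ht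
        _ = ‖y₀‖ := by ring
  exact hP.exists_eq_forall_mem_Icc_hasDerivWithinAt₀

/-- Constants for a coefficient of class `C^2` near a point. -/
theorem exists_ball_bounds {G : Type*} [NormedAddCommGroup G] [NormedSpace ℝ G] {A : E → G}
    {Ω : Set E} (hΩ : IsOpen Ω) {z₀ : E} (hz₀ : z₀ ∈ Ω) (hA : ContDiffOn ℝ 2 A Ω) :
    ∃ K r : ℝ, 0 ≤ K ∧ 0 < r ∧ K * r ≤ 1 / 2 ∧ r ≤ 1 ∧ ball z₀ r ⊆ Ω ∧
      (∀ z ∈ ball z₀ r, ‖A z‖ ≤ K) ∧ (∀ z ∈ ball z₀ r, ‖fderiv ℝ A z‖ ≤ K) ∧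
      ∀ z ∈ ball z₀ r, ∀ z' ∈ ball z₀ r,
        ‖A z' - A z - fderiv ℝ A z (z' - z)‖ ≤ K * ‖z' - z‖ ^ 2 := by
  have hc : ContDiffAt ℝ 2 A z₀ := hA.contDiffAt (hΩ.mem_nhds hz₀)
  have hd : ContDiffAt ℝ 1 (fderiv ℝ A) z₀ := hc.fderiv_right (by norm_num)
  obtain ⟨K₀, s, hs, hlip⟩ := hd.exists_lipschitzOnWith
  -- One constant dominates the Lipschitz constant of the derivative and, near `z₀`, both `‖A‖` and
  -- `‖fderiv ℝ A‖`; the radius is then cut to `1 / (2K)` or less.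
  set K : ℝ := K₀ + ‖A z₀‖ + 1 + ‖fderiv ℝ A z₀‖ with hK
  have hK0 : 0 < K := by positivity
  have h1 : ∀ᶠ z in 𝓝 z₀, z ∈ Ω ∧ z ∈ s ∧ ‖A z‖ < ‖A z₀‖ + 1 ∧
      ‖fderiv ℝ A z‖ < ‖fderiv ℝ A z₀‖ + 1 :=
    Filter.Eventually.and (hΩ.mem_nhds hz₀) (Filter.Eventually.and hs
      ((hc.continuousAt.norm.eventually (gt_mem_nhds (lt_add_one _))).and
        (hd.continuousAt.norm.eventually (gt_mem_nhds (lt_add_one _)))))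
  obtain ⟨r₁, hr₁, hball⟩ := Metric.eventually_nhds_iff_ball.1 h1
  set r := min r₁ (min 1 (1 / 2 / K)) with hr
  have hrr₁ : ball z₀ r ⊆ ball z₀ r₁ := ball_subset_ball (min_le_left _ _)
  have hrK : r ≤ 1 / 2 / K := (min_le_right _ _).trans (min_le_right _ _)
  have hr0 : 0 < r := by positivity
  refine ⟨K, r, hK0.le, hr0, ?_, (min_le_right _ _).trans (min_le_left _ _),
    fun z hz => (hball z (hrr₁ hz)).1, fun z hz => ?_, fun z hz => ?_, fun z hz z' hz' => ?_⟩
  · calc K * r ≤ K * (1 / 2 / K) := by gcongr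
      _ = 1 / 2 := by field_simp
  · have := (hball z (hrr₁ hz)).2.2.1
    have h2 := K₀.2
    have h3 := norm_nonneg (fderiv ℝ A z₀)
    simp only [hK, NNReal.val_eq_coe] at *; linarith
  · have := (hball z (hrr₁ hz)).2.2.2
    have h2 := K₀.2
    have h3 := norm_nonneg (A z₀)
    simp only [hK, NNReal.val_eq_coe] at *; linarith
  · have hseg : segment ℝ z z' ⊆ ball z₀ r := (convex_ball z₀ r).segment_subset hz hz'
    have h2 := Convex.norm_image_sub_le_of_norm_fderiv_le' (𝕜 := ℝ) (f := A)
      (φ := fderiv ℝ A z) (C := K₀ * ‖z' - z‖) (s := segment ℝ z z') (x := z) (y := z')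
      (fun w hw => (hA.differentiableOn (by norm_num) w
        (hball w (hrr₁ (hseg hw))).1).differentiableAt
          (hΩ.mem_nhds (hball w (hrr₁ (hseg hw))).1))
      (fun w hw => by
        refine (hlip.norm_sub_le (hball w (hrr₁ (hseg hw))).2.1 (hball z (hrr₁ hz)).2.1).trans ?_
        gcongr
        exact norm_sub_le_of_mem_segment hw) (convex_segment z z') (left_mem_segment ℝ z z')
        (right_mem_segment ℝ z z')
    refine h2.trans ?_
    have : (K₀ : ℝ) ≤ K := by
      have h4 := norm_nonneg (A z₀)
      have h3 := norm_nonneg (fderiv ℝ A z₀)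
      linarith
    calc (K₀ : ℝ) * ‖z' - z‖ * ‖z' - z‖ = K₀ * ‖z' - z‖ ^ 2 := by ring
      _ ≤ _ := by gcongr

/-- Local solvability of the total differential equation `du = A u` under the integrability
condition. -/
theorem exists_hasFDerivAt_of_flat [CompleteSpace F] {A : E → E →L[ℝ] F →L[ℝ] F} {Ω : Set E}
    (hΩ : IsOpen Ω) {z₀ : E} (hz₀ : z₀ ∈ Ω) (hA : ContDiffOn ℝ 2 A Ω)
    (hflat : ∀ z ∈ Ω, ∀ v w, fderiv ℝ A z v w + A z w ∘L A z v
      = fderiv ℝ A z w v + A z v ∘L A z w) :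
    ∃ r > 0, ball z₀ r ⊆ Ω ∧ ∀ y₀ : F, ∃ u : E → F, u z₀ = y₀ ∧
      ∀ z ∈ ball z₀ r, HasFDerivAt u ((A z).flip (u z)) z := by
  obtain ⟨K, r, hK, hr, hKr, hr1, hsub, hA1, hA2, hA3⟩ := exists_ball_bounds hΩ hz₀ hA
  have hcont : ContinuousOn A (ball z₀ r) := (hA.continuousOn).mono hsub
  have hmem {x : E} (hx : ‖x‖ < r) {t : ℝ} (ht : t ∈ Icc (0 : ℝ) 1) : z₀ + t • x ∈ ball z₀ r := by
    simp only [mem_ball, dist_eq_norm, add_sub_cancel_left, norm_smul, Real.norm_eq_abs,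
      abs_of_nonneg ht.1]
    nlinarith [ht.2, norm_nonneg x]
  have hAx {x : E} (hx : ‖x‖ < r) {t : ℝ} (ht : t ∈ Icc (0 : ℝ) 1) :
      ‖A (z₀ + t • x) x‖ ≤ 1 / 2 := by
    calc ‖A (z₀ + t • x) x‖ ≤ ‖A (z₀ + t • x)‖ * ‖x‖ := ContinuousLinearMap.le_opNorm _ _
      _ ≤ K * r := by gcongr; exact hA1 _ (hmem hx ht)
      _ ≤ 1 / 2 := hKr
  refine ⟨r, hr, hsub, fun y₀ => ?_⟩
  -- On the ray `t ↦ z₀ + t x` the equation reduces to a linear ODE, and the solution sought at `z₀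
  -- + x` is the value at `t = 1`. The condition `‖x‖ < r` stands under the existential so that
  -- `choose` yields a family indexed by all `x`.
  have hsol (x : E) : ∃ y : ℝ → F, ‖x‖ < r → y 0 = y₀ ∧ ∀ t ∈ Icc (0 : ℝ) 1,
      HasDerivWithinAt y (A (z₀ + t • x) x (y t)) (Icc 0 1) t := by
    by_cases hx : ‖x‖ < r
    · obtain ⟨y, hy⟩ := exists_linear_ode_solution (B := fun t => A (z₀ + t • x) x)
        ((hcont.comp (by fun_prop) fun t ht => hmem hx ht).clm_apply continuousOn_const)
        (fun t ht => hAx hx ht) y₀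
      exact ⟨y, fun _ => hy⟩
    · exact ⟨0, fun h => absurd h hx⟩
  choose y hy using hsol
  have hybd {x : E} (hx : ‖x‖ < r) {t : ℝ} (ht : t ∈ Icc (0 : ℝ) 1) : ‖y x t‖ ≤ 4 * ‖y₀‖ := by
    have := norm_le_of_norm_deriv_le (hy x hx).2 (δ := ‖y₀‖) (by rw [(hy x hx).1]) le_rfl
      (fun t ht => by
        rw [add_zero]
        refine (ContinuousLinearMap.le_opNorm _ _).trans ?_
        gcongr
        exact hAx hx ht) t ht
    simpa using this
  have hA3' {x h : E} (hx : ‖x‖ < r) (hxh : ‖x + h‖ < r) {t : ℝ} (ht : t ∈ Icc (0 : ℝ) 1) :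
      ‖A (z₀ + t • (x + h)) - A (z₀ + t • x) - t • fderiv ℝ A (z₀ + t • x) h‖ ≤ K * ‖h‖ ^ 2 := by
    have h1 := hA3 _ (hmem hx ht) _ (hmem hxh ht)
    have h2 : z₀ + t • (x + h) - (z₀ + t • x) = t • h := by rw [smul_add]; abel
    rw [h2, ContinuousLinearMap.map_smul, norm_smul, Real.norm_eq_abs, abs_of_nonneg ht.1] at h1
    refine h1.trans ?_
    have : t * ‖h‖ ≤ 1 * ‖h‖ := by gcongr; exact ht.2
    have h0 : 0 ≤ t * ‖h‖ := mul_nonneg ht.1 (norm_nonneg h)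
    rw [one_mul] at this
    gcongr
  have hdiffA {x h : E} (hx : ‖x‖ < r) (hxh : ‖x + h‖ < r) (hh : ‖h‖ ≤ 1) {t : ℝ}
      (ht : t ∈ Icc (0 : ℝ) 1) :
      ‖A (z₀ + t • (x + h)) (x + h) - A (z₀ + t • x) x‖ ≤ 3 * K * ‖h‖ := by
    set D := fderiv ℝ A (z₀ + t • x)
    have h1 : A (z₀ + t • (x + h)) (x + h) - A (z₀ + t • x) x
        = (A (z₀ + t • (x + h)) - A (z₀ + t • x) - t • D h) x + t • D h x
          + A (z₀ + t • (x + h)) h := by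
      simp only [map_add, sub_apply, smul_apply]; abel
    have hx1 : ‖x‖ ≤ 1 := hx.le.trans hr1
    have n1 : ‖(A (z₀ + t • (x + h)) - A (z₀ + t • x) - t • D h) x‖ ≤ K * ‖h‖ := by
      refine (ContinuousLinearMap.le_opNorm _ _).trans ?_
      calc _ ≤ K * ‖h‖ ^ 2 * 1 := by gcongr; exact hA3' hx hxh ht
        _ ≤ K * ‖h‖ := by
          have : ‖h‖ ^ 2 ≤ ‖h‖ := by nlinarith [norm_nonneg h]
          nlinarith
    have n2 : ‖t • D h x‖ ≤ K * ‖h‖ := by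
      rw [norm_smul, Real.norm_eq_abs, abs_of_nonneg ht.1]
      calc t * ‖D h x‖ ≤ 1 * (K * ‖h‖ * 1) := by
            gcongr
            · exact ht.2
            · exact (D.le_opNorm₂ h x).trans (by gcongr; exact hA2 _ (hmem hx ht))
        _ = K * ‖h‖ := by ring
    have n3 : ‖A (z₀ + t • (x + h)) h‖ ≤ K * ‖h‖ :=
      (ContinuousLinearMap.le_opNorm _ _).trans (by gcongr; exact hA1 _ (hmem hxh ht))
    rw [h1]
    refine (norm_add₃_le).trans ?_
    linarith
  have hdiffy {x h : E} (hx : ‖x‖ < r) (hxh : ‖x + h‖ < r) (hh : ‖h‖ ≤ 1) {t : ℝ}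
      (ht : t ∈ Icc (0 : ℝ) 1) : ‖y (x + h) t - y x t‖ ≤ 48 * K * ‖y₀‖ * ‖h‖ := by
    have := norm_le_of_norm_deriv_le (f := fun t => y (x + h) t - y x t) (δ := 0)
      (ε := 12 * K * ‖y₀‖ * ‖h‖)
      (fun t ht => ((hy (x + h) hxh).2 t ht).sub ((hy x hx).2 t ht))
      (by simp [(hy (x + h) hxh).1, (hy x hx).1]) (by positivity)
      (fun t ht => by
        have h1 : A (z₀ + t • (x + h)) (x + h) (y (x + h) t) - A (z₀ + t • x) x (y x t)
            = A (z₀ + t • x) x (y (x + h) t - y x t)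
              + (A (z₀ + t • (x + h)) (x + h) - A (z₀ + t • x) x) (y (x + h) t) := by
          simp only [map_sub, sub_apply]; abel
        rw [h1]
        refine (norm_add_le _ _).trans (add_le_add ?_ ?_)
        · refine (ContinuousLinearMap.le_opNorm _ _).trans ?_
          gcongr
          exact hAx hx ht
        · refine (ContinuousLinearMap.le_opNorm _ _).trans ?_
          calc _ ≤ (3 * K * ‖h‖) * (4 * ‖y₀‖) := by
                gcongr
                · exact hdiffA hx hxh hh ht
                · exact hybd hxh ht
            _ = _ := by ring) t ht
    refine this.trans (le_of_eq (by ring))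
  refine ⟨fun z => y (z - z₀) 1, ?_, fun z hz => ?_⟩
  · have h0 : ‖(0 : E)‖ < r := by simpa using hr
    have := norm_le_of_norm_deriv_le (f := fun t => y 0 t - y₀) (δ := 0) (ε := 0)
      (fun t ht => ((hy 0 h0).2 t ht).sub_const y₀) (by simp [(hy 0 h0).1]) le_rfl
      (fun t ht => by simp) 1 (by simp)
    simp only [sub_self]
    rw [← sub_eq_zero, ← norm_le_zero_iff]
    simpa using this
  · set x := z - z₀ with hxdef
    have hx : ‖x‖ < r := by simpa [dist_eq_norm] using hz
    have hzx : z = z₀ + (1 : ℝ) • x := by simp [hxdef]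
    rw [hasFDerivAt_iff_isLittleO_nhds_zero]
    have hev : ∀ᶠ h : E in 𝓝 0, ‖x + h‖ < r ∧ ‖h‖ ≤ 1 := by
      have c1 : Filter.Tendsto (fun h : E => ‖x + h‖) (𝓝 0) (𝓝 ‖x + 0‖) :=
        (by fun_prop : Continuous fun h : E => ‖x + h‖).tendsto 0
      have c2 : Filter.Tendsto (fun h : E => ‖h‖) (𝓝 0) (𝓝 ‖(0 : E)‖) :=
        continuous_norm.tendsto 0
      exact (c1.eventually (gt_mem_nhds (by simpa using hx))).and
        ((c2.eventually (gt_mem_nhds (by simp : ‖(0 : E)‖ < 1))).mono fun _ h => h.le)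
    -- Differentiability with the prescribed derivative is proved with a quadratic remainder.
    have hbig : (fun h => y (z + h - z₀) 1 - y (z - z₀) 1 - (A z).flip (y (z - z₀) 1) h)
        =O[𝓝 0] fun h : E => ‖h‖ ^ 2 := by
      refine Asymptotics.IsBigO.of_bound
        (4 * (3 * K * (48 * K * ‖y₀‖) + K * (4 * ‖y₀‖) + K * (4 * ‖y₀‖))) ?_
      filter_upwards [hev] with h ⟨hxh, hh⟩
      have e1 : z + h - z₀ = x + h := by rw [hxdef]; abel
      rw [e1, norm_pow, norm_norm]
      -- Let `W(t) = y_{x+h}(t) - y_x(t) - t A(z₀ + t x) h y_x(t)`. It vanishes at `t = 0` and is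
      -- the remainder at `t = 1`; Grönwall applies once `‖W'‖ ≤ ‖W‖ / 2 + O(‖h‖²)`.
      have hW (t : ℝ) (ht : t ∈ Icc (0 : ℝ) 1) : HasDerivWithinAt
          (fun t => y (x + h) t - y x t - t • A (z₀ + t • x) h (y x t))
          (A (z₀ + t • (x + h)) (x + h) (y (x + h) t) - A (z₀ + t • x) x (y x t)
            - (t • (fderiv ℝ A (z₀ + t • x) x h (y x t)
                + A (z₀ + t • x) h (A (z₀ + t • x) x (y x t)))
              + A (z₀ + t • x) h (y x t))) (Icc 0 1) t := by
        have d0 : HasDerivAt (fun t : ℝ => z₀ + t • x) x t := by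
          simpa using ((hasDerivAt_id t).smul_const x).const_add z₀
        have hΩt := hΩ.mem_nhds (hsub (hmem hx ht))
        have dA : HasFDerivAt A (fderiv ℝ A (z₀ + t • x)) (z₀ + t • x) :=
          ((hA.contDiffAt hΩt).differentiableAt (by norm_num)).hasFDerivAt
        have d1 : HasDerivAt (fun t : ℝ => A (z₀ + t • x)) (fderiv ℝ A (z₀ + t • x) x) t :=
          HasFDerivAt.comp_hasDerivAt (E := E →L[ℝ] F →L[ℝ] F) (l := A) t dA d0
        have d2 : HasDerivAt (fun t : ℝ => A (z₀ + t • x) h) (fderiv ℝ A (z₀ + t • x) x h) t := by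
          simpa using d1.clm_apply (hasDerivAt_const t h)
        have d3 := d2.hasDerivWithinAt.clm_apply ((hy x hx).2 t ht)
        have d4 := (hasDerivWithinAt_id t (Icc (0 : ℝ) 1)).smul d3
        simp only [id, one_smul] at d4
        exact (((hy (x + h) hxh).2 t ht).sub ((hy x hx).2 t ht)).sub d4
      have hb := norm_le_of_norm_deriv_le hW (δ := 0)
        (ε := (3 * K * (48 * K * ‖y₀‖) + K * (4 * ‖y₀‖) + K * (4 * ‖y₀‖)) * ‖h‖ ^ 2)
        (by simp [(hy (x + h) hxh).1, (hy x hx).1]) (by positivity)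
        (fun t ht => by
          have hfl := hflat _ (hsub (hmem hx ht)) x h
          set D := fderiv ℝ A (z₀ + t • x) with hD
          set A₀ := A (z₀ + t • x) with hA₀
          set A₁ := A (z₀ + t • (x + h)) with hA₁
          have hfl' : D x h (y x t) + A₀ h (A₀ x (y x t))
              = D h x (y x t) + A₀ x (A₀ h (y x t)) := by
            simpa using congrArg (fun L : F →L[ℝ] F => L (y x t)) hfl
          -- Flatness exchanges `x` and `h` in the derivative of the third term of `W`. All terms of
          -- first order in `h` then combine into `A₀ x W`, and the other three terms are of second
          -- order.
          have h1 : A₁ (x + h) (y (x + h) t) - A₀ x (y x t)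
              - (t • (D x h (y x t) + A₀ h (A₀ x (y x t))) + A₀ h (y x t))
              = A₀ x (y (x + h) t - y x t - t • A₀ h (y x t))
                + (A₁ (x + h) - A₀ x) (y (x + h) t - y x t) + t • D h h (y x t)
                + (A₁ - A₀ - t • D h) (x + h) (y x t) := by
            rw [hfl']
            simp only [map_add, map_sub, map_smul, sub_apply, smul_apply, add_apply, smul_add]
            abel
          rw [h1]
          have n1 : ‖A₀ x (y (x + h) t - y x t - t • A₀ h (y x t))‖
              ≤ 1 / 2 * ‖y (x + h) t - y x t - t • A₀ h (y x t)‖ := by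
            refine (ContinuousLinearMap.le_opNorm _ _).trans ?_
            gcongr
            exact hAx hx ht
          have n2 : ‖(A₁ (x + h) - A₀ x) (y (x + h) t - y x t)‖
              ≤ (3 * K * ‖h‖) * (48 * K * ‖y₀‖ * ‖h‖) := by
            refine (ContinuousLinearMap.le_opNorm _ _).trans ?_
            gcongr
            · exact hdiffA hx hxh hh ht
            · exact hdiffy hx hxh hh ht
          have n3 : ‖t • D h h (y x t)‖ ≤ K * ‖h‖ * ‖h‖ * (4 * ‖y₀‖) := by
            rw [norm_smul, Real.norm_eq_abs, abs_of_nonneg ht.1]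
            calc t * ‖D h h (y x t)‖ ≤ 1 * (K * ‖h‖ * ‖h‖ * (4 * ‖y₀‖)) := by
                  gcongr
                  · exact ht.2
                  · refine (ContinuousLinearMap.le_opNorm _ _).trans ?_
                    gcongr
                    · exact (D.le_opNorm₂ h h).trans (by gcongr; exact hA2 _ (hmem hx ht))
                    · exact hybd hx ht
              _ = _ := one_mul _
          have n4 : ‖(A₁ - A₀ - t • D h) (x + h) (y x t)‖ ≤ K * ‖h‖ ^ 2 * 1 * (4 * ‖y₀‖) := by
            refine (ContinuousLinearMap.le_opNorm₂ _ _ _).trans ?_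
            gcongr
            · exact hA3' hx hxh ht
            · exact hxh.le.trans hr1
            · exact hybd hx ht
          refine (norm_add₄_le).trans ?_
          refine (add_le_add (add_le_add (add_le_add n1 n2) n3) n4).trans (le_of_eq ?_)
          ring) 1 (by simp)
      have e2 : y (x + h) 1 - y x 1 - (A z).flip (y x 1) h
          = y (x + h) 1 - y x 1 - (1 : ℝ) • A (z₀ + (1 : ℝ) • x) h (y x 1) := by
        rw [← hzx, one_smul]; rfl
      rw [e2]
      refine hb.trans (le_of_eq (by ring))
    exact hbig.trans_isLittleO (Asymptotics.isLittleO_norm_pow_id one_lt_two)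

/-- A solution of a total differential equation with smooth coefficients is smooth. -/
theorem contDiffOn_of_hasFDerivAt {u : E → F} {A : E → E →L[ℝ] F →L[ℝ] F} {Ω : Set E}
    (hΩ : IsOpen Ω) (hA : ContDiffOn ℝ ∞ A Ω)
    (hu : ∀ z ∈ Ω, HasFDerivAt u ((A z).flip (u z)) z) : ContDiffOn ℝ ∞ u Ω := by
  rw [contDiffOn_infty]
  intro n
  induction n with
  | zero =>
    rw [Nat.cast_zero, contDiffOn_zero]
    exact fun z hz => (hu z hz).continuousAt.continuousWithinAt
  | succ n ih =>
    rw [Nat.cast_add, Nat.cast_one, contDiffOn_succ_iff_fderiv_of_isOpen hΩ]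
    refine ⟨fun z hz => (hu z hz).differentiableAt.differentiableWithinAt, by simp, ?_⟩
    -- Bootstrap: the derivative of `u` is `A z` followed by evaluation at `u z`, hence as regular
    -- as `u` itself.
    have h1 : ContDiffOn ℝ n (fun z => ContinuousLinearMap.apply ℝ F (u z)) Ω :=
      ContDiff.comp_contDiffOn (ContinuousLinearMap.contDiff _) ih
    exact (h1.clm_comp (hA.of_le (WithTop.coe_le_coe.2 le_top))).congr
      fun z hz => (hu z hz).fderiv

end TotalDifferentialEquation

/-! ### Vector fields and frames read in a chart -/

section Chart

/-- The expression of the vector field `X` in the chart at `p`. -/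
def chartField (p : M) (X : VField M) : EuclideanSpace ℝ (Fin 4) → EuclideanSpace ℝ (Fin 4) :=
  fun z => (fun y => (mfderiv (𝓡 4) 𝓘(ℝ, EuclideanSpace ℝ (Fin 4)) (extChartAt (𝓡 4) p) y (X y) :
    EuclideanSpace ℝ (Fin 4))) ((extChartAt (𝓡 4) p).symm z)

/-- The image in the chart at `p` of the part of `U` in the domain of the chart. -/
def chartImage (p : M) (U : Set M) : Set (EuclideanSpace ℝ (Fin 4)) :=
  (extChartAt (𝓡 4) p).target ∩ (extChartAt (𝓡 4) p).symm ⁻¹' U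

variable {p : M} {U : Set M} {X Y : VField M} {f : M → ℝ} {x : M}
  {z : EuclideanSpace ℝ (Fin 4)}

theorem isOpen_chartImage (hU : IsOpen U) : IsOpen (chartImage p U) :=
  (continuousOn_extChartAt_symm p).isOpen_inter_preimage (isOpen_extChartAt_target p) hU

theorem mem_chartImage (hx : x ∈ U) (hxp : x ∈ (extChartAt (𝓡 4) p).source) :
    extChartAt (𝓡 4) p x ∈ chartImage p U :=
  ⟨(extChartAt (𝓡 4) p).map_source hxp, by rwa [Set.mem_preimage, (extChartAt (𝓡 4) p).left_inv hxp]⟩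

theorem SmoothFnOn.comp_chart_symm (hf : SmoothFnOn f U) :
    ContDiffOn ℝ ∞ (f ∘ (extChartAt (𝓡 4) p).symm) (chartImage p U) := by
  rw [← contMDiffOn_iff_contDiffOn]
  exact ContMDiffOn.comp hf ((contMDiffOn_extChartAt_symm p).mono Set.inter_subset_left)
    Set.inter_subset_right

theorem differentiableAt_comp_chart_symm (hz : z ∈ (extChartAt (𝓡 4) p).target)
    (hf : MDifferentiableAt (𝓡 4) 𝓘(ℝ, ℝ) f ((extChartAt (𝓡 4) p).symm z)) :
    DifferentiableAt ℝ (f ∘ (extChartAt (𝓡 4) p).symm) z := by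
  rw [← mdifferentiableAt_iff_differentiableAt]
  refine MDifferentiableAt.comp z hf ?_
  exact (mdifferentiableOn_extChartAt_symm (I := 𝓡 4) z hz).mdifferentiableAt
    ((isOpen_extChartAt_target p).mem_nhds hz)

theorem fderiv_comp_chart_symm (hz : z ∈ (extChartAt (𝓡 4) p).target)
    (hf : MDifferentiableAt (𝓡 4) 𝓘(ℝ, ℝ) f ((extChartAt (𝓡 4) p).symm z)) :
    fderiv ℝ (f ∘ (extChartAt (𝓡 4) p).symm) z (chartField p X z)
      = dirDeriv X f ((extChartAt (𝓡 4) p).symm z) := by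
  have hd := differentiableAt_comp_chart_symm hz hf
  have hx := (extChartAt (𝓡 4) p).map_target hz
  unfold chartField
  set x := (extChartAt (𝓡 4) p).symm z with hxz
  have hzx : extChartAt (𝓡 4) p x = z := (extChartAt (𝓡 4) p).right_inv hz
  have hev : (f ∘ (extChartAt (𝓡 4) p).symm) ∘ extChartAt (𝓡 4) p =ᶠ[𝓝 x] f := by
    filter_upwards [(isOpen_extChartAt_source p).mem_nhds hx] with y hy
    rw [Function.comp_apply, Function.comp_apply, (extChartAt (𝓡 4) p).left_inv hy]
  have h1 : dirDeriv X ((f ∘ (extChartAt (𝓡 4) p).symm) ∘ extChartAt (𝓡 4) p) x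
      = dirDeriv X f x := by
    unfold dirDeriv mvfderiv
    rw [hev.mfderiv_eq, hev.self_of_nhds]
  rw [← h1]
  have h2 := mvfderiv_comp_apply (I := 𝓡 4) (I' := 𝓘(ℝ, EuclideanSpace ℝ (Fin 4)))
    (g := f ∘ (extChartAt (𝓡 4) p).symm) (f := extChartAt (𝓡 4) p) x
    (by rw [hzx]; exact hd.mdifferentiableAt)
    (mdifferentiableAt_extChartAt (by simpa using hx)) (X x)
  refine Eq.trans ?_ h2.symm
  rw [← mfderiv_eq_fderiv, ← hzx]
  rfl

theorem smoothFnOn_chart_coord (j : Fin 4) :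
    SmoothFnOn (fun x : M => extChartAt (𝓡 4) p x j) (extChartAt (𝓡 4) p).source := by
  have h1 := contMDiffOn_extChartAt (I := 𝓡 4) (n := ∞) (x := p)
  rw [← extChartAt_source (𝓡 4)] at h1
  have h2 : ContMDiff 𝓘(ℝ, EuclideanSpace ℝ (Fin 4)) 𝓘(ℝ, ℝ) ∞
      (fun v : EuclideanSpace ℝ (Fin 4) => v j) :=
    ((EuclideanSpace.proj j : EuclideanSpace ℝ (Fin 4) →L[ℝ] ℝ)).contDiff.contMDiff
  exact h2.comp_contMDiffOn h1

/-- The `j`-th component of a field is its derivative of the `j`-th coordinate function. Smoothness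
and brackets of chart expressions are thereby reduced to facts on `dirDeriv`. -/
theorem chartField_apply (hz : z ∈ (extChartAt (𝓡 4) p).target) (j : Fin 4) :
    chartField p X z j
      = dirDeriv X (fun x => extChartAt (𝓡 4) p x j) ((extChartAt (𝓡 4) p).symm z) := by
  have hx := (extChartAt (𝓡 4) p).map_target hz
  rw [← fderiv_comp_chart_symm hz ((smoothFnOn_chart_coord j).mdifferentiableAt
    (isOpen_extChartAt_source p) hx)]
  have hev : (fun x => extChartAt (𝓡 4) p x j) ∘ (extChartAt (𝓡 4) p).symm
      =ᶠ[𝓝 z] fun w => (EuclideanSpace.proj j : EuclideanSpace ℝ (Fin 4) →L[ℝ] ℝ) w := by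
    filter_upwards [(isOpen_extChartAt_target p).mem_nhds hz] with w hw
    rw [Function.comp_apply, (extChartAt (𝓡 4) p).right_inv hw]
    rfl
  rw [hev.fderiv_eq, ContinuousLinearMap.fderiv]
  rfl

theorem chartField_sum {ι : Type*} (s : Finset ι) (c : ι → M → ℝ) (F : ι → VField M)
    (h : X ((extChartAt (𝓡 4) p).symm z) = ∑ i ∈ s, c i ((extChartAt (𝓡 4) p).symm z) •
      F i ((extChartAt (𝓡 4) p).symm z)) :
    chartField p X z = ∑ i ∈ s, c i ((extChartAt (𝓡 4) p).symm z) • chartField p (F i) z := by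
  simp only [chartField, h, map_sum, map_smul]
  rfl

namespace LorentzMetric.IsOrthonormalFrame

variable {g : LorentzMetric M} {e : Fin 4 → VField M}

theorem contDiffOn_chartField (he : g.IsOrthonormalFrame e) (hU : IsOpen U)
    (hX : SmoothOn X U) : ContDiffOn ℝ ∞ (chartField p X) (chartImage p U) := by
  rw [contDiffOn_euclidean]
  intro j
  set V := U ∩ (extChartAt (𝓡 4) p).source
  have h1 := he.smoothFnOn_dirDeriv (hU.inter (isOpen_extChartAt_source p))
    (hX.mono Set.inter_subset_left)
    ((smoothFnOn_chart_coord (p := p) j).mono Set.inter_subset_right)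
  refine ((h1.comp_chart_symm (p := p)).mono ?_).congr fun z hz => chartField_apply hz.1 j
  exact fun z hz => ⟨hz.1, hz.2, (extChartAt (𝓡 4) p).map_target hz.1⟩

/-- This is `dirDeriv_bracket` applied to each coordinate function. -/
theorem lieBracket_chartField (he : g.IsOrthonormalFrame e) (hU : IsOpen U)
    (hX : SmoothOn X U) (hY : SmoothOn Y U) (hz : z ∈ chartImage p U) :
    fderiv ℝ (chartField p Y) z (chartField p X z) - fderiv ℝ (chartField p X) z (chartField p Y z)
      = chartField p (bracket X Y) z := by
  have hW : IsOpen (U ∩ (extChartAt (𝓡 4) p).source) := hU.inter (isOpen_extChartAt_source p)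
  have hx : (extChartAt (𝓡 4) p).symm z ∈ U ∩ (extChartAt (𝓡 4) p).source :=
    ⟨hz.2, (extChartAt (𝓡 4) p).map_target hz.1⟩
  have key {X Y : VField M} (hY : SmoothOn Y U) (j : Fin 4) :
      fderiv ℝ (chartField p Y) z (chartField p X z) j
        = dirDeriv X (dirDeriv Y fun x => extChartAt (𝓡 4) p x j)
          ((extChartAt (𝓡 4) p).symm z) := by
    have hd : DifferentiableAt ℝ (chartField p Y) z :=
      ((he.contDiffOn_chartField hU hY).contDiffAt
        ((isOpen_chartImage hU).mem_nhds hz)).differentiableAt (by simp)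
    have h1 : MDifferentiableAt (𝓡 4) 𝓘(ℝ, ℝ) (dirDeriv Y fun x => extChartAt (𝓡 4) p x j)
        ((extChartAt (𝓡 4) p).symm z) :=
      (he.smoothFnOn_dirDeriv hW (hY.mono Set.inter_subset_left)
        ((smoothFnOn_chart_coord (p := p) j).mono Set.inter_subset_right)).mdifferentiableAt hW hx
    rw [← fderiv_comp_chart_symm hz.1 h1]
    have hev : (dirDeriv Y fun x => extChartAt (𝓡 4) p x j) ∘ (extChartAt (𝓡 4) p).symm
        =ᶠ[𝓝 z] fun w => (EuclideanSpace.proj j : EuclideanSpace ℝ (Fin 4) →L[ℝ] ℝ)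
          (chartField p Y w) := by
      filter_upwards [(isOpen_extChartAt_target p).mem_nhds hz.1] with w hw
      exact (chartField_apply hw j).symm
    have h2 := (((EuclideanSpace.proj j : EuclideanSpace ℝ (Fin 4) →L[ℝ] ℝ)).hasFDerivAt.comp z
      hd.hasFDerivAt)
    have h3 : fderiv ℝ (fun w => (EuclideanSpace.proj j : EuclideanSpace ℝ (Fin 4) →L[ℝ] ℝ)
          (chartField p Y w)) z = _ := h2.fderiv
    rw [hev.fderiv_eq, h3]
    rfl
  ext j
  rw [chartField_apply hz.1, he.dirDeriv_bracket hW hx (hX.mono Set.inter_subset_left)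
    (hY.mono Set.inter_subset_left)
    ((smoothFnOn_chart_coord (p := p) j).mono Set.inter_subset_right), ← key hX, ← key hY]
  rfl

end LorentzMetric.IsOrthonormalFrame

/-- The frame `e` at a point of the chart at `p`, as a linear map from the components of a vector
to the vector. -/
def chartFrame (e : Fin 4 → VField M) (p : M) (z : EuclideanSpace ℝ (Fin 4)) :
    (Fin 4 → ℝ) →L[ℝ] EuclideanSpace ℝ (Fin 4) :=
  ∑ a, (ContinuousLinearMap.proj (R := ℝ) (φ := fun _ : Fin 4 => ℝ) a).smulRight
    (chartField p (e a) z)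

/-- The dual basis of the frame `e` in the chart at `p`. -/
def chartCoframe (e : Fin 4 → VField M) (p : M) (a : Fin 4) (z : EuclideanSpace ℝ (Fin 4)) :
    EuclideanSpace ℝ (Fin 4) →L[ℝ] ℝ :=
  (ContinuousLinearMap.proj (R := ℝ) (φ := fun _ : Fin 4 => ℝ) a).comp
    (ContinuousLinearMap.inverse (chartFrame e p z))

theorem chartFrame_apply (e : Fin 4 → VField M) (c : Fin 4 → ℝ) :
    chartFrame e p z c = ∑ a, c a • chartField p (e a) z := by
  simp [chartFrame]

namespace LorentzMetric.IsOrthonormalFrame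

variable {g : LorentzMetric M} {e : Fin 4 → VField M}

/-- The differential of the chart is invertible, so the frame vectors remain independent in the
chart; equality of dimensions does the rest. -/
theorem isInvertible_chartFrame (he : g.IsOrthonormalFrame e)
    (hz : z ∈ (extChartAt (𝓡 4) p).target) : (chartFrame e p z).IsInvertible := by
  have hx := (extChartAt (𝓡 4) p).map_target hz
  have hinj : Function.Injective (chartFrame e p z) := by
    rw [injective_iff_map_eq_zero]
    intro c hc
    rw [chartFrame_apply] at hc
    set x := (extChartAt (𝓡 4) p).symm z with hxz
    obtain ⟨L, hL⟩ := isInvertible_mfderiv_extChartAt (I := 𝓡 4) hx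
    have h1 : L (∑ a, c a • e a x) = 0 := by
      rw [map_sum]
      refine Eq.trans ?_ hc
      refine Finset.sum_congr rfl fun a _ => ?_
      rw [map_smul]
      congr 1
      exact congrArg (fun T => T (e a x)) hL
    rw [map_eq_zero_iff L L.injective] at h1
    funext a
    exact Fintype.linearIndependent_iff.1 (he.linearIndependent x) c h1 a
  have hfin : Module.finrank ℝ (Fin 4 → ℝ) = Module.finrank ℝ (EuclideanSpace ℝ (Fin 4)) := by
    simp
  exact ⟨(LinearEquiv.ofInjectiveOfFinrankEq (chartFrame e p z).toLinearMap hinj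
    hfin).toContinuousLinearEquiv, by ext; rfl⟩

theorem chartCoframe_chartField (he : g.IsOrthonormalFrame e)
    (hz : z ∈ (extChartAt (𝓡 4) p).target) (a b : Fin 4) :
    chartCoframe e p a z (chartField p (e b) z) = if a = b then 1 else 0 := by
  obtain ⟨L, hL⟩ := he.isInvertible_chartFrame hz
  have h1 : chartField p (e b) z = L (Pi.single b 1) := by
    have : chartField p (e b) z = chartFrame e p z (Pi.single b 1) := by
      rw [chartFrame_apply]
      simp [Pi.single_apply]
    rw [this, ← hL]; rfl
  rw [h1, chartCoframe, ← hL, ContinuousLinearMap.inverse_equiv]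
  simp [Pi.single_apply]

theorem contDiffOn_chartCoframe (he : g.IsOrthonormalFrame e) (a : Fin 4) :
    ContDiffOn ℝ ∞ (chartCoframe e p a) (extChartAt (𝓡 4) p).target := by
  have h0 : chartImage p Set.univ = (extChartAt (𝓡 4) p).target := by simp [chartImage]
  have h1 : ContDiffOn ℝ ∞ (chartFrame e p) (extChartAt (𝓡 4) p).target := by
    refine ContDiffOn.sum fun a _ => ?_
    have h2 := he.contDiffOn_chartField (p := p) isOpen_univ (he.smoothOn a)
    rw [h0] at h2
    exact contDiffOn_const.smulRight h2
  intro z hz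
  have h3 : ContDiffAt ℝ ∞ ContinuousLinearMap.inverse (chartFrame e p z) :=
    (he.isInvertible_chartFrame hz).contDiffAt_map_inverse
  exact contDiffWithinAt_const.clm_comp (h3.comp_contDiffWithinAt z (h1 z hz))

/-- Two linear maps which agree on the frame are equal. -/
theorem clm_ext (he : g.IsOrthonormalFrame e) {G : Type*} [NormedAddCommGroup G]
    [NormedSpace ℝ G] (hz : z ∈ (extChartAt (𝓡 4) p).target)
    {S T : EuclideanSpace ℝ (Fin 4) →L[ℝ] G}
    (h : ∀ a, S (chartField p (e a) z) = T (chartField p (e a) z)) : S = T := by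
  obtain ⟨L, hL⟩ := he.isInvertible_chartFrame hz
  ext v
  have hv : v = ∑ a, L.symm v a • chartField p (e a) z := by
    rw [← chartFrame_apply, ← hL]
    simp
  rw [hv, map_sum, map_sum]
  simp [h]

end LorentzMetric.IsOrthonormalFrame

end Chart

/-! ### Linear systems `e_a(u) = N_a u` along a frame -/

section LinearSystem

set_option synthInstance.maxHeartbeats 200000

variable {p : M} {U : Set M} {x : M} {z : EuclideanSpace ℝ (Fin 4)}

/-- The coefficient operator, in the chart at `p`, of the system `e_a(u) = N_a u`. -/
def chartCoeff (e : Fin 4 → VField M) (p : M)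
    (N : Fin 4 → EuclideanSpace ℝ (Fin 4) → (Fin 4 → ℝ) →L[ℝ] Fin 4 → ℝ) :
    EuclideanSpace ℝ (Fin 4) →
      EuclideanSpace ℝ (Fin 4) →L[ℝ] (Fin 4 → ℝ) →L[ℝ] Fin 4 → ℝ :=
  fun z => ∑ a, (chartCoframe e p a z).smulRight (N a z)

namespace LorentzMetric.IsOrthonormalFrame

variable {g : LorentzMetric M} {e : Fin 4 → VField M}

theorem chartCoeff_chartField (he : g.IsOrthonormalFrame e)
    (hz : z ∈ (extChartAt (𝓡 4) p).target)
    (N : Fin 4 → EuclideanSpace ℝ (Fin 4) → (Fin 4 → ℝ) →L[ℝ] Fin 4 → ℝ) (a : Fin 4) :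
    chartCoeff e p N z (chartField p (e a) z) = N a z := by
  simp [chartCoeff, he.chartCoframe_chartField hz]

theorem contDiffOn_chartCoeff (he : g.IsOrthonormalFrame e)
    {N : Fin 4 → EuclideanSpace ℝ (Fin 4) → (Fin 4 → ℝ) →L[ℝ] Fin 4 → ℝ}
    (hN : ∀ a, ContDiffOn ℝ ∞ (N a) (chartImage p U)) :
    ContDiffOn ℝ ∞ (chartCoeff e p N) (chartImage p U) :=
  ContDiffOn.sum fun a _ =>
    ((he.contDiffOn_chartCoframe a).mono Set.inter_subset_left).smulRight (hN a)

/-- A system along the frame is a total differential equation in the chart: both linear maps need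
only be compared on frame vectors, where equality is the system itself. -/
theorem hasFDerivAt_of_system (he : g.IsOrthonormalFrame e)
    {N : Fin 4 → EuclideanSpace ℝ (Fin 4) → (Fin 4 → ℝ) →L[ℝ] Fin 4 → ℝ}
    {u : Fin 4 → M → ℝ} (hz : z ∈ (extChartAt (𝓡 4) p).target)
    (hu : ∀ c, MDifferentiableAt (𝓡 4) 𝓘(ℝ, ℝ) (u c) ((extChartAt (𝓡 4) p).symm z))
    (hd : ∀ a c, dirDeriv (e a) (u c) ((extChartAt (𝓡 4) p).symm z)
      = N a z (fun b => u b ((extChartAt (𝓡 4) p).symm z)) c) :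
    HasFDerivAt (fun w b => u b ((extChartAt (𝓡 4) p).symm w))
      ((chartCoeff e p N z).flip (fun b => u b ((extChartAt (𝓡 4) p).symm z))) z := by
  have h1 : DifferentiableAt ℝ (fun w b => u b ((extChartAt (𝓡 4) p).symm w)) z :=
    differentiableAt_pi.2 fun b => differentiableAt_comp_chart_symm hz (hu b)
  have h2 : fderiv ℝ (fun w b => u b ((extChartAt (𝓡 4) p).symm w)) z
      = (chartCoeff e p N z).flip (fun b => u b ((extChartAt (𝓡 4) p).symm z)) := by
    refine he.clm_ext hz fun a => ?_
    rw [ContinuousLinearMap.flip_apply, he.chartCoeff_chartField hz]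
    funext c
    have h3 : fderiv ℝ (fun w b => u b ((extChartAt (𝓡 4) p).symm w)) z
        = ContinuousLinearMap.pi fun b => fderiv ℝ (u b ∘ (extChartAt (𝓡 4) p).symm) z :=
      fderiv_pi fun b => differentiableAt_comp_chart_symm hz (hu b)
    rw [← hd, ← fderiv_comp_chart_symm hz (hu c), h3]
    rfl
  rw [← h2]
  exact h1.hasFDerivAt

/-- A solution of a linear system `e_a(u^c) = N_a{}^c{}_b u^b` which vanishes at a point vanishes
near it. -/
theorem eventually_eq_zero_of_system (he : g.IsOrthonormalFrame e) (hU : IsOpen U) (hx : x ∈ U)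
    {N : Fin 4 → Fin 4 → Fin 4 → M → ℝ} (hN : ∀ a c b, SmoothFnOn (N a c b) U)
    {u : Fin 4 → M → ℝ} (hu : ∀ c, SmoothFnOn (u c) U)
    (hd : ∀ y ∈ U, ∀ a c, dirDeriv (e a) (u c) y = ∑ b, N a c b y * u b y)
    (h0 : ∀ c, u c x = 0) : ∀ᶠ y in 𝓝 x, ∀ c, u c y = 0 := by
  let N' : Fin 4 → EuclideanSpace ℝ (Fin 4) → (Fin 4 → ℝ) →L[ℝ] Fin 4 → ℝ := fun a z =>
    ∑ c, ∑ b, (N a c b ((extChartAt (𝓡 4) x).symm z)) •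
      (ContinuousLinearMap.proj (R := ℝ) (φ := fun _ : Fin 4 => ℝ) b).smulRight
        (Pi.single c 1 : Fin 4 → ℝ)
  have hN' (a) : ContDiffOn ℝ ∞ (N' a) (chartImage x U) :=
    ContDiffOn.sum fun c _ => ContDiffOn.sum fun b _ =>
      ((hN a c b).comp_chart_symm).smul contDiffOn_const
  have happ (a z v c) : N' a z v c = ∑ b, N a c b ((extChartAt (𝓡 4) x).symm z) * v b := by
    simp [N', Finset.sum_apply, Pi.single_apply]
  have hmem : extChartAt (𝓡 4) x x ∈ chartImage x U := mem_chartImage hx (mem_extChartAt_source x)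
  have h1 := eventually_eq_zero_of_hasFDerivAt
    (u := fun w b => u b ((extChartAt (𝓡 4) x).symm w))
    (A := chartCoeff e x N') (isOpen_chartImage hU) hmem
    (he.contDiffOn_chartCoeff hN').continuousOn
    (fun z hz => he.hasFDerivAt_of_system hz.1
      (fun c => (hu c).mdifferentiableAt hU hz.2)
      (fun a c => by rw [hd _ hz.2, happ]))
    (by funext b; simpa using h0 b)
  have h2 := (continuousAt_extChartAt (I := 𝓡 4) x).eventually h1
  filter_upwards [h2, extChartAt_source_mem_nhds (I := 𝓡 4) x] with y hy hys c
  have := congrFun hy c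
  rwa [(extChartAt (𝓡 4) x).left_inv hys] at this

theorem bracket_const_comb (he : g.IsOrthonormalFrame e) (Z : VField M) (c : Fin 4 → ℝ) :
    bracket Z (∑ d, (fun _ : M => c d) • e d) x = ∑ d, c d • bracket Z (e d) x := by
  rw [bracket_sum_right fun d _ =>
    MDifferentiableAt.smul_section mdifferentiableAt_const (he.diffAt d)]
  refine Finset.sum_congr rfl fun d _ => ?_
  rw [bracket_smul_right mdifferentiableAt_const (he.diffAt d), dirDeriv_const]
  simp

/-- The Jacobi identity for constant structure functions. -/
theorem jacobi_of_const (he : g.IsOrthonormalFrame e) [Nonempty M] {C : Fin 4 → Fin 4 → Fin 4 → ℝ}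
    (hC : ∀ a b x, bracket (e a) (e b) x = ∑ d, C a b d • e d x) (a b n c : Fin 4) :
    ∑ m, C b n m * C a m c = ∑ m, C a b m * C m n c + ∑ m, C a n m * C b m c := by
  obtain ⟨x⟩ := ‹Nonempty M›
  have hC' (a b) : bracket (e a) (e b) = ∑ d, (fun _ : M => C a b d) • e d := by
    funext x; simp [hC]
  have h := bracket_bracket (he.smoothOn a) (he.smoothOn b) (he.smoothOn n) isOpen_univ
    (Set.mem_univ x)
  rw [hC' b n, hC' a b, hC' a n, he.bracket_const_comb, he.bracket_const_comb,
    bracket_swap (Y := e n), he.bracket_const_comb, ← Finset.sum_neg_distrib] at h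
  have h1 (m) : -(C a b m • bracket (e n) (e m) x) = C a b m • bracket (e m) (e n) x := by
    rw [bracket_swap, smul_neg, neg_neg]
  simp only [h1] at h
  simp only [hC, Finset.smul_sum, smul_smul] at h
  have h2 (S : Fin 4 → Fin 4 → ℝ) : ∑ m, ∑ d, S m d • e d x = ∑ d, (∑ m, S m d) • e d x := by
    rw [Finset.sum_comm]
    simp only [Finset.sum_smul]
  rw [h2, h2, h2, ← Finset.sum_add_distrib, ← sub_eq_zero, ← Finset.sum_sub_distrib] at h
  simp only [← add_smul, ← sub_smul] at h
  have := Fintype.linearIndependent_iff.1 (he.linearIndependent x) _ h c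
  linarith

/-- If the structure functions of the frame are constant, the system expressing that
`∑ u^c e_c` commutes with the frame has solutions with arbitrary initial values. -/
theorem exists_solution_of_const (he : g.IsOrthonormalFrame e) {C : Fin 4 → Fin 4 → Fin 4 → ℝ}
    (hC : ∀ a b x, bracket (e a) (e b) x = ∑ d, C a b d • e d x) (p : M) :
    ∃ V : TopologicalSpace.Opens M, p ∈ V ∧ ∀ y₀ : Fin 4 → ℝ, ∃ u : Fin 4 → M → ℝ,
      (∀ c, SmoothFnOn (u c) V) ∧ (∀ c, u c p = y₀ c) ∧
      ∀ x ∈ V, ∀ a c, dirDeriv (e a) (u c) x = - ∑ b, C a b c * u b x := by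
  have : Nonempty M := ⟨p⟩
  let N : Fin 4 → (Fin 4 → ℝ) →L[ℝ] Fin 4 → ℝ := fun a =>
    - ∑ c, ∑ b, C a b c •
      (ContinuousLinearMap.proj (R := ℝ) (φ := fun _ : Fin 4 => ℝ) b).smulRight
        (Pi.single c 1 : Fin 4 → ℝ)
  have happ (a v c) : N a v c = - ∑ b, C a b c * v b := by
    simp [N, Finset.sum_apply, Pi.single_apply]
  -- Up to sign the matrices `N_a` form the adjoint representation, so their commutators encode the
  -- Jacobi identity.
  have hNN (a b) : N a ∘L N b - N b ∘L N a = - ∑ d, C a b d • N d := by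
    ext v c
    have h1 (a b c) (v : Fin 4 → ℝ) : N a (N b v) c = ∑ n, (∑ m, C b n m * C a m c) * v n := by
      rw [happ]
      simp only [happ, Finset.sum_mul, Finset.mul_sum, ← Finset.sum_neg_distrib]
      rw [Finset.sum_comm]
      refine Finset.sum_congr rfl fun n _ => Finset.sum_congr rfl fun m _ => by ring
    have h2 : (- ∑ d, C a b d • N d) v c = ∑ n, (∑ m, C a b m * C m n c) * v n := by
      simp only [neg_apply, sum_apply, smul_apply,
        Pi.neg_apply, Finset.sum_apply, Pi.smul_apply, happ, smul_eq_mul, Finset.sum_mul,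
        Finset.mul_sum, ← Finset.sum_neg_distrib]
      rw [Finset.sum_comm]
      refine Finset.sum_congr rfl fun n _ => Finset.sum_congr rfl fun m _ => by ring
    rw [h2]
    change N a (N b v) c - N b (N a v) c = _
    rw [h1, h1, ← Finset.sum_sub_distrib]
    refine Finset.sum_congr rfl fun n _ => ?_
    rw [he.jacobi_of_const hC a b n c]
    ring
  set A := chartCoeff e p (fun a _ => N a) with hA
  have h0 : chartImage p Set.univ = (extChartAt (𝓡 4) p).target := by simp [chartImage]
  have hAs : ContDiffOn ℝ ∞ A (extChartAt (𝓡 4) p).target := by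
    rw [← h0]
    exact he.contDiffOn_chartCoeff fun a => contDiffOn_const
  have hopen := isOpen_extChartAt_target (I := 𝓡 4) p
  have hAe {z} (hz : z ∈ (extChartAt (𝓡 4) p).target) (a : Fin 4) :
      A z (chartField p (e a) z) = N a := he.chartCoeff_chartField hz _ a
  -- Differentiate the identity `A(e_b) = N_b`, whose right-hand side is constant.
  have hdA {z} (hz : z ∈ (extChartAt (𝓡 4) p).target) (a b : Fin 4) :
      fderiv ℝ A z (chartField p (e a) z) (chartField p (e b) z)
        = - A z (fderiv ℝ (chartField p (e b)) z (chartField p (e a) z)) := by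
    have hd : DifferentiableAt ℝ A z :=
      (hAs.contDiffAt (hopen.mem_nhds hz)).differentiableAt (by simp)
    have hde : DifferentiableAt ℝ (chartField p (e b)) z :=
      ((he.contDiffOn_chartField (p := p) isOpen_univ (he.smoothOn b)).contDiffAt
        ((isOpen_chartImage isOpen_univ).mem_nhds (by rwa [h0]))).differentiableAt (by simp)
    have h1 := (hd.hasFDerivAt.clm_apply hde.hasFDerivAt).fderiv
    have h2 : (fun w => A w (chartField p (e b) w)) =ᶠ[𝓝 z] fun _ => N b := by
      filter_upwards [hopen.mem_nhds hz] with w hw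
      exact hAe hw b
    rw [h2.fderiv_eq, fderiv_const_apply] at h1
    have h3 := congrArg (fun T => T (chartField p (e a) z)) h1.symm
    simp at h3
    rw [eq_neg_iff_add_eq_zero, add_comm]
    exact h3
  have hflat : ∀ z ∈ (extChartAt (𝓡 4) p).target, ∀ v w,
      fderiv ℝ A z v w + A z w ∘L A z v = fderiv ℝ A z w v + A z v ∘L A z w := by
    intro z hz v w
    -- Integrability is the symmetry of the bilinear map `T`, to be checked on pairs of frame
    -- vectors. There the antisymmetric part of the derivative is `-A([e_a, e_b]) = -∑ C_{ab}^d
    -- N_d`, which equals the commutator of `N_a` and `N_b`.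
    set T := fderiv ℝ A z + (ContinuousLinearMap.compL ℝ (Fin 4 → ℝ) (Fin 4 → ℝ)
      (Fin 4 → ℝ)).flip.bilinearComp (A z) (A z) with hT
    have hTT : T = T.flip := by
      refine he.clm_ext hz fun a => he.clm_ext hz fun b => ?_
      have hb := he.lieBracket_chartField isOpen_univ (he.smoothOn a) (he.smoothOn b)
        (z := z) (p := p) (by rwa [h0])
      have hb' := chartField_sum (p := p) (z := z) Finset.univ (fun d _ => C a b d) e (hC a b _)
      rw [hb'] at hb
      have hb2 := congrArg (A z) hb
      simp only [map_sub, map_sum, map_smul, hAe hz] at hb2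
      change fderiv ℝ A z _ _ + A z _ ∘L A z _ = fderiv ℝ A z _ _ + A z _ ∘L A z _
      rw [hdA hz, hdA hz, hAe hz, hAe hz]
      have h5 := hNN a b
      rw [← hb2] at h5
      rw [← sub_eq_zero] at h5 ⊢
      rw [← neg_eq_zero, ← h5]
      abel
    exact congrArg (fun S => S v w) hTT
  obtain ⟨r, hr, hsub, hsol⟩ := exists_hasFDerivAt_of_flat hopen (mem_extChartAt_target p)
    (hAs.of_le (WithTop.coe_le_coe.2 le_top)) hflat
  refine ⟨⟨(extChartAt (𝓡 4) p).source ∩ extChartAt (𝓡 4) p ⁻¹'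
    Metric.ball (extChartAt (𝓡 4) p p) r, (continuousOn_extChartAt p).isOpen_inter_preimage
      (isOpen_extChartAt_source p) Metric.isOpen_ball⟩,
    ⟨mem_extChartAt_source p, by simpa using hr⟩, fun y₀ => ?_⟩
  obtain ⟨u, hu0, hu⟩ := hsol y₀
  have hus := contDiffOn_of_hasFDerivAt Metric.isOpen_ball (hAs.mono hsub) hu
  have hsm (c : Fin 4) : SmoothFnOn (fun x => u (extChartAt (𝓡 4) p x) c)
      ((extChartAt (𝓡 4) p).source ∩ extChartAt (𝓡 4) p ⁻¹'
        Metric.ball (extChartAt (𝓡 4) p p) r) := by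
    have h1 := contMDiffOn_extChartAt (I := 𝓡 4) (n := ∞) (x := p)
    rw [← extChartAt_source (𝓡 4)] at h1
    exact ((contDiffOn_pi.1 hus c).contMDiffOn).comp (h1.mono Set.inter_subset_left)
      Set.inter_subset_right
  refine ⟨fun c x => u (extChartAt (𝓡 4) p x) c, hsm, fun c => congrFun hu0 c,
    fun x hx a c => ?_⟩
  have hzt := (extChartAt (𝓡 4) p).map_source hx.1
  have hleft := (extChartAt (𝓡 4) p).left_inv hx.1
  have hd := (hsm c).mdifferentiableAt ((continuousOn_extChartAt p).isOpen_inter_preimage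
      (isOpen_extChartAt_source p) Metric.isOpen_ball) hx
  rw [← hleft] at hd
  have h1 := fderiv_comp_chart_symm (X := e a) hzt hd
  have hev : (fun x => u (extChartAt (𝓡 4) p x) c) ∘ (extChartAt (𝓡 4) p).symm
      =ᶠ[𝓝 (extChartAt (𝓡 4) p x)] fun w => u w c := by
    filter_upwards [hopen.mem_nhds hzt] with w hw
    rw [Function.comp_apply, (extChartAt (𝓡 4) p).right_inv hw]
  have h2 := (hasFDerivAt_pi'.1 (hu _ hx.2)) c
  have h3 : fderiv ℝ (fun w => u w c) (extChartAt (𝓡 4) p x) = _ := h2.fderiv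
  rw [hev.fderiv_eq, h3, hleft] at h1
  rw [← h1, ← happ, ← hAe hzt a]
  rfl

end LorentzMetric.IsOrthonormalFrame

end LinearSystem

/-! ### Connection coefficients, the concomitant, and homogeneity from constant coefficients -/

section Connection

namespace LorentzMetric

variable {g : LorentzMetric M} {U : Set M} {X Y Z : VField M} {f : M → ℝ} {x : M}
  {e : Fin 4 → VField M}

namespace IsOrthonormalFrame

/-- A function-linear functional of vector fields is determined by its values on the frame. -/
theorem expand_of_linear (he : g.IsOrthonormalFrame e) {Q : VField M → Prop}
    {R : (M → ℝ) → Prop} {P : VField M → ℝ}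
    (hQadd : ∀ Y Z, Q Y → Q Z → Q (Y + Z)) (hQsmul : ∀ f Y, R f → Q Y → Q (f • Y))
    (hadd : ∀ Y Z, Q Y → Q Z → P (Y + Z) = P Y + P Z)
    (hsmul : ∀ f Y, R f → Q Y → P (f • Y) = f x * P Y) (hQe : ∀ c, Q (e c))
    (hR : ∀ c, R (g.coframe e c X)) :
    P X = ∑ c, g.coframe e c X x * P (e c) := by
  have h (c) := hQsmul _ _ (hR c) (hQe c)
  conv_lhs => rw [he.eq_sum X, Fin.sum_univ_four]
  rw [hadd _ _ (hQadd _ _ (hQadd _ _ (h 0) (h 1)) (h 2)) (h 3),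
    hadd _ _ (hQadd _ _ (h 0) (h 1)) (h 2), hadd _ _ (h 0) (h 1), hsmul _ _ (hR 0) (hQe 0),
    hsmul _ _ (hR 1) (hQe 1), hsmul _ _ (hR 2) (hQe 2), hsmul _ _ (hR 3) (hQe 3),
    Fin.sum_univ_four]

theorem expand_of_smooth (he : g.IsOrthonormalFrame e) {P : VField M → ℝ}
    (hadd : ∀ Y Z, SmoothOn Y U → SmoothOn Z U → P (Y + Z) = P Y + P Z)
    (hsmul : ∀ f Y, SmoothFnOn f U → SmoothOn Y U → P (f • Y) = f x * P Y)
    (hX : SmoothOn X U) : P X = ∑ c, g.coframe e c X x * P (e c) :=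
  he.expand_of_linear (Q := fun Y => SmoothOn Y U) (R := fun f => SmoothFnOn f U)
    (fun _ _ => SmoothOn.add) (fun _ _ => SmoothOn.smul) hadd hsmul (fun c => he.smoothOn c)
    (fun c => he.smoothFnOn_coframe c hX)

theorem expand_of_diffAt (he : g.IsOrthonormalFrame e) {P : VField M → ℝ}
    (hadd : ∀ Y Z, DiffAt Y x → DiffAt Z x → P (Y + Z) = P Y + P Z)
    (hsmul : ∀ f Y, MDifferentiableAt (𝓡 4) 𝓘(ℝ, ℝ) f x → DiffAt Y x → P (f • Y) = f x * P Y)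
    (hX : DiffAt X x) : P X = ∑ c, g.coframe e c X x * P (e c) :=
  he.expand_of_linear (Q := fun Y => DiffAt Y x)
    (R := fun f => MDifferentiableAt (𝓡 4) 𝓘(ℝ, ℝ) f x)
    (fun _ _ h h' => mdifferentiableAt_add_section h h')
    (fun _ _ h h' => MDifferentiableAt.smul_section h h') hadd hsmul (fun c => he.diffAt c)
    (fun c => he.mdifferentiableAt_coframe c hX)

theorem coframe_nabla_left (he : g.IsOrthonormalFrame e) (hX : DiffAt X x) (hY : DiffAt Y x)
    (d : Fin 4) : g.coframe e d (g.nabla X Y) x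
      = ∑ c, g.coframe e c X x * g.coframe e d (g.nabla (e c) Y) x := by
  refine he.expand_of_diffAt (P := fun X => g.coframe e d (g.nabla X Y) x)
    (fun A B hA hB => ?_) (fun f A hf hA => ?_) hX
  · have h : g.nabla (A + B) Y x = (g.nabla A Y + g.nabla B Y) x := he.nabla_add_left hA hB hY
    rw [coframe_congr d h, coframe_add]
  · have h : g.nabla (f • A) Y x = (f • g.nabla A Y) x := he.nabla_smul_left hf hA hY
    rw [coframe_congr d h, coframe_smul]

/-- The difference `θ^d(∇_X Y) - X(θ^d(Y))` is function-linear in `Y`, hence determined by its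
values on the frame, where the second term vanishes. -/
theorem coframe_nabla_right (he : g.IsOrthonormalFrame e) (hX : DiffAt X x) (hY : DiffAt Y x)
    (d : Fin 4) : g.coframe e d (g.nabla X Y) x = dirDeriv X (g.coframe e d Y) x
      + ∑ c, g.coframe e c Y x * g.coframe e d (g.nabla X (e c)) x := by
  have := he.expand_of_diffAt
    (P := fun Y => g.coframe e d (g.nabla X Y) x - dirDeriv X (g.coframe e d Y) x)
    (fun A B hA hB => ?_) (fun f A hf hA => ?_) hY
  · have h (c) : dirDeriv X (g.coframe e d (e c)) x = 0 := by
      rw [show g.coframe e d (e c) = fun _ => if d = c then 1 else 0 from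
        funext fun y => he.coframe_frame d c, dirDeriv_const]
    simp only [h, sub_zero] at this
    linarith
  · have h : g.nabla X (A + B) x = (g.nabla X A + g.nabla X B) x := he.nabla_add_right hX hA hB
    have h2 : g.coframe e d (A + B) = fun y => g.coframe e d A y + g.coframe e d B y :=
      funext fun y => coframe_add d
    rw [coframe_congr d h, coframe_add, h2, dirDeriv_fun_add (he.mdifferentiableAt_coframe d hA)
      (he.mdifferentiableAt_coframe d hB)]
    ring
  · have h : g.nabla X (f • A) x = (dirDeriv X f • A + f • g.nabla X A) x :=
      he.nabla_smul_right hf hX hA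
    have h2 : g.coframe e d (f • A) = fun y => f y * g.coframe e d A y :=
      funext fun y => coframe_smul d
    rw [coframe_congr d h, coframe_add, coframe_smul, coframe_smul, h2,
      dirDeriv_fun_mul hf (he.mdifferentiableAt_coframe d hA)]
    ring

theorem smoothFnOn_connCoeff (he : g.IsOrthonormalFrame e) (c a b : Fin 4) :
    SmoothFnOn (g.connCoeff e c a b) Set.univ :=
  he.smoothFnOn_coframe c (he.smoothOn_nabla isOpen_univ (he.smoothOn b) (he.smoothOn a))

theorem coframe_connVec (he : g.IsOrthonormalFrame e) (d : Fin 4) :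
    g.coframe e d (g.connVec e X Y) x
      = ∑ a, ∑ b, g.connCoeff e d a b x * (g.coframe e b X x * g.coframe e a Y x) := by
  have h1 : g.connVec e X Y x = (∑ c, (fun x => ∑ a, ∑ b, g.connCoeff e c a b x *
      (g.coframe e b X x * g.coframe e a Y x)) • e c) x := by
    simp only [connVec, Finset.sum_apply, Pi.smul_apply', Finset.sum_smul, mul_assoc]
    rw [Finset.sum_congr rfl fun a _ => Finset.sum_comm, Finset.sum_comm]
  rw [coframe_congr d h1, Fin.sum_univ_four]
  simp only [coframe_add, coframe_smul, he.coframe_frame]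
  fin_cases d <;> simp

/-- The decomposition `∇ = ∇' + H`, where `∇'` differentiates the frame components. -/
theorem coframe_nabla_eq (he : g.IsOrthonormalFrame e) (hX : DiffAt X x) (hY : DiffAt Y x)
    (d : Fin 4) : g.coframe e d (g.nabla X Y) x
      = dirDeriv X (g.coframe e d Y) x + g.coframe e d (g.connVec e X Y) x := by
  rw [he.coframe_nabla_right hX hY, he.coframe_connVec]
  congr 1
  refine Finset.sum_congr rfl fun a _ => ?_
  rw [he.coframe_nabla_left hX (he.diffAt a), Finset.mul_sum]
  refine Finset.sum_congr rfl fun b _ => ?_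
  rw [connCoeff]
  ring

theorem connTensor_eq (he : g.IsOrthonormalFrame e) (W : Fin 3 → VField M) :
    g.connTensor e W x = ∑ c, ∑ a, ∑ b, sgn c * (g.connCoeff e c a b x *
      (g.coframe e b (W 0) x * g.coframe e a (W 1) x * g.coframe e c (W 2) x)) := by
  rw [connTensor, he.inn_eq_sum]
  refine Finset.sum_congr rfl fun c _ => ?_
  rw [he.coframe_connVec, Finset.sum_mul, Finset.mul_sum]
  refine Finset.sum_congr rfl fun a _ => ?_
  rw [Finset.sum_mul, Finset.mul_sum]
  refine Finset.sum_congr rfl fun b _ => ?_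
  ring

/-- The first differential concomitant is the derivative of the connection coefficients. -/
theorem concomitant_eq (he : g.IsOrthonormalFrame e) {W : Fin 4 → VField M}
    (hW : ∀ i, Smooth (W i)) (x : M) :
    g.concomitant e W x = ∑ c, ∑ a, ∑ b, sgn c * (dirDeriv (W 0) (g.connCoeff e c a b) x *
      (g.coframe e b (W 1) x * g.coframe e a (W 2) x * g.coframe e c (W 3) x)) := by
  have hD (i) : DiffAt (W i) x := (hW i).diffAt
  have hm (i a) := he.mdifferentiableAt_coframe a (hD i)
  have hγ (c a b) : MDifferentiableAt (𝓡 4) 𝓘(ℝ, ℝ) (g.connCoeff e c a b) x :=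
    (he.smoothFnOn_connCoeff c a b).mdifferentiableAt isOpen_univ (Set.mem_univ x)
  have hH : g.connTensor e (Fin.tail W) = fun x => ∑ c, ∑ a, ∑ b, sgn c * (g.connCoeff e c a b x *
      (g.coframe e b (W 1) x * g.coframe e a (W 2) x * g.coframe e c (W 3) x)) := by
    funext y
    exact he.connTensor_eq _
  have hm1 (a b) : MDifferentiableAt (𝓡 4) 𝓘(ℝ, ℝ)
      (fun x => g.coframe e b (W 1) x * g.coframe e a (W 2) x) x := (hm 1 b).mul (hm 2 a)
  have hm2 (c a b) : MDifferentiableAt (𝓡 4) 𝓘(ℝ, ℝ)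
      (fun x => g.coframe e b (W 1) x * g.coframe e a (W 2) x * g.coframe e c (W 3) x) x :=
    (hm1 a b).mul (hm 3 c)
  have hm3 (c a b) : MDifferentiableAt (𝓡 4) 𝓘(ℝ, ℝ)
      (fun x => g.connCoeff e c a b x * (g.coframe e b (W 1) x * g.coframe e a (W 2) x *
        g.coframe e c (W 3) x)) x := (hγ c a b).mul (hm2 c a b)
  have hm4 (c a b) : MDifferentiableAt (𝓡 4) 𝓘(ℝ, ℝ)
      (fun x => sgn c * (g.connCoeff e c a b x * (g.coframe e b (W 1) x * g.coframe e a (W 2) x *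
        g.coframe e c (W 3) x))) x := mdifferentiableAt_const.mul (hm3 c a b)
  have hd : dirDeriv (W 0) (g.connTensor e (Fin.tail W)) x = ∑ c, ∑ a, ∑ b, sgn c *
      (g.connCoeff e c a b x * (g.coframe e b (W 1) x * g.coframe e a (W 2) x *
          dirDeriv (W 0) (g.coframe e c (W 3)) x
        + g.coframe e c (W 3) x * (g.coframe e b (W 1) x * dirDeriv (W 0) (g.coframe e a (W 2)) x
          + g.coframe e a (W 2) x * dirDeriv (W 0) (g.coframe e b (W 1)) x))
        + (g.coframe e b (W 1) x * g.coframe e a (W 2) x * g.coframe e c (W 3) x) *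
          dirDeriv (W 0) (g.connCoeff e c a b) x) := by
    rw [hH, dirDeriv_fun_sum fun c _ => mdifferentiableAt_fun_sum fun a _ =>
      mdifferentiableAt_fun_sum fun b _ => hm4 c a b]
    refine Finset.sum_congr rfl fun c _ => ?_
    rw [dirDeriv_fun_sum fun a _ => mdifferentiableAt_fun_sum fun b _ => hm4 c a b]
    refine Finset.sum_congr rfl fun a _ => ?_
    rw [dirDeriv_fun_sum fun b _ => hm4 c a b]
    refine Finset.sum_congr rfl fun b _ => ?_
    rw [dirDeriv_const_mul _ (hm3 c a b), dirDeriv_fun_mul (hγ c a b) (hm2 c a b),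
      dirDeriv_fun_mul (hm1 a b) (hm 3 c), dirDeriv_fun_mul (hm 1 b) (hm 2 a)]
  -- Each slot correction in `∇H` splits into a derivative of components and an `H`-term. The former
  -- cancels against the Leibniz expansion `hd`, the latter against the quadratic terms of the
  -- concomitant; only the derivatives of the coefficients survive.
  have n (i d) := he.coframe_nabla_eq (hD 0) (hD i) d
  have hc2 (A B C : VField M) : (![A, B, C] : Fin 3 → VField M) 2 = C := rfl
  rw [concomitant, nablaT, hd, Fin.sum_univ_three]
  simp only [he.connTensor_eq]
  simp only [Function.update_self, Fin.tail, Matrix.cons_val_zero, Matrix.cons_val_one,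
    hc2, ne_eq, Fin.reduceEq, not_false_eq_true,
    Function.update_of_ne, Fin.isValue, Fin.succ_zero_eq_one, Fin.succ_one_eq_two, Fin.reduceSucc,
    n, ← Finset.sum_add_distrib, ← Finset.sum_sub_distrib, zero_ne_one, one_ne_zero]
  refine Finset.sum_congr rfl fun c _ => Finset.sum_congr rfl fun a _ =>
    Finset.sum_congr rfl fun b _ => ?_
  ring

/-- Uniqueness for the system with zero coefficients, applied to `f - f x`, shows that `f` is
locally constant. -/
theorem exists_const_of_dirDeriv_eq_zero (he : g.IsOrthonormalFrame e) [ConnectedSpace M]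
    (hf : SmoothFnOn f Set.univ) (h : ∀ a x, dirDeriv (e a) f x = 0) : ∃ k, ∀ x, f x = k := by
  have hloc : IsLocallyConstant f := by
    rw [IsLocallyConstant.iff_eventually_eq]
    intro x
    have h1 := he.eventually_eq_zero_of_system isOpen_univ (Set.mem_univ x)
      (N := fun _ _ _ _ => 0) (u := fun _ y => f y - f x) (fun _ _ _ => SmoothFnOn.const 0)
      (fun _ => hf.sub (SmoothFnOn.const _)) (fun y _ a c => by
        rw [dirDeriv_fun_sub (hf.mdifferentiableAt isOpen_univ (Set.mem_univ y))
          mdifferentiableAt_const, h, dirDeriv_const]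
        simp) (by simp)
    filter_upwards [h1] with y hy
    exact sub_eq_zero.1 (hy 0)
  obtain ⟨x⟩ := (inferInstance : Nonempty M)
  exact ⟨f x, fun y => hloc.apply_eq_of_preconnectedSpace y x⟩

theorem connCoeff_const_iff (he : g.IsOrthonormalFrame e) [ConnectedSpace M] :
    (∀ c a b, ∃ k : ℝ, ∀ x, g.connCoeff e c a b x = k) ↔
      ∀ c a b d x, dirDeriv (e d) (g.connCoeff e c a b) x = 0 := by
  refine ⟨fun h c a b d x => ?_, fun h c a b =>
    he.exists_const_of_dirDeriv_eq_zero (he.smoothFnOn_connCoeff c a b) (h c a b)⟩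
  obtain ⟨k, hk⟩ := h c a b
  rw [funext hk, dirDeriv_const]

theorem concomitant_eq_zero_iff (he : g.IsOrthonormalFrame e) [ConnectedSpace M] :
    (∀ X : Fin 4 → VField M, (∀ i, Smooth (X i)) → ∀ x, g.concomitant e X x = 0) ↔
      ∀ c a b, ∃ k : ℝ, ∀ x, g.connCoeff e c a b x = k := by
  rw [he.connCoeff_const_iff]
  refine ⟨fun h c a b d x => ?_, fun h X hX x => ?_⟩
  -- The order of the arguments follows the slots of `H`: first the direction `b`, then the
  -- differentiated vector `a`, then the output `c`.
  · have h1 := h ![e d, e b, e a, e c]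
      (fun i => by fin_cases i; exacts [he.smooth d, he.smooth b, he.smooth a, he.smooth c]) x
    rw [he.concomitant_eq (fun i => by
      fin_cases i; exacts [he.smooth d, he.smooth b, he.smooth a, he.smooth c])] at h1
    simpa [he.coframe_frame, sgn_ne_zero] using h1
  · rw [he.concomitant_eq hX]
    refine Finset.sum_eq_zero fun c _ => Finset.sum_eq_zero fun a _ =>
      Finset.sum_eq_zero fun b _ => ?_
    rw [he.dirDeriv_eq_sum]
    simp [h]

/-- A field which commutes with the frame is a Killing field. -/
theorem killingAt_of_bracket_eq_zero (he : g.IsOrthonormalFrame e) {ξ : VField M}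
    (h : ∀ a, bracket ξ (e a) x = 0) : g.KillingAt ξ x := by
  intro X Y hX hY
  -- Bracketing with `ξ` merely differentiates the frame components, so the Killing equation becomes
  -- the Leibniz rule for `∑ sgn a θ^a(X) θ^a(Y)`.
  have hb {X : VField M} (hX : DiffAt X x) (c : Fin 4) :
      g.coframe e c (bracket ξ X) x = dirDeriv ξ (g.coframe e c X) x := by
    have h1 : bracket ξ X x = (∑ a, dirDeriv ξ (g.coframe e a X) • e a) x := by
      conv_lhs => rw [he.eq_sum X]
      rw [bracket_sum_right fun a _ =>
        MDifferentiableAt.smul_section (he.mdifferentiableAt_coframe a hX) (he.diffAt a)]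
      simp only [Finset.sum_apply]
      refine Finset.sum_congr rfl fun a _ => ?_
      rw [bracket_smul_right (he.mdifferentiableAt_coframe a hX) (he.diffAt a), h a]
      simp
    rw [coframe_congr c h1, Fin.sum_univ_four]
    simp only [coframe_add, coframe_smul, he.coframe_frame]
    fin_cases c <;> simp
  have h1 : g.inn X Y = fun x => ∑ a, sgn a * (g.coframe e a X x * g.coframe e a Y x) :=
    funext fun y => he.inn_eq_sum X Y y
  have hm (a) : MDifferentiableAt (𝓡 4) 𝓘(ℝ, ℝ)
      (fun x => g.coframe e a X x * g.coframe e a Y x) x :=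
    (he.mdifferentiableAt_coframe a hX).mul (he.mdifferentiableAt_coframe a hY)
  have hm' (a) : MDifferentiableAt (𝓡 4) 𝓘(ℝ, ℝ)
      (fun x => sgn a * (g.coframe e a X x * g.coframe e a Y x)) x :=
    mdifferentiableAt_const.mul (hm a)
  rw [h1, dirDeriv_fun_sum fun a _ => hm' a, he.inn_eq_sum,
    he.inn_eq_sum, ← Finset.sum_add_distrib]
  refine Finset.sum_congr rfl fun a _ => ?_
  rw [dirDeriv_const_mul _ (hm a), dirDeriv_fun_mul (he.mdifferentiableAt_coframe a hX)
    (he.mdifferentiableAt_coframe a hY), hb hX, hb hY]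
  ring

/-- A spacetime with a frame whose connection coefficients are constant is locally homogeneous. -/
theorem locallyHomogeneous_of_const (he : g.IsOrthonormalFrame e)
    (h : ∀ c a b, ∃ k : ℝ, ∀ x, g.connCoeff e c a b x = k) : g.LocallyHomogeneous := by
  classical
  choose k hk using h
  -- Since the torsion vanishes, the structure functions are differences of connection coefficients,
  -- hence constant.
  have hC (a b x) : bracket (e a) (e b) x = ∑ d, (k d b a - k d a b) • e d x := by
    have h1 : bracket (e a) (e b) x = (g.nabla (e a) (e b) - g.nabla (e b) (e a)) x :=
      he.nabla_sub_nabla (he.diffAt a) (he.diffAt b)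
    rw [h1, ← he.sum_coframe_smul (g.nabla (e a) (e b) - g.nabla (e b) (e a))]
    refine Finset.sum_congr rfl fun d _ => ?_
    rw [coframe_sub, ← hk d b a x, ← hk d a b x]
    rfl
  intro p
  obtain ⟨V, hpV, hV⟩ := he.exists_solution_of_const (C := fun a b d => k d b a - k d a b) hC p
  refine ⟨V, hpV, fun v => ?_⟩
  -- The coframe takes vector fields, so `v` is presented as the value at `p` of a field that is
  -- zero elsewhere; nothing is differentiated.
  obtain ⟨u, hu, hup, hue⟩ := hV fun c => g.coframe e c (Function.update (0 : VField M) p v) p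
  have hv : ∑ c, u c p • e c p = v := by
    simp only [hup, he.sum_coframe_smul]
    simp
  have hsm : SmoothOn (∑ c, u c • e c) (V : Set M) :=
    SmoothOn.sum fun c _ => SmoothOn.smul (hu c) (he.smoothOn c)
  have hbr : ∀ x ∈ V, ∀ a, bracket (∑ c, u c • e c) (e a) x = 0 := by
    intro x hx a
    rw [bracket_swap, bracket_sum_right fun c _ => MDifferentiableAt.smul_section
      ((hu c).mdifferentiableAt V.isOpen hx) (he.diffAt c), neg_eq_zero]
    have h1 (c) : bracket (e a) (u c • e c) x = (- ∑ b, (k c b a - k c a b) * u b x) • e c x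
        + ∑ d, (u c x * (k d c a - k d a c)) • e d x := by
      rw [bracket_smul_right ((hu c).mdifferentiableAt V.isOpen hx) (he.diffAt c), hue x hx, hC,
        Finset.smul_sum]
      simp only [smul_smul]
    simp only [h1, Finset.sum_add_distrib]
    have h2 : ∑ c, ∑ d, (u c x * (k d c a - k d a c)) • e d x
        = ∑ d, (∑ c, (k d c a - k d a c) * u c x) • e d x := by
      rw [Finset.sum_comm]
      simp only [Finset.sum_smul, mul_comm]
    rw [h2, ← Finset.sum_add_distrib]
    simp
  -- Members of `killingFields` must vanish outside the open set.
  refine ⟨fun x => if x ∈ V then (∑ c, u c • e c) x else 0, ⟨hsm.congr fun x hx => ?_,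
    fun x hx => ?_, fun x hx => if_neg hx⟩, ?_⟩
  · exact if_pos hx
  · refine he.killingAt_of_bracket_eq_zero fun a => ?_
    exact (bracket_congr (X' := ∑ c, u c • e c) (Y' := e a) V.isOpen hx
      (fun y hy => if_pos (show y ∈ V from hy)) (fun _ _ => rfl)).trans (hbr x hx a)
  · simp only [if_pos hpV]
    simpa using hv

end IsOrthonormalFrame

end LorentzMetric

end Connection

/-! ### Tensoriality of the curvature and its derivatives; invariance along Killing fields -/

section Tensors

namespace LorentzMetric

variable {g : LorentzMetric M} {U : Set M} {X Y Z ξ : VField M} {f : M → ℝ} {x : M}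
  {e : Fin 4 → VField M}

/-- On the open set `U`, `T` is a smooth tensor field: it is smooth on smooth fields, and
function-linear in each slot. -/
structure IsTensorOn (g : LorentzMetric M) (e : Fin 4 → VField M) (U : Set M) {k : ℕ}
    (T : (Fin k → VField M) → M → ℝ) : Prop where
  smooth : ∀ W, (∀ i, SmoothOn (W i) U) → SmoothFnOn (T W) U
  expand : ∀ W, (∀ i, SmoothOn (W i) U) → ∀ i, ∀ x ∈ U,
    T W x = ∑ c, g.coframe e c (W i) x * T (Function.update W i (e c)) x

theorem smoothOn_update {k : ℕ} {W : Fin k → VField M} (hW : ∀ i, SmoothOn (W i) U) (i : Fin k)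
    (hY : SmoothOn Y U) (j : Fin k) : SmoothOn (Function.update W i Y j) U := by
  by_cases h : j = i
  · subst h; simpa using hY
  · simpa [h] using hW j

theorem IsTensorOn.update {k : ℕ} {T : (Fin k → VField M) → M → ℝ} (hT : g.IsTensorOn e U T)
    {W : Fin k → VField M} (hW : ∀ i, SmoothOn (W i) U) (i : Fin k) (hY : SmoothOn Y U)
    (hx : x ∈ U) : T (Function.update W i Y) x
      = ∑ c, g.coframe e c Y x * T (Function.update W i (e c)) x := by
  rw [hT.expand _ (smoothOn_update hW i hY) i x hx]
  simp

theorem IsTensorOn.update_add {k : ℕ} {T : (Fin k → VField M) → M → ℝ}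
    (hT : g.IsTensorOn e U T) {W : Fin k → VField M} (hW : ∀ i, SmoothOn (W i) U) (i : Fin k)
    (hX : SmoothOn X U) (hY : SmoothOn Y U) (hZ : SmoothOn Z U) (hx : x ∈ U)
    (h : X x = Y x + Z x) : T (Function.update W i X) x
      = T (Function.update W i Y) x + T (Function.update W i Z) x := by
  rw [hT.update hW i hX hx, hT.update hW i hY hx, hT.update hW i hZ hx, ← Finset.sum_add_distrib]
  refine Finset.sum_congr rfl fun c _ => ?_
  have h' : X x = (Y + Z) x := h
  rw [coframe_congr c h', coframe_add, add_mul]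

/-- In the direction slot both terms are function-linear. In another slot `i`, the derivatives of
the components of `W_i` appear twice, from the Leibniz rule and from `∇ W_i`, and they cancel. -/
theorem IsTensorOn.nablaT (he : g.IsOrthonormalFrame e) (hU : IsOpen U) {k : ℕ}
    {T : (Fin k → VField M) → M → ℝ} (hT : g.IsTensorOn e U T) :
    g.IsTensorOn e U (g.nablaT T) where
  smooth W hW := by
    refine (he.smoothFnOn_dirDeriv hU (hW 0) (hT.smooth _ fun i => hW i.succ)).sub ?_
    exact SmoothFnOn.sum fun i _ => hT.smooth _ (smoothOn_update (fun i => hW i.succ) i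
      (he.smoothOn_nabla hU (hW 0) (hW i.succ)))
  expand W hW i x hx := by
    have hV (i) : SmoothOn (Fin.tail W i) U := hW i.succ
    have hD (i) : DiffAt (W i) x := (hW i).diffAt hU hx
    have hn {A B : VField M} (hA : SmoothOn A U) (hB : SmoothOn B U) : SmoothOn (g.nabla A B) U :=
      he.smoothOn_nabla hU hA hB
    refine Fin.cases ?_ (fun i => ?_) i
    · simp only [LorentzMetric.nablaT, Fin.tail_update_zero, Function.update_self, ne_eq,
        Fin.succ_ne_zero, not_false_eq_true, Function.update_of_ne]
      simp only [mul_sub, Finset.sum_sub_distrib, ← he.dirDeriv_eq_sum, Finset.mul_sum]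
      congr 1
      rw [Finset.sum_comm]
      refine Finset.sum_congr rfl fun j _ => ?_
      rw [hT.update hV j (hn (hW 0) (hW j.succ)) hx]
      have h1 (c) := hT.update hV j (hn (he.smoothOn c) (hW j.succ)) hx
      simp only [h1, he.coframe_nabla_left (hD 0) (hD j.succ), Finset.sum_mul, Finset.mul_sum]
      rw [Finset.sum_comm]
      simp only [mul_assoc]
    · set V := Fin.tail W with hVdef
      have hTV : ∀ y ∈ U, T V y
          = ∑ c, g.coframe e c (V i) y * T (Function.update V i (e c)) y :=
        fun y hy => hT.expand V hV i y hy
      have hVe (c) := smoothOn_update hV i (he.smoothOn (U := U) c)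
      have hm1 (c) := (he.smoothFnOn_coframe c (hV i)).mdifferentiableAt hU hx
      have hm2 (c) := (hT.smooth _ (hVe c)).mdifferentiableAt hU hx
      have hd : dirDeriv (W 0) (T V) x
          = ∑ c, (g.coframe e c (V i) x * dirDeriv (W 0) (T (Function.update V i (e c))) x
            + T (Function.update V i (e c)) x * dirDeriv (W 0) (g.coframe e c (V i)) x) := by
        have hm (c) : MDifferentiableAt (𝓡 4) 𝓘(ℝ, ℝ)
            (fun y => g.coframe e c (V i) y * T (Function.update V i (e c)) y) x :=
          (hm1 c).mul (hm2 c)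
        rw [dirDeriv_congr hU hx hTV, dirDeriv_fun_sum fun c _ => hm c]
        exact Finset.sum_congr rfl fun c _ => dirDeriv_fun_mul (hm1 c) (hm2 c)
      -- Only the correction in the slot being expanded, `j = i`, yields derivatives of components.
      have hj (j : Fin k) : T (Function.update V j (g.nabla (W 0) (V j))) x
          = ∑ c, g.coframe e c (V i) x * T (Function.update (Function.update V i (e c)) j
              (g.nabla (W 0) (Function.update V i (e c) j))) x
            + if j = i then ∑ c, T (Function.update V i (e c)) x *
                dirDeriv (W 0) (g.coframe e c (V i)) x else 0 := by
        by_cases hji : j = i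
        · subst hji
          simp only [Function.update_self, Function.update_idem, if_true]
          rw [hT.update hV j (hn (hW 0) (hV j)) hx]
          have h1 (c) := hT.update hV j (hn (hW 0) (he.smoothOn c)) hx
          simp only [h1, he.coframe_nabla_right (hD 0) ((hV j).diffAt hU hx), add_mul,
            Finset.sum_add_distrib, Finset.sum_mul, Finset.mul_sum]
          rw [add_comm]
          congr 1
          · rw [Finset.sum_comm]
            simp only [mul_assoc]
          · exact Finset.sum_congr rfl fun c _ => mul_comm _ _
        · simp only [hji, if_false, add_zero, Function.update_of_ne, ne_eq, not_false_eq_true]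
          rw [hT.expand _ (smoothOn_update hV j (hn (hW 0) (hV j))) i x hx]
          refine Finset.sum_congr rfl fun c _ => ?_
          rw [Function.update_of_ne (Ne.symm hji), Function.update_comm hji]
      have hWi (c : Fin 4) (j : Fin k) : Function.update W i.succ (e c) j.succ
          = Function.update V i (e c) j := by
        rw [hVdef, ← Fin.tail_update_succ]; rfl
      simp only [LorentzMetric.nablaT, Fin.tail_update_succ, ← hVdef, hWi]
      rw [hd]
      have hVj (j : Fin k) : W j.succ = V j := rfl
      have h0 (c : Fin 4) : Function.update W i.succ (e c) 0 = W 0 :=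
        Function.update_of_ne (Fin.succ_ne_zero i).symm _ _
      simp only [hVj, hj, h0, Finset.sum_add_distrib, mul_sub, Finset.sum_sub_distrib,
        Finset.sum_ite_eq', Finset.mem_univ, if_true, Finset.mul_sum]
      rw [Finset.sum_comm (f := fun (j : Fin k) (c : Fin 4) => _ * _)]
      ring

theorem curv_add_left (he : g.IsOrthonormalFrame e) (hU : IsOpen U) {X' : VField M}
    (hX : SmoothOn X U) (hX' : SmoothOn X' U) (hY : SmoothOn Y U) (hZ : SmoothOn Z U)
    (hx : x ∈ U) : g.curv (X + X') Y Z x = g.curv X Y Z x + g.curv X' Y Z x := by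
  have hn {A B : VField M} (hA : SmoothOn A U) (hB : SmoothOn B U) : SmoothOn (g.nabla A B) U :=
    he.smoothOn_nabla hU hA hB
  have hd {A : VField M} (hA : SmoothOn A U) {y : M} (hy : y ∈ U) : DiffAt A y := hA.diffAt hU hy
  simp only [curv, Pi.sub_apply]
  rw [he.nabla_add_left (hd hX hx) (hd hX' hx) (hd (hn hY hZ) hx),
    he.nabla_congr (Y' := g.nabla X Z + g.nabla X' Z) hU hx hY (hn (hX.add hX') hZ)
      (fun _ _ => rfl) (fun y hy => he.nabla_add_left (hd hX hy) (hd hX' hy) (hd hZ hy)),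
    he.nabla_add_right (hd hY hx) (hd (hn hX hZ) hx) (hd (hn hX' hZ) hx),
    he.nabla_congr (X' := bracket X Y + bracket X' Y) (Y' := Z) hU hx
      ((hX.add hX').bracket hY hU) hZ (fun y hy => bracket_add_left (hd hX hy) (hd hX' hy))
      (fun _ _ => rfl),
    he.nabla_add_left (hd (hX.bracket hY hU) hx) (hd (hX'.bracket hY hU) hx) (hd hZ hx)]
  abel

theorem curv_smul_left (he : g.IsOrthonormalFrame e) (hU : IsOpen U) (hf : SmoothFnOn f U)
    (hX : SmoothOn X U) (hY : SmoothOn Y U) (hZ : SmoothOn Z U)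
    (hx : x ∈ U) : g.curv (f • X) Y Z x = f x • g.curv X Y Z x := by
  have hn {A B : VField M} (hA : SmoothOn A U) (hB : SmoothOn B U) : SmoothOn (g.nabla A B) U :=
    he.smoothOn_nabla hU hA hB
  have hd {A : VField M} (hA : SmoothOn A U) {y : M} (hy : y ∈ U) : DiffAt A y := hA.diffAt hU hy
  have hf' {y : M} (hy : y ∈ U) := hf.mdifferentiableAt hU hy
  have hYf := (he.smoothFnOn_dirDeriv hU hY hf).neg
  have hYf' := hYf.mdifferentiableAt hU hx
  simp only [curv, Pi.sub_apply]
  rw [he.nabla_smul_left (hf' hx) (hd hX hx) (hd (hn hY hZ) hx),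
    he.nabla_congr (Y' := f • g.nabla X Z) hU hx hY (hn (SmoothOn.smul hf hX) hZ)
      (fun _ _ => rfl) (fun y hy => he.nabla_smul_left (hf' hy) (hd hX hy) (hd hZ hy)),
    he.nabla_smul_right (hf' hx) (hd hY hx) (hd (hn hX hZ) hx),
    he.nabla_congr (X' := (fun x => -dirDeriv Y f x) • X + f • bracket X Y) (Y' := Z) hU hx
      ((SmoothOn.smul hf hX).bracket hY hU) hZ (fun y hy => bracket_smul_left (hf' hy) (hd hX hy))
      (fun _ _ => rfl),
    he.nabla_add_left (hd (SmoothOn.smul hYf hX) hx)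
      (hd (SmoothOn.smul hf (hX.bracket hY hU)) hx) (hd hZ hx),
    he.nabla_smul_left hYf' (hd hX hx) (hd hZ hx),
    he.nabla_smul_left (hf' hx) (hd (hX.bracket hY hU) hx) (hd hZ hx)]
  module

/-- Antisymmetry carries linearity over from the first slot of the curvature to the second. -/
theorem curv_swap (he : g.IsOrthonormalFrame e) (hU : IsOpen U)
    (hX : SmoothOn X U) (hY : SmoothOn Y U) (hZ : SmoothOn Z U)
    (hx : x ∈ U) : g.curv X Y Z x = - g.curv Y X Z x := by
  have h1 : bracket X Y = (fun _ : M => (-1 : ℝ)) • bracket Y X := by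
    funext y
    rw [bracket_swap]; simp
  simp only [curv, Pi.sub_apply]
  rw [h1, he.nabla_smul_left mdifferentiableAt_const ((hY.bracket hX hU).diffAt hU hx)
    (hZ.diffAt hU hx)]
  module

theorem curv_add_right (he : g.IsOrthonormalFrame e) (hU : IsOpen U) {Z' : VField M}
    (hX : SmoothOn X U) (hY : SmoothOn Y U) (hZ : SmoothOn Z U) (hZ' : SmoothOn Z' U)
    (hx : x ∈ U) : g.curv X Y (Z + Z') x = g.curv X Y Z x + g.curv X Y Z' x := by
  have hn {A B : VField M} (hA : SmoothOn A U) (hB : SmoothOn B U) : SmoothOn (g.nabla A B) U :=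
    he.smoothOn_nabla hU hA hB
  have hd {A : VField M} (hA : SmoothOn A U) {y : M} (hy : y ∈ U) : DiffAt A y := hA.diffAt hU hy
  have key {X Y : VField M} (hX : SmoothOn X U) (hY : SmoothOn Y U) :
      g.nabla X (g.nabla Y (Z + Z')) x = g.nabla X (g.nabla Y Z) x + g.nabla X (g.nabla Y Z') x := by
    rw [he.nabla_congr (Y' := g.nabla Y Z + g.nabla Y Z') hU hx hX (hn hY (hZ.add hZ'))
      (fun _ _ => rfl) (fun y hy => he.nabla_add_right (hd hY hy) (hd hZ hy) (hd hZ' hy)),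
      he.nabla_add_right (hd hX hx) (hd (hn hY hZ) hx) (hd (hn hY hZ') hx)]
  simp only [curv, Pi.sub_apply]
  rw [key hX hY, key hY hX, he.nabla_add_right (hd (hX.bracket hY hU) hx) (hd hZ hx) (hd hZ' hx)]
  abel

/-- The first-order terms are symmetric in `X` and `Y`, and the second derivatives of `f` cancel by
`dirDeriv_bracket`. -/
theorem curv_smul_right (he : g.IsOrthonormalFrame e) (hU : IsOpen U) (hf : SmoothFnOn f U)
    (hX : SmoothOn X U) (hY : SmoothOn Y U) (hZ : SmoothOn Z U)
    (hx : x ∈ U) : g.curv X Y (f • Z) x = f x • g.curv X Y Z x := by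
  have hn {A B : VField M} (hA : SmoothOn A U) (hB : SmoothOn B U) : SmoothOn (g.nabla A B) U :=
    he.smoothOn_nabla hU hA hB
  have hd {A : VField M} (hA : SmoothOn A U) {y : M} (hy : y ∈ U) : DiffAt A y := hA.diffAt hU hy
  have hf' {y : M} (hy : y ∈ U) := hf.mdifferentiableAt hU hy
  have key {X Y : VField M} (hX : SmoothOn X U) (hY : SmoothOn Y U) :
      g.nabla X (g.nabla Y (f • Z)) x = dirDeriv X (dirDeriv Y f) x • Z x
        + dirDeriv Y f x • g.nabla X Z x + dirDeriv X f x • g.nabla Y Z x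
        + f x • g.nabla X (g.nabla Y Z) x := by
    have hYf := he.smoothFnOn_dirDeriv hU hY hf
    rw [he.nabla_congr (Y' := dirDeriv Y f • Z + f • g.nabla Y Z) hU hx hX
      (hn hY (SmoothOn.smul hf hZ)) (fun _ _ => rfl)
      (fun y hy => he.nabla_smul_right (hf' hy) (hd hY hy) (hd hZ hy)),
      he.nabla_add_right (hd hX hx) (hd (SmoothOn.smul hYf hZ) hx)
        (hd (SmoothOn.smul hf (hn hY hZ)) hx),
      he.nabla_smul_right (hYf.mdifferentiableAt hU hx) (hd hX hx) (hd hZ hx),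
      he.nabla_smul_right (hf' hx) (hd hX hx) (hd (hn hY hZ) hx)]
    abel
  simp only [curv, Pi.sub_apply]
  rw [key hX hY, key hY hX, he.nabla_smul_right (hf' hx) (hd (hX.bracket hY hU) hx) (hd hZ hx),
    he.dirDeriv_bracket hU hx hX hY hf]
  module

theorem smoothOn_curv (he : g.IsOrthonormalFrame e) (hU : IsOpen U)
    (hX : SmoothOn X U) (hY : SmoothOn Y U) (hZ : SmoothOn Z U) : SmoothOn (g.curv X Y Z) U := by
  have hn {A B : VField M} (hA : SmoothOn A U) (hB : SmoothOn B U) : SmoothOn (g.nabla A B) U :=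
    he.smoothOn_nabla hU hA hB
  exact ((hn hX (hn hY hZ)).sub (hn hY (hn hX hZ))).sub (hn (hX.bracket hY hU) hZ)

theorem isTensorOn_nablaRiem (he : g.IsOrthonormalFrame e) (hU : IsOpen U) :
    ∀ k, g.IsTensorOn e U (g.nablaRiem k)
  | k + 1 => (isTensorOn_nablaRiem he hU k).nablaT he hU
  | 0 =>
    { smooth := fun W hW => SmoothFnOn.inn (smoothOn_curv he hU (hW 0) (hW 1) (hW 2)) (hW 3)
      expand := fun W hW i x hx => by
        have e0 : g.inn (g.curv (W 0) (W 1) (W 2)) (W 3) x = ∑ c, g.coframe e c (W 0) x *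
            g.inn (g.curv (e c) (W 1) (W 2)) (W 3) x := by
          refine he.expand_of_smooth (U := U)
            (P := fun Y => g.inn (g.curv Y (W 1) (W 2)) (W 3) x)
            (fun A B hA hB => ?_) (fun f A hf hA => ?_) (hW 0)
          · have h : g.curv (A + B) (W 1) (W 2) x
                = (g.curv A (W 1) (W 2) + g.curv B (W 1) (W 2)) x :=
              curv_add_left he hU hA hB (hW 1) (hW 2) hx
            rw [inn_congr h rfl, inn_add_left]
          · have h : g.curv (f • A) (W 1) (W 2) x = (f • g.curv A (W 1) (W 2)) x :=
              curv_smul_left he hU hf hA (hW 1) (hW 2) hx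
            rw [inn_congr h rfl, inn_smul_left]
        have e1 : g.inn (g.curv (W 0) (W 1) (W 2)) (W 3) x = ∑ c, g.coframe e c (W 1) x *
            g.inn (g.curv (W 0) (e c) (W 2)) (W 3) x := by
          refine he.expand_of_smooth (U := U)
            (P := fun Y => g.inn (g.curv (W 0) Y (W 2)) (W 3) x)
            (fun A B hA hB => ?_) (fun f A hf hA => ?_) (hW 1)
          · have h : g.curv (W 0) (A + B) (W 2) x
                = (g.curv (W 0) A (W 2) + g.curv (W 0) B (W 2)) x := by
              rw [Pi.add_apply, curv_swap he hU (hW 0) (hA.add hB) (hW 2) hx,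
                curv_add_left he hU hA hB (hW 0) (hW 2) hx, curv_swap he hU (hW 0) hA (hW 2) hx,
                curv_swap he hU (hW 0) hB (hW 2) hx, neg_add]
            rw [inn_congr h rfl, inn_add_left]
          · have h : g.curv (W 0) (f • A) (W 2) x = (f • g.curv (W 0) A (W 2)) x := by
              rw [Pi.smul_apply', curv_swap he hU (hW 0) (SmoothOn.smul hf hA) (hW 2) hx,
                curv_smul_left he hU hf hA (hW 0) (hW 2) hx, curv_swap he hU (hW 0) hA (hW 2) hx,
                smul_neg]
            rw [inn_congr h rfl, inn_smul_left]
        have e2 : g.inn (g.curv (W 0) (W 1) (W 2)) (W 3) x = ∑ c, g.coframe e c (W 2) x *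
            g.inn (g.curv (W 0) (W 1) (e c)) (W 3) x := by
          refine he.expand_of_smooth (U := U)
            (P := fun Y => g.inn (g.curv (W 0) (W 1) Y) (W 3) x)
            (fun A B hA hB => ?_) (fun f A hf hA => ?_) (hW 2)
          · have h : g.curv (W 0) (W 1) (A + B) x
                = (g.curv (W 0) (W 1) A + g.curv (W 0) (W 1) B) x :=
              curv_add_right he hU (hW 0) (hW 1) hA hB hx
            rw [inn_congr h rfl, inn_add_left]
          · have h : g.curv (W 0) (W 1) (f • A) x = (f • g.curv (W 0) (W 1) A) x :=
              curv_smul_right he hU hf (hW 0) (hW 1) hA hx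
            rw [inn_congr h rfl, inn_smul_left]
        have e3 : g.inn (g.curv (W 0) (W 1) (W 2)) (W 3) x = ∑ c, g.coframe e c (W 3) x *
            g.inn (g.curv (W 0) (W 1) (W 2)) (e c) x :=
          he.expand_of_smooth (U := U) (P := fun Y => g.inn (g.curv (W 0) (W 1) (W 2)) Y x)
            (fun A B hA hB => inn_add_right) (fun f A hf hA => inn_smul_right) (hW 3)
        fin_cases i
        exacts [e0, e1, e2, e3] }

/-! ### Invariance under Killing fields -/

/-- The tensor field `T` has vanishing Lie derivative along `ξ` on `U`. -/
def IsInvariantOn (ξ : VField M) (U : Set M) {k : ℕ} (T : (Fin k → VField M) → M → ℝ) : Prop :=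
  ∀ W, (∀ i, SmoothOn (W i) U) → ∀ x ∈ U,
    dirDeriv ξ (T W) x = ∑ i, T (Function.update W i (bracket ξ (W i))) x

/-- Differentiate the Koszul formula along `ξ`. Each of its terms is built from the metric,
directional derivatives and brackets, all of which obey a Leibniz rule for the Lie derivative along
a Killing field; the terms containing `[ξ, Z]` are removed by the formula itself. -/
theorem bracket_nabla (he : g.IsOrthonormalFrame e) (hU : IsOpen U) (hξ : SmoothOn ξ U)
    (hK : ∀ x ∈ U, g.KillingAt ξ x) (hX : SmoothOn X U) (hY : SmoothOn Y U) (hx : x ∈ U) :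
    bracket ξ (g.nabla X Y) x = g.nabla (bracket ξ X) Y x + g.nabla X (bracket ξ Y) x := by
  change _ = (g.nabla (bracket ξ X) Y + g.nabla X (bracket ξ Y)) x
  refine he.ext_two_inn fun c => ?_
  set Z := e c
  have hZ : SmoothOn Z U := he.smoothOn c
  have hd {A : VField M} (hA : SmoothOn A U) {y : M} (hy : y ∈ U) : DiffAt A y := hA.diffAt hU hy
  have hb {A B : VField M} (hA : SmoothOn A U) (hB : SmoothOn B U) : SmoothOn (bracket A B) U :=
    hA.bracket hB hU
  have hi {A B : VField M} (hA : SmoothOn A U) (hB : SmoothOn B U) : SmoothFnOn (g.inn A B) U :=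
    SmoothFnOn.inn hA hB
  have hk {A B : VField M} (hA : SmoothOn A U) (hB : SmoothOn B U) {y : M} (hy : y ∈ U) :
      dirDeriv ξ (g.inn A B) y = g.inn (bracket ξ A) B y + g.inn A (bracket ξ B) y :=
    hK y hy A B (hd hA hy) (hd hB hy)
  have hn := he.smoothOn_nabla hU hX hY
  have hii {A B : VField M} (hA : SmoothOn A U) (hB : SmoothOn B U) {y : M} (hy : y ∈ U) :=
    (hi hA hB).mdifferentiableAt hU hy
  have hdi {A B C : VField M} (hA : SmoothOn A U) (hB : SmoothOn B U) (hC : SmoothOn C U) :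
      dirDeriv ξ (dirDeriv A (g.inn B C)) x = dirDeriv (bracket ξ A) (g.inn B C) x
        + dirDeriv A (g.inn (bracket ξ B) C) x + dirDeriv A (g.inn B (bracket ξ C)) x := by
    have h1 := he.dirDeriv_bracket hU hx hξ hA (hi hB hC)
    have h2 : dirDeriv A (dirDeriv ξ (g.inn B C)) x
        = dirDeriv A (g.inn (bracket ξ B) C) x + dirDeriv A (g.inn B (bracket ξ C)) x := by
      rw [dirDeriv_congr hU hx fun y hy => hk hB hC hy, dirDeriv_fun_add
        (hii (hb hξ hB) hC hx) (hii hB (hb hξ hC) hx)]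
    linarith
  have hbi {A B C : VField M} (hA : SmoothOn A U) (hB : SmoothOn B U) (hC : SmoothOn C U) :
      dirDeriv ξ (g.inn (bracket A B) C) x = g.inn (bracket (bracket ξ A) B) C x
        + g.inn (bracket A (bracket ξ B)) C x + g.inn (bracket A B) (bracket ξ C) x := by
    have h1 : bracket ξ (bracket A B) x = (bracket (bracket ξ A) B + bracket A (bracket ξ B)) x :=
      bracket_bracket hξ hA hB hU hx
    rw [hk (hb hA hB) hC hx, inn_congr h1 rfl, inn_add_left]
  have hdm {A B C : VField M} (hA : SmoothOn A U) (hB : SmoothOn B U) (hC : SmoothOn C U) :=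
    (he.smoothFnOn_dirDeriv hU hA (hi hB hC)).mdifferentiableAt hU hx
  have hl : dirDeriv ξ (fun y => 2 * g.inn (g.nabla X Y) Z y) x = dirDeriv ξ (g.koszul X Y Z) x :=
    dirDeriv_congr hU hx fun y hy => g.nabla_spec (hd hX hy) (hd hY hy) (hd hZ hy)
  rw [dirDeriv_const_mul _ (hii hn hZ hx), hk hn hZ hx] at hl
  have hkz : g.koszul X Y Z = fun x =>
    dirDeriv X (g.inn Y Z) x + dirDeriv Y (g.inn Z X) x - dirDeriv Z (g.inn X Y) x
      + g.inn (bracket X Y) Z x - g.inn (bracket X Z) Y x - g.inn (bracket Y Z) X x := rfl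
  have m1 := hdm hX hY hZ
  have m2 := hdm hY hZ hX
  have m3 := hdm hZ hX hY
  have m4 := hii (hb hX hY) hZ hx
  have m5 := hii (hb hX hZ) hY hx
  have m6 := hii (hb hY hZ) hX hx
  have s1 := g.nabla_spec (hd hX hx) (hd hY hx) (hd (hb hξ hZ) hx)
  have s2 := g.nabla_spec (hd (hb hξ hX) hx) (hd hY hx) (hd hZ hx)
  have s3 := g.nabla_spec (hd hX hx) (hd (hb hξ hY) hx) (hd hZ hx)
  have m12 : MDifferentiableAt (𝓡 4) 𝓘(ℝ, ℝ)
    (fun x => dirDeriv X (g.inn Y Z) x + dirDeriv Y (g.inn Z X) x) x := m1.add m2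
  have m13 : MDifferentiableAt (𝓡 4) 𝓘(ℝ, ℝ) (fun x => dirDeriv X (g.inn Y Z) x
    + dirDeriv Y (g.inn Z X) x - dirDeriv Z (g.inn X Y) x) x := m12.sub m3
  have m14 : MDifferentiableAt (𝓡 4) 𝓘(ℝ, ℝ) (fun x => dirDeriv X (g.inn Y Z) x
    + dirDeriv Y (g.inn Z X) x - dirDeriv Z (g.inn X Y) x + g.inn (bracket X Y) Z x) x :=
    m13.add m4
  have m15 : MDifferentiableAt (𝓡 4) 𝓘(ℝ, ℝ) (fun x => dirDeriv X (g.inn Y Z) x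
    + dirDeriv Y (g.inn Z X) x - dirDeriv Z (g.inn X Y) x + g.inn (bracket X Y) Z x
    - g.inn (bracket X Z) Y x) x := m14.sub m5
  rw [hkz, dirDeriv_fun_sub m15 m6, dirDeriv_fun_sub m14 m5, dirDeriv_fun_add m13 m4,
    dirDeriv_fun_sub m12 m3, dirDeriv_fun_add m1 m2, hdi hX hY hZ, hdi hY hZ hX,
    hdi hZ hX hY, hbi hX hY hZ, hbi hX hZ hY, hbi hY hZ hX] at hl
  rw [inn_add_left, mul_add, s2, s3]
  simp only [koszul] at s1 ⊢
  linarith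

/-- The Lie derivative along a Killing field commutes with `∇` on vector fields by `bracket_nabla`,
hence also on tensor fields. -/
theorem IsInvariantOn.nablaT (he : g.IsOrthonormalFrame e) (hU : IsOpen U) (hξ : SmoothOn ξ U)
    (hK : ∀ x ∈ U, g.KillingAt ξ x) {k : ℕ} {T : (Fin k → VField M) → M → ℝ}
    (hT : g.IsTensorOn e U T) (hI : IsInvariantOn ξ U T) : IsInvariantOn ξ U (g.nablaT T) := by
  intro W hW x hx
  set V := Fin.tail W with hVdef
  have hV (i) : SmoothOn (V i) U := hW i.succ
  have hb {A B : VField M} (hA : SmoothOn A U) (hB : SmoothOn B U) : SmoothOn (bracket A B) U :=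
    hA.bracket hB hU
  have hn {A B : VField M} (hA : SmoothOn A U) (hB : SmoothOn B U) : SmoothOn (g.nabla A B) U :=
    he.smoothOn_nabla hU hA hB
  have hVn (j) := smoothOn_update hV j (hn (hW 0) (hV j))
  have hVb (i) := smoothOn_update hV i (hb hξ (hV i))
  have h1 : dirDeriv ξ (dirDeriv (W 0) (T V)) x = dirDeriv (bracket ξ (W 0)) (T V) x
      + ∑ i, dirDeriv (W 0) (T (Function.update V i (bracket ξ (V i)))) x := by
    have h2 := he.dirDeriv_bracket hU hx hξ (hW 0) (hT.smooth V hV)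
    have h3 : dirDeriv (W 0) (dirDeriv ξ (T V)) x
        = ∑ i, dirDeriv (W 0) (T (Function.update V i (bracket ξ (V i)))) x := by
      rw [dirDeriv_congr hU hx fun y hy => hI V hV y hy, dirDeriv_fun_sum fun i _ =>
        (hT.smooth _ (hVb i)).mdifferentiableAt hU hx]
    linarith
  have h4 : dirDeriv ξ (g.nablaT T W) x = dirDeriv (bracket ξ (W 0)) (T V) x
      + ∑ i, dirDeriv (W 0) (T (Function.update V i (bracket ξ (V i)))) x
      - ∑ j, ∑ i, T (Function.update (Function.update V j (g.nabla (W 0) (V j))) i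
          (bracket ξ (Function.update V j (g.nabla (W 0) (V j)) i))) x := by
    have h5 : g.nablaT T W = fun x => dirDeriv (W 0) (T V) x
      - ∑ j, T (Function.update V j (g.nabla (W 0) (V j))) x := rfl
    have hm (j) := (hT.smooth _ (hVn j)).mdifferentiableAt hU hx
    rw [h5, dirDeriv_fun_sub ((he.smoothFnOn_dirDeriv hU (hW 0)
      (hT.smooth V hV)).mdifferentiableAt hU hx) (mdifferentiableAt_fun_sum fun j _ => hm j), h1,
      dirDeriv_fun_sum fun j _ => hm j]
    congr 1
    exact Finset.sum_congr rfl fun j _ => hI _ (hVn j) x hx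
  have h0 (A : VField M) (i : Fin k) : Function.update W i.succ A 0 = W 0 :=
    Function.update_of_ne (Fin.succ_ne_zero i).symm _ _
  have hWi (A : VField M) (i j : Fin k) : Function.update W i.succ A j.succ
      = Function.update V i A j := by
    rw [hVdef, ← Fin.tail_update_succ]; rfl
  have hW0 (A : VField M) (j : Fin k) : Function.update W 0 A j.succ = V j :=
    Function.update_of_ne (Fin.succ_ne_zero j) _ _
  have hVj (j : Fin k) : W j.succ = V j := rfl
  rw [h4, Fin.sum_univ_succ]
  simp only [LorentzMetric.nablaT, Fin.tail_update_zero, Fin.tail_update_succ, ← hVdef, h0, hWi,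
    hW0, hVj, Function.update_self, Finset.sum_sub_distrib]
  -- For `i ≠ j` the two operations act on different slots and commute. For `i = j`, `bracket_nabla`
  -- adds a term, which accounts for the bracket of `ξ` with the direction of differentiation.
  have hij (i j : Fin k) : T (Function.update (Function.update V j (g.nabla (W 0) (V j))) i
          (bracket ξ (Function.update V j (g.nabla (W 0) (V j)) i))) x
      = (if i = j then T (Function.update V j (g.nabla (bracket ξ (W 0)) (V j))) x else 0)
        + T (Function.update (Function.update V i (bracket ξ (V i))) j
          (g.nabla (W 0) (Function.update V i (bracket ξ (V i)) j))) x := by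
    by_cases h : i = j
    · subst h
      simp only [Function.update_self, Function.update_idem, if_true]
      exact hT.update_add hV i (hb hξ (hn (hW 0) (hV i))) (hn (hb hξ (hW 0)) (hV i))
        (hn (hW 0) (hb hξ (hV i))) hx (bracket_nabla he hU hξ hK (hW 0) (hV i) hx)
    · have h' : j ≠ i := Ne.symm h
      simp only [h, if_false, zero_add, Function.update_of_ne, ne_eq, not_false_eq_true, h']
      rw [Function.update_comm h]
  simp only [hij, Finset.sum_add_distrib, Finset.sum_ite_eq', Finset.mem_univ, if_true]
  rw [Finset.sum_comm (f := fun (j i : Fin k) => T (Function.update (Function.update V i _) j _) x)]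
  ring

theorem isInvariantOn_nablaRiem (he : g.IsOrthonormalFrame e) (hU : IsOpen U)
    (hξ : SmoothOn ξ U) (hK : ∀ x ∈ U, g.KillingAt ξ x) :
    ∀ k, IsInvariantOn ξ U (g.nablaRiem k)
  | k + 1 => IsInvariantOn.nablaT he hU hξ hK (isTensorOn_nablaRiem he hU k)
      (isInvariantOn_nablaRiem he hU hξ hK k)
  | 0 => by
    intro W hW x hx
    have hb {A B : VField M} (hA : SmoothOn A U) (hB : SmoothOn B U) : SmoothOn (bracket A B) U :=
      hA.bracket hB hU
    have hn {A B : VField M} (hA : SmoothOn A U) (hB : SmoothOn B U) :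
        SmoothOn (g.nabla A B) U := he.smoothOn_nabla hU hA hB
    have hd {A : VField M} (hA : SmoothOn A U) {y : M} (hy : y ∈ U) : DiffAt A y :=
      hA.diffAt hU hy
    have key {X Y Z : VField M} (hX : SmoothOn X U) (hY : SmoothOn Y U) (hZ : SmoothOn Z U) :
        bracket ξ (g.nabla X (g.nabla Y Z)) x = g.nabla (bracket ξ X) (g.nabla Y Z) x
          + g.nabla X (g.nabla (bracket ξ Y) Z) x + g.nabla X (g.nabla Y (bracket ξ Z)) x := by
      rw [bracket_nabla he hU hξ hK hX (hn hY hZ) hx,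
        he.nabla_congr (Y' := g.nabla (bracket ξ Y) Z + g.nabla Y (bracket ξ Z)) hU hx hX
          (hb hξ (hn hY hZ)) (fun _ _ => rfl) (fun y hy => bracket_nabla he hU hξ hK hY hZ hy),
        he.nabla_add_right (hd hX hx) (hd (hn (hb hξ hY) hZ) hx) (hd (hn hY (hb hξ hZ)) hx),
        add_assoc]
    have key2 {X Y Z : VField M} (hX : SmoothOn X U) (hY : SmoothOn Y U) (hZ : SmoothOn Z U) :
        bracket ξ (g.nabla (bracket X Y) Z) x = g.nabla (bracket (bracket ξ X) Y) Z x
          + g.nabla (bracket X (bracket ξ Y)) Z x + g.nabla (bracket X Y) (bracket ξ Z) x := by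
      rw [bracket_nabla he hU hξ hK (hb hX hY) hZ hx,
        he.nabla_congr (X' := bracket (bracket ξ X) Y + bracket X (bracket ξ Y)) (Y' := Z) hU hx
          (hb hξ (hb hX hY)) hZ (fun y hy => bracket_bracket hξ hX hY hU hy) (fun _ _ => rfl),
        he.nabla_add_left (hd (hb (hb hξ hX) hY) hx) (hd (hb hX (hb hξ hY)) hx) (hd hZ hx)]
    have hsub {A B : VField M} (hA : DiffAt A x) (hB : DiffAt B x) :
        bracket ξ (A - B) x = bracket ξ A x - bracket ξ B x := by
      have h1 : A - B = A + (fun _ : M => (-1 : ℝ)) • B := by funext y; simp [sub_eq_add_neg]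
      rw [h1, bracket_add_right hA (MDifferentiableAt.smul_section mdifferentiableAt_const hB),
        bracket_smul_right mdifferentiableAt_const hB, dirDeriv_const]
      simp [sub_eq_add_neg]
    have hc {X Y Z : VField M} (hX : SmoothOn X U) (hY : SmoothOn Y U) (hZ : SmoothOn Z U) :
        bracket ξ (g.curv X Y Z) x
          = (g.curv (bracket ξ X) Y Z + g.curv X (bracket ξ Y) Z + g.curv X Y (bracket ξ Z)) x := by
      rw [curv, hsub (hd ((hn hX (hn hY hZ)).sub (hn hY (hn hX hZ))) hx)
        (hd (hn (hb hX hY) hZ) hx), hsub (hd (hn hX (hn hY hZ)) hx) (hd (hn hY (hn hX hZ)) hx),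
        key hX hY hZ, key hY hX hZ, key2 hX hY hZ]
      simp only [curv, Pi.add_apply, Pi.sub_apply]
      abel
    have hC := smoothOn_curv he hU (hW 0) (hW 1) (hW 2)
    change dirDeriv ξ (g.inn (g.curv (W 0) (W 1) (W 2)) (W 3)) x = _
    rw [hK x hx _ _ (hd hC hx) (hd (hW 3) hx), inn_congr (hc (hW 0) (hW 1) (hW 2)) rfl,
      inn_add_left, inn_add_left, Fin.sum_univ_four]
    rfl

end LorentzMetric

end Tensors

/-! ### Transport along an integral curve; Killing fields commute with a Riemann-frame -/

section Transport

/-- Exchanging the entry `b i` with `c` is an involution of the index pairs. -/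
theorem sum_sum_update {ι κ : Type*} [Fintype ι] [DecidableEq ι] [Fintype κ] (i : ι)
    (P : (ι → κ) → κ → ℝ) :
    ∑ b, ∑ c, P b c = ∑ b, ∑ c, P (Function.update b i c) (b i) := by
  classical
  rw [← Fintype.sum_prod_type', ← Fintype.sum_prod_type']
  have hs : Function.Involutive fun q : (ι → κ) × κ => (Function.update q.1 i q.2, q.1 i) := by
    rintro ⟨b, c⟩
    simp
  exact (Equiv.sum_comp hs.toPerm fun q => P q.1 q.2).symm

/-- The vectors evolve by `-B` and the covariant components by the dual action of `B`; after the
contracted index is renamed by `sum_sum_update`, the contributions cancel slot by slot. -/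
theorem hasDerivAt_contraction {k : ℕ} {L : ℝ → Fin 4 → Fin 4 → ℝ} {B : Fin 4 → Fin 4 → ℝ}
    {G : (Fin k → Fin 4) → ℝ → ℝ} {t : ℝ}
    (hL : ∀ b a, HasDerivAt (fun s => L s b a) (-∑ c, B b c * L t c a) t)
    (hG : ∀ b, HasDerivAt (G b) (∑ i, ∑ c, B c (b i) * G (Function.update b i c) t) t)
    (a : Fin k → Fin 4) :
    HasDerivAt (fun s => ∑ b : Fin k → Fin 4, (∏ i, L s (b i) (a i)) * G b s) 0 t := by
  have h1 (b : Fin k → Fin 4) : HasDerivAt (fun s => (∏ i, L s (b i) (a i)) * G b s)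
      ((∑ i, (∏ j ∈ Finset.univ.erase i, L t (b j) (a j)) * -∑ c, B (b i) c * L t c (a i)) * G b t
        + (∏ i, L t (b i) (a i)) * ∑ i, ∑ c, B c (b i) * G (Function.update b i c) t) t := by
    refine HasDerivAt.mul ?_ (hG b)
    simpa only [smul_eq_mul] using HasDerivAt.fun_finsetProd fun i _ => hL (b i) (a i)
  refine (HasDerivAt.fun_sum fun b _ => h1 b).congr_deriv ?_
  have h2 (i : Fin k) :
      ∑ b : Fin k → Fin 4, ∑ c, (∏ j, L t (b j) (a j)) * (B c (b i) * G (Function.update b i c) t)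
      = ∑ b : Fin k → Fin 4, ∑ c, ((∏ j ∈ Finset.univ.erase i, L t (b j) (a j))
          * (B (b i) c * L t c (a i))) * G b t := by
    rw [sum_sum_update i]
    refine Finset.sum_congr rfl fun b _ => Finset.sum_congr rfl fun c _ => ?_
    have h3 : ∏ j, L t (Function.update b i c j) (a j)
        = L t c (a i) * ∏ j ∈ Finset.univ.erase i, L t (b j) (a j) := by
      rw [← Finset.mul_prod_erase _ _ (Finset.mem_univ i), Function.update_self]
      congr 1
      refine Finset.prod_congr rfl fun j hj => ?_
      rw [Function.update_of_ne (Finset.ne_of_mem_erase hj)]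
    rw [h3, Function.update_self, Function.update_idem, Function.update_eq_self]
    ring
  simp only [Finset.sum_add_distrib, Finset.sum_mul, Finset.mul_sum, mul_neg, neg_mul,
    Finset.sum_neg_distrib]
  rw [Finset.sum_comm (f := fun (b : Fin k → Fin 4) (i : Fin k) => ∑ c, (∏ j, _) * _),
    Finset.sum_congr rfl fun i _ => h2 i, Finset.sum_comm]
  exact neg_add_cancel _

namespace LorentzMetric

variable {g : LorentzMetric M} {U : Set M} {X Y ξ : VField M} {x : M} {e : Fin 4 → VField M}

/-- The integral curve of `ξ` through `p`, together with a solution along it of the linear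
equation `Λ' = -BΛ`. -/
theorem IsOrthonormalFrame.exists_integralCurve (he : g.IsOrthonormalFrame e) (hU : IsOpen U)
    (hξ : SmoothOn ξ U) {B : Fin 4 → Fin 4 → M → ℝ} (hB : ∀ b c, SmoothFnOn (B b c) U) {p : M}
    (hp : p ∈ U) : ∃ ε > 0, ∃ (c : ℝ → M) (L : ℝ → Fin 4 → Fin 4 → ℝ), c 0 = p ∧
      (L 0 = fun b a => if b = a then 1 else 0) ∧ ContinuousAt c 0 ∧ ContinuousAt L 0 ∧
      ∀ t ∈ Set.Ioo (-ε) ε, c t ∈ U ∧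
        (∀ f, SmoothFnOn f U → HasDerivAt (fun s => f (c s)) (dirDeriv ξ f (c t)) t) ∧
        ∀ b a, HasDerivAt (fun s => L s b a) (-∑ d, B b d (c t) * L t d a) t := by
  set φ := extChartAt (𝓡 4) p
  -- The curve and the matrix are solved for together as one autonomous equation, so that a single
  -- local existence theorem applies.
  let F : EuclideanSpace ℝ (Fin 4) × (Fin 4 → Fin 4 → ℝ) →
      EuclideanSpace ℝ (Fin 4) × (Fin 4 → Fin 4 → ℝ) :=
    fun w => (chartField p ξ w.1, fun b a => -∑ d, (B b d ∘ φ.symm) w.1 * w.2 d a)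
  have hpz : φ p ∈ chartImage p U := mem_chartImage hp (mem_extChartAt_source p)
  have hnz := (isOpen_chartImage (p := p) hU).mem_nhds hpz
  let w0 : EuclideanSpace ℝ (Fin 4) × (Fin 4 → Fin 4 → ℝ) :=
    (φ p, fun b a => if b = a then 1 else 0)
  have hF : ContDiffAt ℝ 1 F w0 := by
    have h1 : ContDiffAt ℝ ∞ F w0 := by
      refine ContDiffAt.prodMk ?_ ?_
      · exact (((he.contDiffOn_chartField hU hξ).contDiffAt hnz) : ContDiffAt ℝ ∞ _ w0.1).comp w0
          contDiffAt_fst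
      · refine contDiffAt_pi.2 fun b => contDiffAt_pi.2 fun a => ContDiffAt.neg ?_
        refine ContDiffAt.sum fun d _ => ContDiffAt.mul ?_ ?_
        · exact ((((hB b d).comp_chart_symm (p := p)).contDiffAt hnz) :
            ContDiffAt ℝ ∞ _ w0.1).comp w0 contDiffAt_fst
        · exact contDiffAt_pi.1 (contDiffAt_pi.1 contDiffAt_snd d) a
    exact h1.of_le (by exact_mod_cast le_top)
  obtain ⟨α, hα0, ε, hε, hα⟩ :=
    hF.exists_forall_mem_closedBall_exists_eq_forall_mem_Ioo_hasDerivAt₀ 0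
  have hαc : ContinuousAt α 0 := (hα 0 (by simpa using hε)).continuousAt
  have hev : ∀ᶠ t in 𝓝 (0 : ℝ), (α t).1 ∈ chartImage p U := by
    refine hαc.fst.eventually_mem ?_
    simpa [hα0, w0] using hnz
  obtain ⟨δ, hδ, hδ'⟩ := Metric.eventually_nhds_iff.1 hev
  -- Here `ε` bounds the time of existence and `δ` keeps the curve in the chart image of `U`.
  refine ⟨min ε δ, lt_min hε hδ, fun t => φ.symm (α t).1, fun t => (α t).2, ?_, ?_, ?_, ?_, ?_⟩
  · simp only [hα0, w0]
    exact extChartAt_to_inv p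
  · simp only [hα0, w0]
  · have h1 : ContinuousAt φ.symm (α 0).1 := by
      rw [hα0]
      exact continuousAt_extChartAt_symm p
    exact ContinuousAt.comp (f := fun t => (α t).1) h1 hαc.fst
  · exact hαc.snd
  · intro t ht
    have ht1 : t ∈ Set.Ioo (0 - ε) (0 + ε) := by
      constructor <;> linarith [ht.1, ht.2, min_le_left ε δ]
    have ht2 : (α t).1 ∈ chartImage p U := hδ' (by
      rw [Real.dist_eq, sub_zero, abs_lt]
      constructor <;> linarith [ht.1, ht.2, min_le_right ε δ])
    have hd := hα t ht1
    refine ⟨ht2.2, fun f hf => ?_, fun b a => ?_⟩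
    · have h1 := hf.mdifferentiableAt hU ht2.2
      rw [← fderiv_comp_chart_symm ht2.1 h1]
      exact (differentiableAt_comp_chart_symm ht2.1 h1).hasFDerivAt.comp_hasDerivAt t hd.fst
    · exact hasDerivAt_pi.1 (hasDerivAt_pi.1 hd.snd b) a

theorem IsTensorOn.eq_sum {k : ℕ} {T : (Fin k → VField M) → M → ℝ} (he : g.IsOrthonormalFrame e)
    (hT : g.IsTensorOn e U T) {W : Fin k → VField M} (hW : ∀ i, SmoothOn (W i) U) (hx : x ∈ U) :
    T W x = ∑ b : Fin k → Fin 4, (∏ i, g.coframe e (b i) (W i) x) * T (fun i => e (b i)) x := by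
  induction k with
  | zero =>
    rw [Fintype.sum_unique]
    simp only [Finset.univ_eq_empty, Finset.prod_empty, one_mul]
    congr 1
    exact Subsingleton.elim _ _
  | succ k ih =>
    have hV (i : Fin k) : SmoothOn (Fin.tail W i) U := hW i.succ
    have hc (c : Fin 4) : g.IsTensorOn e U fun V : Fin k → VField M =>
        T (Fin.cons (e c) V : Fin (k + 1) → VField M) := by
      have hs (V : Fin k → VField M) (hV : ∀ i, SmoothOn (V i) U) (i : Fin (k + 1)) :
          SmoothOn ((Fin.cons (e c) V : Fin (k + 1) → VField M) i) U :=
        Fin.cases (he.smoothOn c) hV i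
      refine ⟨fun V hV => hT.smooth _ (hs V hV), fun V hV i y hy => ?_⟩
      rw [hT.expand _ (hs V hV) i.succ y hy]
      simp only [Fin.cons_succ, Fin.cons_update]
    rw [hT.expand W hW 0 x hx, ← (Fin.consEquiv fun _ : Fin (k + 1) => Fin 4).sum_comp,
      Fintype.sum_prod_type]
    refine Finset.sum_congr rfl fun c _ => ?_
    have h1 : Function.update W 0 (e c) = Fin.cons (e c) (Fin.tail W) := by
      rw [← Fin.update_cons_zero (W 0), Fin.cons_self_tail]
    rw [h1, ih (hc c) hV, Finset.mul_sum]
    refine Finset.sum_congr rfl fun b _ => ?_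
    have h2 : (fun i => e ((Fin.consEquiv fun _ : Fin (k + 1) => Fin 4) (c, b) i))
        = (Fin.cons (e c) fun i => e (b i) : Fin (k + 1) → VField M) := by
      funext i
      refine Fin.cases ?_ (fun j => ?_) i <;> simp [Fin.consEquiv]
    rw [h2, Fin.prod_univ_succ]
    simp [Fin.consEquiv, Fin.tail, mul_assoc]

/-- The metric is treated as one more invariant tensor field, so that `IsInvariantOn.rotate_eq` also
shows the transported frame to be orthonormal. -/
theorem isTensorOn_inn (he : g.IsOrthonormalFrame e) :
    g.IsTensorOn e U fun W : Fin 2 → VField M => g.inn (W 0) (W 1) where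
  smooth W hW := SmoothFnOn.inn (hW 0) (hW 1)
  expand W hW i x hx := by
    have h0 : g.inn (W 0) (W 1) x = ∑ c, g.coframe e c (W 0) x * g.inn (e c) (W 1) x := by
      rw [he.inn_eq_sum]
      refine Finset.sum_congr rfl fun c _ => ?_
      rw [coframe_def (X := W 1)]
      linear_combination (g.coframe e c (W 0) x * g.inn (e c) (W 1) x) * sgn_mul_self c
    have h1 : g.inn (W 0) (W 1) x = ∑ c, g.coframe e c (W 1) x * g.inn (W 0) (e c) x := by
      rw [he.inn_eq_sum]
      refine Finset.sum_congr rfl fun c _ => ?_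
      rw [coframe_def, inn_comm (X := W 0) (Y := e c), coframe_def]
      linear_combination (g.inn (e c) (W 0) x * (sgn c * g.inn (e c) (W 1) x)) * sgn_mul_self c
    fin_cases i
    exacts [h0, h1]

theorem isInvariantOn_inn (hU : IsOpen U) (hK : ∀ x ∈ U, g.KillingAt ξ x) :
    IsInvariantOn ξ U fun W : Fin 2 → VField M => g.inn (W 0) (W 1) := by
  intro W hW x hx
  rw [hK x hx _ _ ((hW 0).diffAt hU hx) ((hW 1).diffAt hU hx), Fin.sum_univ_two]
  rfl

theorem rotate_eq_sum (L : Matrix (Fin 4) (Fin 4) ℝ) (a : Fin 4) :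
    rotate L e a = ∑ b, L b a • e b := by
  funext x
  simp [rotate]

theorem IsOrthonormalFrame.coframe_rotate (he : g.IsOrthonormalFrame e)
    (L : Matrix (Fin 4) (Fin 4) ℝ) (a b : Fin 4) : g.coframe e b (rotate L e a) x = L b a := by
  have h : g.coframe e b (rotate L e a) x = ∑ c, L c a * g.coframe e b (e c) x := by
    simp only [coframe, inn, rotate, map_sum, map_smul, smul_eq_mul, Finset.mul_sum]
    exact Finset.sum_congr rfl fun c _ => mul_left_comm _ _ _
  simp [h, he.coframe_frame]

/-- An isometry of the tangent spaces along the flow of a Killing field preserves every tensor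
field invariant under this flow. -/
theorem IsInvariantOn.rotate_eq (he : g.IsOrthonormalFrame e) (hU : IsOpen U) {k : ℕ}
    {T : (Fin k → VField M) → M → ℝ} (hT : g.IsTensorOn e U T) (hI : IsInvariantOn ξ U T)
    (hξ : SmoothOn ξ U) {ε : ℝ} (hε : 0 < ε) {c : ℝ → M} {L : ℝ → Fin 4 → Fin 4 → ℝ}
    (hL0 : L 0 = fun b a => if b = a then 1 else 0)
    (hc : ∀ t ∈ Set.Ioo (-ε) ε, c t ∈ U ∧
      (∀ f, SmoothFnOn f U → HasDerivAt (fun s => f (c s)) (dirDeriv ξ f (c t)) t) ∧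
      ∀ b a, HasDerivAt (fun s => L s b a)
        (-∑ d, g.coframe e b (bracket ξ (e d)) (c t) * L t d a) t)
    {t : ℝ} (ht : t ∈ Set.Ioo (-ε) ε) (a : Fin k → Fin 4) :
    T (fun i => rotate (Matrix.of (L t)) e (a i)) (c t) = T (fun i => e (a i)) (c 0) := by
  have hes (b : Fin k → Fin 4) (i : Fin k) : SmoothOn (e (b i)) U := he.smoothOn (b i)
  -- The value of `T` on the transported vectors, expanded in the frame; it will turn out to be
  -- constant along the curve.
  set F : ℝ → ℝ := fun s => ∑ b : Fin k → Fin 4,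
    (∏ i, L s (b i) (a i)) * T (fun i => e (b i)) (c s) with hF
  have hd : ∀ s ∈ Set.Ioo (-ε) ε, HasDerivAt F 0 s := by
    intro s hs
    refine hasDerivAt_contraction (G := fun b s => T (fun i => e (b i)) (c s)) (hc s hs).2.2
      (fun b => ?_) a
    refine ((hc s hs).2.1 _ (hT.smooth _ (hes b))).congr_deriv ?_
    rw [hI _ (hes b) _ (hc s hs).1]
    refine Finset.sum_congr rfl fun i _ => ?_
    rw [hT.update (hes b) i (hξ.bracket (hes b i) hU) (hc s hs).1]
    refine Finset.sum_congr rfl fun d _ => ?_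
    congr 2
    funext j
    by_cases h : j = i
    · subst h; simp
    · simp [h]
  have hr : ∀ s ∈ Set.Ioo (-ε) ε, T (fun i => rotate (Matrix.of (L s)) e (a i)) (c s) = F s := by
    intro s hs
    have h1 (i : Fin k) : SmoothOn (rotate (Matrix.of (L s)) e (a i)) U := by
      rw [rotate_eq_sum]
      exact SmoothOn.sum fun b _ => SmoothOn.const_smul _ (he.smoothOn b)
    rw [hT.eq_sum he h1 (hc s hs).1]
    simp only [he.coframe_rotate, Matrix.of_apply, hF]
  have h0 : (0 : ℝ) ∈ Set.Ioo (-ε) ε := by simpa using hε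
  have he0 : T (fun i => e (a i)) (c 0) = F 0 := by
    rw [hT.eq_sum he (hes a) (hc 0 h0).1]
    simp only [he.coframe_frame, hF, hL0]
  rw [hr t ht, he0]
  exact isOpen_Ioo.is_const_of_deriv_eq_zero isPreconnected_Ioo
    (fun s hs => (hd s hs).differentiableAt.differentiableWithinAt)
    (fun s hs => (hd s hs).deriv) ht h0

/-- The local Killing fields commute with a Riemann-frame. -/
theorem IsRiemannFrame.bracket_eq_zero (he : g.IsRiemannFrame e) (hU : IsOpen U)
    (hξ : SmoothOn ξ U) (hK : ∀ x ∈ U, g.KillingAt ξ x) {p : M} (hp : p ∈ U) (a : Fin 4) :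
    bracket ξ (e a) p = 0 := by
  have ho := he.toIsOrthonormalFrame
  have hB (b d : Fin 4) : SmoothFnOn (g.coframe e b (bracket ξ (e d))) U :=
    ho.smoothFnOn_coframe b (hξ.bracket (ho.smoothOn d) hU)
  obtain ⟨ε, hε, c, L, hc0, hL0, hcc, hLc, h⟩ := ho.exists_integralCurve hU hξ hB hp
  have h0 : (0 : ℝ) ∈ Set.Ioo (-ε) ε := by simpa using hε
  obtain ⟨m, V, hV, N, hN, hdet⟩ := he.determined p
  have hL01 : Matrix.of (L 0) = 1 := by
    ext b a
    rw [hL0, Matrix.of_apply, Matrix.one_apply]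
  have hev : ∀ᶠ t in 𝓝 (0 : ℝ), Matrix.of (L t) = 1 := by
    have e1 : ∀ᶠ t in 𝓝 (0 : ℝ), c t ∈ V := hcc.eventually_mem (by rwa [hc0])
    have e2 : ∀ᶠ t in 𝓝 (0 : ℝ), Matrix.of (L t) ∈ N :=
      ContinuousAt.eventually_mem (f := fun t => Matrix.of (L t)) hLc (by rwa [hL01])
    filter_upwards [e1, e2, isOpen_Ioo.mem_nhds h0] with t h1 h2 h3
    -- The frame condition is used with `q = p` and `q' = c t`. The Lorentz property comes from
    -- invariance of the metric, the matching of `∇^k R` from invariance of these tensors.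
    refine hdet p (mem_of_mem_nhds hV) (c t) h1 (Matrix.of (L t)) h2 ?_ fun k _ a => ?_
    · ext a b
      have h4 := IsInvariantOn.rotate_eq ho hU (isTensorOn_inn ho) (isInvariantOn_inn hU hK) hξ hε
        hL0 h h3 ![a, b]
      simp only [Matrix.cons_val_zero, Matrix.cons_val_one] at h4
      rw [ho.orthonormal, ho.inn_eq_sum] at h4
      simp only [ho.coframe_rotate] at h4
      rw [← h4, Matrix.mul_assoc, Matrix.mul_apply]
      refine Finset.sum_congr rfl fun d _ => ?_
      rw [Matrix.transpose_apply, etaMat, Matrix.diagonal_mul]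
      ring
    · rw [← hc0]
      exact IsInvariantOn.rotate_eq ho hU (isTensorOn_nablaRiem ho hU k)
        (isInvariantOn_nablaRiem ho hU hξ hK k) hξ hε hL0 h h3 a
  change _ = (0 : VField M) p
  refine ho.ext_coframe fun b => ?_
  -- At `t = 0` the equation `L' = -BL` with `L = 1` says that the derivative is `-θ^b([ξ, e_a])` at
  -- `p`; as `L` is constantly `1` near `0`, it is zero.
  have h1 := (h 0 h0).2.2 b a
  have h2 : HasDerivAt (fun s => L s b a) 0 0 := by
    refine (hasDerivAt_const (0 : ℝ) ((1 : Matrix (Fin 4) (Fin 4) ℝ) b a)).congr_of_eventuallyEq ?_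
    filter_upwards [hev] with t ht
    rw [← ht, Matrix.of_apply]
  have h3 := h1.unique h2
  simp only [hL0, hc0, mul_ite, mul_one, mul_zero, Finset.sum_ite_eq', Finset.mem_univ,
    if_true, neg_eq_zero] at h3
  rw [h3]
  simp [coframe, inn]

end LorentzMetric

end Transport

/-! ### Consequences of commutation: constant coefficients and the dimension of the Killing algebra
-/

section Killing

namespace LorentzMetric

variable {g : LorentzMetric M} {U : Set M} {X Y ξ : VField M} {x : M} {e : Fin 4 → VField M}

/-- Since `ξ` commutes with the frame, `bracket_nabla` shows that it commutes with `∇_{e_b} e_a`;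
the Killing equation then gives zero for the derivative of the inner product with `e_c`. -/
theorem IsRiemannFrame.dirDeriv_connCoeff_eq_zero (he : g.IsRiemannFrame e) (hU : IsOpen U)
    (hξ : SmoothOn ξ U) (hK : ∀ x ∈ U, g.KillingAt ξ x) (hx : x ∈ U) (c a b : Fin 4) :
    dirDeriv ξ (g.connCoeff e c a b) x = 0 := by
  have ho := he.toIsOrthonormalFrame
  have hes (a : Fin 4) : SmoothOn (e a) U := ho.smoothOn a
  -- The zero field is written as `0 • e_0` so that the vanishing of `nabla` on it follows from the
  -- rules for multiplication by a function.
  have h0 (d : Fin 4) : ∀ y ∈ U, bracket ξ (e d) y = ((fun _ : M => (0 : ℝ)) • e 0) y := by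
    intro y hy
    rw [he.bracket_eq_zero hU hξ hK hy d]
    simp
  have hn := ho.smoothOn_nabla hU (hes b) (hes a)
  have h1 : bracket ξ (g.nabla (e b) (e a)) x = 0 := by
    rw [bracket_nabla ho hU hξ hK (hes b) (hes a) hx,
      ho.nabla_congr hU hx (hξ.bracket (hes b) hU) (hes a) (h0 b) fun _ _ => rfl,
      ho.nabla_congr hU hx (hes b) (hξ.bracket (hes a) hU) (fun _ _ => rfl) (h0 a),
      ho.nabla_smul_left mdifferentiableAt_const (ho.diffAt 0) (ho.diffAt a),
      ho.nabla_smul_right mdifferentiableAt_const (ho.diffAt b) (ho.diffAt 0), dirDeriv_const]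
    simp
  have h2 := hK x hx _ _ (ho.diffAt c) (hn.diffAt hU hx)
  have h3 : g.connCoeff e c a b = fun y => sgn c * g.inn (e c) (g.nabla (e b) (e a)) y := rfl
  rw [h3, dirDeriv_const_mul _ (g.mdifferentiableAt_inn (ho.diffAt c) (hn.diffAt hU hx)), h2]
  simp [inn, h1, he.bracket_eq_zero hU hξ hK hx c]

/-- At each point some Killing field takes the value `e_d`, so every frame derivative of a
coefficient is zero. -/
theorem IsRiemannFrame.connCoeff_const (he : g.IsRiemannFrame e) [ConnectedSpace M]
    (h : g.LocallyHomogeneous) (c a b : Fin 4) : ∃ k : ℝ, ∀ x, g.connCoeff e c a b x = k := by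
  revert c a b
  rw [he.toIsOrthonormalFrame.connCoeff_const_iff]
  intro c a b d x
  obtain ⟨U, hxU, hU⟩ := h x
  obtain ⟨ξ, hξ, hξx⟩ := hU (e d x)
  have h1 := he.dirDeriv_connCoeff_eq_zero U.isOpen hξ.1 hξ.2.1 hxU c a b
  rwa [dirDeriv, hξx] at h1

/-- The components of a field which commutes with the frame satisfy a linear system. -/
theorem IsOrthonormalFrame.dirDeriv_coframe_of_bracket_eq_zero (he : g.IsOrthonormalFrame e)
    (hξ : DiffAt ξ x) (a c : Fin 4) (h : bracket ξ (e a) x = 0) :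
    dirDeriv (e a) (g.coframe e c ξ) x
      = ∑ b, -g.coframe e c (bracket (e a) (e b)) x * g.coframe e b ξ x := by
  have hm (b : Fin 4) := he.mdifferentiableAt_coframe b hξ
  have h1 : (∑ b, (dirDeriv (e a) (g.coframe e b ξ) • e b
      + g.coframe e b ξ • bracket (e a) (e b))) x = (0 : VField M) x := by
    have h2 : bracket (e a) ξ x = 0 := by rw [bracket_swap, h, neg_zero]
    rw [he.eq_sum ξ, bracket_sum_right fun b _ =>
      MDifferentiableAt.smul_section (hm b) (he.diffAt b)] at h2
    rw [Finset.sum_apply, Pi.zero_apply, ← h2]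
    exact Finset.sum_congr rfl fun b _ => (bracket_smul_right (hm b) (he.diffAt b)).symm
  have h3 := coframe_congr (g := g) (e := e) c h1
  rw [Fin.sum_univ_four] at h3 ⊢
  simp only [coframe_add, coframe_smul, he.coframe_frame] at h3
  have h4 : g.coframe e c (0 : VField M) x = 0 := by simp [coframe, inn]
  have h5 : dirDeriv (e a) (g.coframe e c ξ) x
      = ∑ b, dirDeriv (e a) (g.coframe e b ξ) x * if c = b then 1 else 0 := by simp
  rw [Fin.sum_univ_four] at h5
  rw [h5]
  linarith

/-- On a connected open set a Killing field which vanishes at a point vanishes everywhere. -/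
theorem IsRiemannFrame.eq_zero_of_apply_eq_zero (he : g.IsRiemannFrame e)
    {V : TopologicalSpace.Opens M} (hV : IsPreconnected (V : Set M)) (hξ : ξ ∈ g.killingFields V)
    {p : M} (hp : p ∈ V) (h0 : ξ p = 0) : ξ = 0 := by
  have ho := he.toIsOrthonormalFrame
  obtain ⟨hs, hK, hz⟩ := hξ
  have hco {y : M} (hy : ξ y = 0) (c : Fin 4) : g.coframe e c ξ y = 0 := by simp [coframe, inn, hy]
  have hsm (c : Fin 4) := ho.smoothFnOn_coframe c hs
  have hnear : ∀ y ∈ V, (∀ c, g.coframe e c ξ y = 0) → ∀ᶠ z in 𝓝 y, ξ z = 0 := by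
    intro y hy h
    have h1 := ho.eventually_eq_zero_of_system V.isOpen hy
      (N := fun a c b y => -g.coframe e c (bracket (e a) (e b)) y)
      (u := fun c => g.coframe e c ξ)
      (fun a c b => (ho.smoothFnOn_coframe c
        ((ho.smoothOn a).bracket (ho.smoothOn b) V.isOpen)).neg) hsm
      (fun z hz a c => ho.dirDeriv_coframe_of_bracket_eq_zero (hs.diffAt V.isOpen hz) a c
        (he.bracket_eq_zero V.isOpen hs hK hz a)) h
    filter_upwards [h1] with z hz
    exact ho.ext_coframe (Y := 0) fun c => by rw [hz c]; simp [coframe, inn]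
  -- The set of points near which `ξ` vanishes is open. It is also closed in `V`: at a limit point
  -- in `V` the components vanish by continuity, and uniqueness for the system gives a
  -- neighbourhood.
  have hsub : (V : Set M) ⊆ {y | ∀ᶠ z in 𝓝 y, ξ z = 0} := by
    refine hV.subset_of_closure_inter_subset isOpen_setOfPred_eventually_nhds
      ⟨p, hp, hnear p hp (hco h0)⟩ ?_
    rintro y ⟨hy, hyV⟩
    refine hnear y hyV fun c => ?_
    by_contra hne
    have h1 := ((hsm c).mdifferentiableAt V.isOpen hyV).continuousAt.eventually_ne hne
    obtain ⟨z, hz, hz'⟩ := ((mem_closure_iff_frequently.1 hy).and_eventually h1).exists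
    exact hz' (hco hz.self_of_nhds c)
  funext y
  by_cases hy : y ∈ V
  · exact (hsub hy).self_of_nhds
  · exact hz y hy

/-- The value at `p` of the Killing fields on `V`. -/
def killingEval (g : LorentzMetric M) (V : TopologicalSpace.Opens M) (p : M) :
    g.killingFields V →ₗ[ℝ] TangentSpace (𝓡 4) p :=
  (LinearMap.proj p).comp (g.killingFields V).subtype

theorem IsRiemannFrame.killingEval_injective (he : g.IsRiemannFrame e)
    {V : TopologicalSpace.Opens M} (hV : IsPreconnected (V : Set M)) {p : M} (hp : p ∈ V) :
    Function.Injective (killingEval g V p) := by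
  rw [injective_iff_map_eq_zero]
  intro ξ hξ
  exact Subtype.ext (he.eq_zero_of_apply_eq_zero hV ξ.2 hp hξ)

theorem finrank_tangentSpace (p : M) : Module.finrank ℝ (TangentSpace (𝓡 4) p) = 4 := by
  change Module.finrank ℝ (EuclideanSpace ℝ (Fin 4)) = 4
  simp

/-- Under the convention of extension by zero, a restriction to `V` must be cut off outside `V`; the
Killing equation persists because it is local. -/
theorem exists_killingField_restrict {U V : TopologicalSpace.Opens M} (hVU : V ≤ U) {p : M}
    (hp : p ∈ V) (hξ : ξ ∈ g.killingFields U) : ∃ ζ ∈ g.killingFields V, ζ p = ξ p := by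
  classical
  have heq : ∀ x ∈ V, (fun x => if x ∈ V then ξ x else 0 : VField M) x = ξ x :=
    fun x hx => if_pos hx
  refine ⟨fun x => if x ∈ V then ξ x else 0, ⟨(hξ.1.mono hVU).congr heq, fun x hx X Y hX hY => ?_,
    fun x hx => if_neg hx⟩, heq p hp⟩
  have hb (Z : VField M) : bracket (fun x => if x ∈ V then ξ x else 0) Z x = bracket ξ Z x :=
    bracket_congr V.isOpen hx heq fun _ _ => rfl
  have h1 := hξ.2.1 x (hVU hx) X Y hX hY
  rw [dirDeriv] at h1 ⊢
  rw [if_pos hx, h1, inn_congr (hb X) rfl, inn_congr rfl (hb Y)]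

/-- On a connected open set evaluation at `p` is an injective linear map into a 4-dimensional space,
so surjectivity and dimension 4 are the same condition. -/
theorem IsRiemannFrame.hasIsometryGroupOfDim_iff (he : g.IsRiemannFrame e) :
    g.HasIsometryGroupOfDim 4 ↔ g.LocallyHomogeneous := by
  refine ⟨fun h p => ?_, fun h p => ?_⟩
  · obtain ⟨U, hpU, hU⟩ := h p
    have : LocallyConnectedSpace M :=
      ChartedSpace.locallyConnectedSpace (EuclideanSpace ℝ (Fin 4)) M
    -- The dimension is prescribed only for connected neighbourhoods, so one is cut out of `U`.
    let V : TopologicalSpace.Opens M := ⟨connectedComponentIn U p, U.isOpen.connectedComponentIn⟩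
    have hpV : p ∈ V := mem_connectedComponentIn hpU
    have hVc : IsConnected (V : Set M) := isConnected_connectedComponentIn_iff.2 hpU
    have hfin := hU V (connectedComponentIn_subset U p) hpV hVc
    -- An infinite-dimensional space would have `finrank` equal to `0`, so the value 4 implies
    -- finiteness.
    have : FiniteDimensional ℝ (g.killingFields V) :=
      Module.finite_of_finrank_pos (by rw [hfin]; norm_num)
    have : FiniteDimensional ℝ (TangentSpace (𝓡 4) p) :=
      Module.finite_of_finrank_pos (by rw [finrank_tangentSpace]; norm_num)
    have hsurj : Function.Surjective (killingEval g V p) :=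
      (LinearMap.injective_iff_surjective_of_finrank_eq_finrank
        (hfin.trans (finrank_tangentSpace p).symm)).1
        (he.killingEval_injective hVc.isPreconnected hpV)
    refine ⟨V, hpV, fun v => ?_⟩
    obtain ⟨ξ, hξ⟩ := hsurj v
    exact ⟨ξ, ξ.2, hξ⟩
  · obtain ⟨U, hpU, hU⟩ := h p
    refine ⟨U, hpU, fun V hVU hpV hVc => ?_⟩
    have hsurj : Function.Surjective (killingEval g V p) := by
      intro v
      obtain ⟨ξ, hξ, hξp⟩ := hU v
      obtain ⟨ζ, hζ, hζp⟩ := exists_killingField_restrict hVU hpV hξ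
      exact ⟨⟨ζ, hζ⟩, hζp.trans hξp⟩
    exact (LinearEquiv.ofBijective _ ⟨he.killingEval_injective hVc.isPreconnected hpV,
      hsurj⟩).finrank_eq.trans (finrank_tangentSpace p)

end LorentzMetric

end Killing

end Spacetime

end

theorem theorem1 {M : Type*} [TopologicalSpace M] [ChartedSpace (EuclideanSpace ℝ (Fin 4)) M]
    [IsManifold (𝓡 4) ∞ M] [T2Space M] [ConnectedSpace M]
    (g : Spacetime.LorentzMetric M) (e : Fin 4 → Spacetime.VField M) (he : g.IsRiemannFrame e) :
    (g.HasIsometryGroupOfDim 4 ↔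
      ∀ X : Fin 4 → Spacetime.VField M, (∀ i, Spacetime.Smooth (X i)) →
        ∀ x, g.concomitant e X x = 0) ∧
    (g.HasIsometryGroupOfDim 4 ↔ g.LocallyHomogeneous) ∧
    (g.HasIsometryGroupOfDim 4 ↔
      ∀ c a b : Fin 4, ∃ k : ℝ, ∀ x, g.connCoeff e c a b x = k) := by
  have h1 := he.hasIsometryGroupOfDim_iff
  have h2 := he.toIsOrthonormalFrame.concomitant_eq_zero_iff
  have h3 : g.LocallyHomogeneous ↔ ∀ c a b : Fin 4, ∃ k : ℝ, ∀ x, g.connCoeff e c a b x = k :=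
    ⟨he.connCoeff_const, he.toIsOrthonormalFrame.locallyHomogeneous_of_const⟩
  exact ⟨(h1.trans h3).trans h2.symm, h1, h1.trans h3⟩
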